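/- Let $K$ be a non-archimedean local field (of any characteristic) with ring of integers $\mathcal{O}_K$, uniformizer $\pi_K$, and let $\mathfrak{A}=\mathbb{M}_2(K)$. A full lattice in $\mathfrak{A}$ is a finitely generated $\mathcal{O}_K$-submodule spanning $\mathfrak{A}$ over $K$; a full order is a subring of $\mathfrak{A}$ containing $\mathcal{O}_K$ that is a full lattice. A full order $R$ is Gorenstein if its codifferent $\{a\in\mathfrak{A} : \mathrm{tr}(aR)\subseteq\mathcal{O}_K\}$ is invertible as a two-sided fractional $R$-ideal, and a full order $B$ is Bass if every full order $R\supseteq B$ is Gorenstein. Two maximal orders are neighbors if, in some basis, they are $$\begin{pmatrix}\mathcal{O}_K&\mathcal{O}_K\\ \mathcal{O}_K&\mathcal{O}_K\end{pmatrix}\quad\text{and}\quad\begin{pmatrix}\mathcal{O}_K&\pi_K^{-1}\mathcal{O}_K\\ \pi_K\mathcal{O}_K&\mathcal{O}_K\end{pmatrix};$$ this makes the set of maximal orders into a graph, the Bruhat--Tits tree. An Eichler order of level $d$ is the intersection of two maximal orders at distance $d$ in this graph. For a subalgebra $\mathfrak{L}\subseteq\mathfrak{A}$ isomorphic to a quadratic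 field extension $L/K$ (possibly inseparable), $\mathcal{O}_{\mathfrak{L}}$ denotes its ring of integers; $L/K$ is unramified if its ramification index is $1$ and ramified otherwise. Let $B$ be a Bass order in $\mathfrak{A}$. Then precisely one of the following conditions holds: (E1) $B$ is contained in a unique maximal order $D$, and $B=\mathcal{O}_{\mathfrak{L}}+\pi_K^rD$ for some integer $r\ge 0$ and some two-dimensional subalgebra $\mathfrak{L}\subseteq\mathfrak{A}$ that is isomorphic to an unramified quadratic extension $L/K$ and satisfies $\mathcal{O}_{\mathfrak{L}}\subseteq D$. (E2) $B$ is contained in two neighboring maximal orders $D_1$ and $D_2$, and $B=\mathcal{O}_{\mathfrak{L}}+\pi_{\mathfrak{L}}^r(D_1\cap D_2)$ for some integer $r\ge 0$, some subalgebra $\mathfrak{L}\subseteq\mathfrak{A}$ that is isomorphic to a ramified quadratic extension $L/K$ and satisfies $\mathcal{O}_{\mathfrak{L}}\subseteq D_1\cap D_2$, and some uniformizer $\pi_{\mathfrak{L}}$ of $\mathcal{O}_{\mathfrak{L}}$. (E3) $B$ is an Eichler order of level $d$ for some $d\ge 2$. Conversely, every full order $B\subseteq\mathfrak{A}$ satisfying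 one of these conditions is a Bass order. -/

import Mathlib

open ValuativeRel
open scoped Matrix

namespace BassOrders

universe u

section Lattices

variable (K : Type u) [Field K] [ValuativeRel K]

/-- The matrix algebra `M₂(K)`. -/
abbrev Mat : Type u := Matrix (Fin 2) (Fin 2) K

variable {K}

/-- A full `𝒪[K]`-lattice in `M₂(K)`: a finitely generated `𝒪[K]`-submodule spanning `M₂(K)`
over `K`. -/
def IsFullLattice (M : Submodule 𝒪[K] (Mat K)) : Prop :=
  M.FG ∧ Submodule.span K (M : Set (Mat K)) = ⊤

/-- A full order in `M₂(K)`: a subring containing `𝒪[K]` which is a full lattice. -/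
def IsFullOrder (R : Subalgebra 𝒪[K] (Mat K)) : Prop :=
  IsFullLattice (Subalgebra.toSubmodule R)

/-- A maximal order: a full order that is maximal among full orders with respect to inclusion. -/
def IsMaximalOrder (D : Subalgebra 𝒪[K] (Mat K)) : Prop :=
  Maximal IsFullOrder D

/-- The codifferent `{a ∈ M₂(K) | tr(aR) ⊆ 𝒪[K]}`. -/
def codifferent (R : Subalgebra 𝒪[K] (Mat K)) : Submodule 𝒪[K] (Mat K) where
  carrier := {a | ∀ x ∈ R, (a * x).trace ∈ 𝒪[K]}
  zero_mem' := by
    intro x _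
    simp
  add_mem' := by
    intro a b ha hb x hx
    rw [add_mul, Matrix.trace_add]
    exact add_mem (ha x hx) (hb x hx)
  smul_mem' := by
    intro c a ha x hx
    rw [smul_mul_assoc, Matrix.trace_smul, Algebra.smul_def]
    exact mul_mem c.2 (ha x hx)

/-- A two-sided fractional `R`-ideal: a full lattice stable under left and right multiplication
by `R`. -/
def IsTwoSidedFractionalIdeal (R : Subalgebra 𝒪[K] (Mat K)) (I : Submodule 𝒪[K] (Mat K)) :
    Prop :=
  IsFullLattice I ∧ ∀ x ∈ R, ∀ a ∈ I, x * a ∈ I ∧ a * x ∈ I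

/-- `I` is an invertible two-sided fractional `R`-ideal (products are products of
`𝒪[K]`-submodules of `M₂(K)`). -/
def IsInvertibleIdeal (R : Subalgebra 𝒪[K] (Mat K)) (I : Submodule 𝒪[K] (Mat K)) : Prop :=
  IsTwoSidedFractionalIdeal R I ∧
    ∃ J : Submodule 𝒪[K] (Mat K), IsTwoSidedFractionalIdeal R J ∧
      I * J = Subalgebra.toSubmodule R ∧ J * I = Subalgebra.toSubmodule R

/-- A Gorenstein order: a full order whose codifferent is invertible. -/
def IsGorenstein (R : Subalgebra 𝒪[K] (Mat K)) : Prop :=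
  IsFullOrder R ∧ IsInvertibleIdeal R (codifferent R)

/-- A Bass order: a full order all of whose overorders are Gorenstein. -/
def IsBass (B : Subalgebra 𝒪[K] (Mat K)) : Prop :=
  IsFullOrder B ∧ ∀ R : Subalgebra 𝒪[K] (Mat K), IsFullOrder R → B ≤ R → IsGorenstein R

end Lattices

section Tree

variable {K : Type u} [Field K] [ValuativeRel K]

/-- `x` lies in the order `M₂(𝒪[K])`. -/
def MemStd (x : Mat K) : Prop :=
  ∀ i j, x i j ∈ 𝒪[K]

/-- `x` lies in the order with rows `(𝒪, π⁻¹𝒪)` and `(π𝒪, 𝒪)`, where `𝒪 = 𝒪[K]`. -/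
def MemNbr (π : 𝒪[K]) (x : Mat K) : Prop :=
  x 0 0 ∈ 𝒪[K] ∧ (∃ b ∈ 𝒪[K], x 0 1 = (π : K)⁻¹ * b) ∧
    (∃ c ∈ 𝒪[K], x 1 0 = (π : K) * c) ∧ x 1 1 ∈ 𝒪[K]

/-- Two orders are neighbors if in some basis (that is, after a common conjugation)
they are `M₂(𝒪)` and the order with rows `(𝒪, π⁻¹𝒪)` and `(π𝒪, 𝒪)`,
with `π` a uniformizer of `K`. -/
def AreNeighbors (D D' : Subalgebra 𝒪[K] (Mat K)) : Prop :=
  ∃ π : 𝒪[K], Irreducible π ∧ ∃ g : GL (Fin 2) K,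
    (∀ x : Mat K, x ∈ D ↔ MemStd ((g⁻¹ : GL (Fin 2) K).1 * x * g.1)) ∧
    (∀ x : Mat K, x ∈ D' ↔ MemNbr π ((g⁻¹ : GL (Fin 2) K).1 * x * g.1))

theorem AreNeighbors.symm {D D' : Subalgebra 𝒪[K] (Mat K)} (h : AreNeighbors D D') :
    AreNeighbors D' D := by
  obtain ⟨π, hπ, g, h1, h2⟩ := h
  have h0 : (π : K) ≠ 0 := by
    intro h
    exact hπ.ne_zero (Subtype.ext h)
  let m : GL (Fin 2) K :=
    ⟨!![0, 1; (π : K), 0], !![0, (π : K)⁻¹; 1, 0],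
      by ext i j; fin_cases i <;> fin_cases j <;> simp [Matrix.mul_apply, h0],
      by ext i j; fin_cases i <;> fin_cases j <;> simp [Matrix.mul_apply, h0]⟩
  have key : ∀ y : Mat K, (m⁻¹ : GL (Fin 2) K).1 * y * m.1 =
      !![y 1 1, (π : K)⁻¹ * y 1 0; (π : K) * y 0 1, y 0 0] := by
    intro y
    change !![0, (π : K)⁻¹; 1, 0] * y * !![0, 1; (π : K), 0] = _
    ext i j
    fin_cases i <;> fin_cases j <;>
      simp [Matrix.mul_apply, Matrix.vecMul, dotProduct, Fin.sum_univ_two, h0, mul_comm]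
  have conj : ∀ x : Mat K, ((g * m)⁻¹ : GL (Fin 2) K).1 * x * (g * m).1 =
      (m⁻¹ : GL (Fin 2) K).1 * ((g⁻¹ : GL (Fin 2) K).1 * x * g.1) * m.1 := by
    intro x
    rw [mul_inv_rev]
    simp only [Units.val_mul, mul_assoc]
  refine ⟨π, hπ, g * m, fun x => ?_, fun x => ?_⟩
  · rw [h2, conj, key]
    generalize (g⁻¹ : GL (Fin 2) K).1 * x * g.1 = y
    constructor
    · rintro ⟨ha, ⟨b, hb, hb'⟩, ⟨c, hc, hc'⟩, hd⟩ i j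
      fin_cases i <;> fin_cases j <;> simp [ha, hd, hb', hc', h0, hb, hc]
    · intro h
      refine ⟨by simpa using h 1 1, ⟨_, h 1 0, by simp [h0]⟩, ⟨_, h 0 1, by simp [h0]⟩,
        by simpa using h 0 0⟩
  · rw [h1, conj, key]
    generalize (g⁻¹ : GL (Fin 2) K).1 * x * g.1 = y
    constructor
    · intro h
      exact ⟨h 1 1, ⟨_, h 1 0, rfl⟩, ⟨_, h 0 1, rfl⟩, h 0 0⟩
    · rintro ⟨ha, ⟨b, hb, hb'⟩, ⟨c, hc, hc'⟩, hd⟩ i j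
      have e1 : y 1 0 = b := by simpa [h0] using hb'
      have e2 : y 0 1 = c := by simpa [h0] using hc'
      simp at ha hd
      fin_cases i <;> fin_cases j <;> simp [ha, hd, e1, e2, hb, hc]

theorem AreNeighbors.ne {D D' : Subalgebra 𝒪[K] (Mat K)} (h : AreNeighbors D D') :
    D ≠ D' := by
  rintro rfl
  obtain ⟨π, hπ, g, h1, h2⟩ := h
  have h0 : (π : K) ≠ 0 := by
    intro h
    exact hπ.ne_zero (Subtype.ext h)
  have e : (g⁻¹ : GL (Fin 2) K).1 * (g.1 * !![0, (π : K)⁻¹; 0, 0] * (g⁻¹ : GL (Fin 2) K).1) * g.1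
      = !![0, (π : K)⁻¹; 0, 0] := by
    simp only [mul_assoc, Units.inv_mul, mul_one]
    rw [← mul_assoc, Units.inv_mul, one_mul]
  have hm : MemNbr π (!![0, (π : K)⁻¹; 0, 0] : Mat K) :=
    ⟨by simp, ⟨1, one_mem _, by simp⟩, ⟨0, zero_mem _, by simp⟩, by simp⟩
  rw [← e, ← h2, h1, e] at hm
  have hinv : (π : K)⁻¹ ∈ 𝒪[K] := by simpa using hm 0 1
  refine hπ.not_isUnit (IsUnit.of_mul_eq_one (⟨(π : K)⁻¹, hinv⟩ : 𝒪[K]) (Subtype.ext ?_))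
  simp [h0]

variable (K) in
/-- The Bruhat–Tits tree of `K`: its vertices are the maximal orders of `M₂(K)`. -/
def bruhatTits : SimpleGraph {D : Subalgebra 𝒪[K] (Mat K) // IsMaximalOrder D} where
  Adj D D' := AreNeighbors D.1 D'.1
  symm := ⟨fun _ _ h => h.symm⟩
  loopless := ⟨fun _ h => h.ne rfl⟩

/-- `E` is an Eichler order of level `d`: the intersection of two maximal orders at distance `d`
in the Bruhat–Tits tree. -/
def IsEichlerOfLevel (E : Subalgebra 𝒪[K] (Mat K)) (d : ℕ) : Prop :=
  ∃ D₁ D₂ : {D : Subalgebra 𝒪[K] (Mat K) // IsMaximalOrder D},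
    (bruhatTits K).Reachable D₁ D₂ ∧ (bruhatTits K).dist D₁ D₂ = d ∧ E = D₁.1 ⊓ D₂.1

end Tree

section Conditions

variable (K : Type u) [Field K] [ValuativeRel K]

/-- The quadratic extension `L/K` is unramified: `𝓂[K]` generates the maximal ideal of the ring
of integers `𝒪_L` (the integral closure of `𝒪[K]` in `L`), i.e. `e(L/K) = 1`. -/
def IsUnramifiedQuadratic (L : Type u) [Field L] [Algebra K L] : Prop :=
  Module.finrank K L = 2 ∧
    (Ideal.map (algebraMap 𝒪[K] (integralClosure 𝒪[K] L)) 𝓂[K]).IsMaximal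

/-- The quadratic extension `L/K`, possibly inseparable, is ramified: `e(L/K) ≠ 1`. -/
def IsRamifiedQuadratic (L : Type u) [Field L] [Algebra K L] : Prop :=
  Module.finrank K L = 2 ∧
    ¬ (Ideal.map (algebraMap 𝒪[K] (integralClosure 𝒪[K] L)) 𝓂[K]).IsMaximal

variable {K}

/-- Condition (E1). The subalgebra of `M₂(K)` isomorphic to `L` is given as the image of an
embedding `φ` of `L`; its ring of integers is `φ(𝒪_L)`. -/
def CondE1 (B : Subalgebra 𝒪[K] (Mat K)) : Prop :=
  ∃ D : Subalgebra 𝒪[K] (Mat K), IsMaximalOrder D ∧ B ≤ D ∧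
    (∀ D' : Subalgebra 𝒪[K] (Mat K), IsMaximalOrder D' → B ≤ D' → D' = D) ∧
    ∃ (L : Type u) (_ : Field L) (_ : Algebra K L) (φ : L →ₐ[K] Mat K),
      IsUnramifiedQuadratic K L ∧
      (∀ a ∈ integralClosure 𝒪[K] L, φ a ∈ D) ∧
      ∃ (π : 𝒪[K]) (r : ℕ), Irreducible π ∧
        ∀ x : Mat K, x ∈ B ↔ ∃ a ∈ integralClosure 𝒪[K] L, ∃ y ∈ D, x = φ a + π ^ r • y

/-- Condition (E2), with the same convention on subalgebras as in (E1);
`ϖ` is a uniformizer of `𝒪_L`. -/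
def CondE2 (B : Subalgebra 𝒪[K] (Mat K)) : Prop :=
  ∃ D₁ D₂ : Subalgebra 𝒪[K] (Mat K), IsMaximalOrder D₁ ∧ IsMaximalOrder D₂ ∧
    AreNeighbors D₁ D₂ ∧ B ≤ D₁ ∧ B ≤ D₂ ∧
    ∃ (L : Type u) (_ : Field L) (_ : Algebra K L) (φ : L →ₐ[K] Mat K),
      IsRamifiedQuadratic K L ∧
      (∀ a ∈ integralClosure 𝒪[K] L, φ a ∈ D₁ ⊓ D₂) ∧
      ∃ (ϖ : integralClosure 𝒪[K] L) (r : ℕ), Irreducible ϖ ∧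
        ∀ x : Mat K, x ∈ B ↔
          ∃ a ∈ integralClosure 𝒪[K] L, ∃ y ∈ D₁ ⊓ D₂, x = φ a + φ (ϖ : L) ^ r * y

/-- Condition (E3). -/
def CondE3 (B : Subalgebra 𝒪[K] (Mat K)) : Prop :=
  ∃ d : ℕ, 2 ≤ d ∧ IsEichlerOfLevel B d

end Conditions

end BassOrders

/-!
Every element `x` of an order in `M₂(K)` satisfies `x² - tx + n = 0` with `t = tr x` and `n = det x`
in `𝒪 = 𝒪[K]`. The classification separates orders by the existence of an element of one of three
kinds: *split* (`t` is a unit and `n` is not), *unramified* (`X² - tX + n` is irreducible over the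
residue field) and *Eisenstein* (`t` is a nonunit and `n` a uniformizer). All three properties pass
to overorders.

*A Bass order contains such an element* (`IsBass.exists_element`). Otherwise every `x ∈ B` is a
scalar plus an element of `π M`, where `M = {m | πm ∈ B, tr m ∈ 𝒪, det m ∈ 𝒪}` turns out to be a
lattice closed under squaring. A finitely generated module that contains `1` and is closed under
squaring generates a finitely generated algebra (`exists_subalgebra_of_sq_mem`), so `M` lies in a
full order `R` and `B ≤ 𝒪 + πR`. But `𝒪 + πR` is never Gorenstein
(`not_isGorenstein_scalarOrder`): it is local, so an invertible codifferent would be principal,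
which makes `R` generated by two elements modulo `π`, whereas it has rank four.

*Orders containing such an element are explicit, and Gorenstein.*
* A split element yields an idempotent by Hensel's lemma, so up to conjugation the order has rows
  `(𝒪, 𝒪)` and `(π^d 𝒪, 𝒪)`: it is an Eichler order
  (`HasSplitElement.exists_eq_conjOrder_eichler`).
* For an unramified or, in the absence of split elements, an Eisenstein element `θ`, one may
  conjugate so that `θ` becomes a companion matrix and `B ≤ 𝔄`, where `𝔄` is `M₂(𝒪)` in the
  unramified case and the Eichler order of level one in the Eisenstein case. The quotient
  `𝔄 / 𝒪[θ]` is free of rank one over the discrete valuation ring `𝒪[θ]`, so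
  `B = 𝒪[θ] + ϖ^r 𝔄` for a uniformizer `ϖ` of `𝒪[θ]` (`exists_isBasicOrder`).

In each case a form `(x, y) ↦ tr(cxy)` makes the order self-dual, so its codifferent is principal.

*Translation into the conditions.* `𝒪[θ]` is the ring of integers of `K[θ]`, so basic orders satisfy
(E1) or (E2). Eichler orders of level zero and one contain an unramified, respectively an
Eisenstein, element and satisfy (E1), respectively (E2). Conversely an order satisfying one of the
conditions contains an element of the corresponding kind: for (E1) by Nakayama's lemma applied to
`𝒪_L`, for (E2) by Hensel's lemma. The conditions exclude each other because an unramified element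
lies in only one maximal order, and an Eichler order of level at least two has no Eisenstein
element. Distances in the tree are computed from the Cartan decomposition.
-/

namespace BassOrders

universe u

/-! ### Conjugates of the standard maximal order -/

section

variable {K : Type u} [Field K] [ValuativeRel K]

theorem mat_ext {A : Type*} {x y : Matrix (Fin 2) (Fin 2) A} (h00 : x 0 0 = y 0 0)
    (h01 : x 0 1 = y 0 1) (h10 : x 1 0 = y 1 0) (h11 : x 1 1 = y 1 1) : x = y := by
  ext i j
  match i, j with
  | 0, 0 => exact h00
  | 0, 1 => exact h01
  | 1, 0 => exact h10
  | 1, 1 => exact h11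

theorem memStd_iff {x : Mat K} :
    MemStd x ↔ x 0 0 ∈ 𝒪[K] ∧ x 0 1 ∈ 𝒪[K] ∧ x 1 0 ∈ 𝒪[K] ∧ x 1 1 ∈ 𝒪[K] := by
  simp only [MemStd, Fin.forall_fin_two, and_assoc]

/-- Conjugation `x ↦ g x g⁻¹` on `M₂(K)`. -/
noncomputable def conj (g : GL (Fin 2) K) : Mat K ≃ₐ[𝒪[K]] Mat K where
  toFun x := g.1 * x * (g⁻¹ : GL (Fin 2) K).1
  invFun x := (g⁻¹ : GL (Fin 2) K).1 * x * g.1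
  left_inv x := by simp [mul_assoc]
  right_inv x := by simp [mul_assoc]
  map_mul' x y := by simp [mul_assoc]
  map_add' x y := by simp [mul_add, add_mul]
  commutes' r := by
    rw [Algebra.algebraMap_eq_smul_one]
    simp

theorem conj_apply (g : GL (Fin 2) K) (x : Mat K) :
    conj g x = g.1 * x * (g⁻¹ : GL (Fin 2) K).1 := rfl

theorem conj_symm_apply (g : GL (Fin 2) K) (x : Mat K) :
    (conj g).symm x = (g⁻¹ : GL (Fin 2) K).1 * x * g.1 := rfl

theorem conj_symm_eq (g : GL (Fin 2) K) : (conj g).symm = conj g⁻¹ := by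
  ext1 x
  rw [conj_symm_apply, conj_apply, inv_inv]

theorem conj_mul (g h : GL (Fin 2) K) (x : Mat K) : conj (g * h) x = conj g (conj h x) := by
  simp [conj_apply, mul_assoc]

theorem conj_symm_mul (g h : GL (Fin 2) K) (x : Mat K) :
    (conj (g * h)).symm x = (conj h).symm ((conj g).symm x) := by
  simp [conj_symm_apply, mul_assoc]

@[simp] theorem trace_conj (g : GL (Fin 2) K) (x : Mat K) : (conj g x).trace = x.trace :=
  Matrix.trace_units_conj g x

@[simp] theorem det_conj (g : GL (Fin 2) K) (x : Mat K) : (conj g x).det = x.det :=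
  Matrix.det_units_conj g x

@[simp] theorem trace_conj_symm (g : GL (Fin 2) K) (x : Mat K) :
    ((conj g).symm x).trace = x.trace := by
  rw [conj_symm_eq, trace_conj]

@[simp] theorem det_conj_symm (g : GL (Fin 2) K) (x : Mat K) :
    ((conj g).symm x).det = x.det := by
  rw [conj_symm_eq, det_conj]

theorem conj_smul (g : GL (Fin 2) K) (c : K) (x : Mat K) : conj g (c • x) = c • conj g x := by
  simp [conj_apply]

/-- Conjugation as an automorphism of the `K`-algebra `M₂(K)`. -/
noncomputable def conjHom (g : GL (Fin 2) K) : Mat K →ₐ[K] Mat K :=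
  { (conj g).toAlgHom.toRingHom with
    commutes' := fun c => by
      change conj g (algebraMap K (Mat K) c) = _
      rw [Algebra.algebraMap_eq_smul_one, conj_smul, map_one] }

theorem conjHom_apply (g : GL (Fin 2) K) (x : Mat K) : conjHom g x = conj g x := rfl

/-- The conjugate order `g R g⁻¹`. -/
noncomputable def conjOrder (g : GL (Fin 2) K) (R : Subalgebra 𝒪[K] (Mat K)) :
    Subalgebra 𝒪[K] (Mat K) :=
  R.map (conj g).toAlgHom

theorem mem_conjOrder {g : GL (Fin 2) K} {R : Subalgebra 𝒪[K] (Mat K)} {x : Mat K} :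
    x ∈ conjOrder g R ↔ (conj g).symm x ∈ R := by
  constructor
  · rintro ⟨y, hy, rfl⟩
    exact ((conj g).symm_apply_apply y).symm ▸ hy
  · intro h
    exact ⟨_, h, (conj g).apply_symm_apply x⟩

theorem conj_mem_conjOrder {g : GL (Fin 2) K} {R : Subalgebra 𝒪[K] (Mat K)} {x : Mat K} :
    conj g x ∈ conjOrder g R ↔ x ∈ R := by
  rw [mem_conjOrder, AlgEquiv.symm_apply_apply]

theorem conjOrder_mul (g h : GL (Fin 2) K) (R : Subalgebra 𝒪[K] (Mat K)) :
    conjOrder (g * h) R = conjOrder g (conjOrder h R) := by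
  ext x
  rw [mem_conjOrder, mem_conjOrder, mem_conjOrder, conj_symm_mul]

theorem conjOrder_one (R : Subalgebra 𝒪[K] (Mat K)) : conjOrder 1 R = R := by
  ext x
  simp [mem_conjOrder, conj_symm_apply]

theorem conjOrder_conjOrder_inv (g : GL (Fin 2) K) (R : Subalgebra 𝒪[K] (Mat K)) :
    conjOrder g (conjOrder g⁻¹ R) = R := by
  rw [← conjOrder_mul, mul_inv_cancel, conjOrder_one]

theorem conjOrder_inv_conjOrder (g : GL (Fin 2) K) (R : Subalgebra 𝒪[K] (Mat K)) :
    conjOrder g⁻¹ (conjOrder g R) = R := by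
  rw [← conjOrder_mul, inv_mul_cancel, conjOrder_one]

theorem conjOrder_mono (g : GL (Fin 2) K) {R S : Subalgebra 𝒪[K] (Mat K)} (h : R ≤ S) :
    conjOrder g R ≤ conjOrder g S := Subalgebra.map_mono h

/-- A `K`-linear automorphism carries full lattices to full lattices. -/
theorem IsFullLattice.map {N : Submodule 𝒪[K] (Mat K)} (hN : IsFullLattice N)
    (f : Mat K ≃ₗ[K] Mat K) :
    IsFullLattice (N.map (f.toLinearMap.restrictScalars 𝒪[K])) := by
  refine ⟨hN.1.map _, ?_⟩
  have : ((N.map (f.toLinearMap.restrictScalars 𝒪[K]) : Submodule 𝒪[K] (Mat K)) : Set (Mat K))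
      = f.toLinearMap '' N := by
    ext; simp
  rw [this, Submodule.span_image, hN.2, Submodule.map_top, LinearEquiv.range]

theorem IsFullOrder.conjOrder {R : Subalgebra 𝒪[K] (Mat K)} (hR : IsFullOrder R)
    (g : GL (Fin 2) K) : IsFullOrder (conjOrder g R) := by
  let f : Mat K ≃ₗ[K] Mat K :=
    { conj g with
      map_smul' := fun c x => conj_smul g c x }
  have h := IsFullLattice.map hR f
  exact h

/-- The maximal order `M₂(𝒪[K])`. -/
def stdOrder : Subalgebra 𝒪[K] (Mat K) where
  carrier := {x | MemStd x}
  mul_mem' := by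
    intro a b ha hb i j
    rw [Matrix.mul_apply]
    exact sum_mem fun k _ => mul_mem (ha i k) (hb k j)
  add_mem' := by
    intro a b ha hb i j
    exact add_mem (ha i j) (hb i j)
  algebraMap_mem' := by
    intro r i j
    rw [Algebra.algebraMap_eq_smul_one, Matrix.smul_apply, Matrix.one_apply]
    split_ifs
    · rw [Algebra.smul_def, mul_one]
      exact r.2
    · simp

theorem mem_stdOrder {x : Mat K} : x ∈ stdOrder ↔ MemStd x := Iff.rfl

/-- A finitely generated order stabilises a lattice in `K²`, hence is conjugate to an order
inside `M₂(𝒪[K])`. -/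
theorem exists_le_conjOrder_std [IsDiscreteValuationRing 𝒪[K]] {R : Subalgebra 𝒪[K] (Mat K)}
    (hR : (Subalgebra.toSubmodule R).FG) : ∃ g : GL (Fin 2) K, R ≤ conjOrder g stdOrder := by
  let ev (v : Fin 2 → K) : Mat K →ₗ[𝒪[K]] (Fin 2 → K) :=
    { toFun := fun x => x *ᵥ v
      map_add' := fun x y => Matrix.add_mulVec x y v
      map_smul' := fun c x => Matrix.smul_mulVec c x v }
  let Λ : Submodule 𝒪[K] (Fin 2 → K) :=
    (Subalgebra.toSubmodule R).map (ev (Pi.single 0 1)) ⊔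
      (Subalgebra.toSubmodule R).map (ev (Pi.single 1 1))
  have hfg : Λ.FG := (hR.map _).sup (hR.map _)
  have hstab : ∀ x ∈ R, ∀ l ∈ Λ, x *ᵥ l ∈ Λ := by
    intro x hx l hl
    obtain ⟨_, ⟨y, hy, rfl⟩, _, ⟨z, hz, rfl⟩, rfl⟩ := Submodule.mem_sup.1 hl
    rw [Matrix.mulVec_add]
    refine Submodule.add_mem_sup ⟨x * y, R.mul_mem hx hy, ?_⟩ ⟨x * z, R.mul_mem hx hz, ?_⟩
    · exact (Matrix.mulVec_mulVec (Pi.single 0 1) x y).symm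
    · exact (Matrix.mulVec_mulVec (Pi.single 1 1) x z).symm
  have hunit : ∀ j : Fin 2, (Pi.single j 1 : Fin 2 → K) ∈ Λ := by
    intro j
    fin_cases j
    · exact Submodule.mem_sup_left ⟨1, one_mem R, Matrix.one_mulVec _⟩
    · exact Submodule.mem_sup_right ⟨1, one_mem R, Matrix.one_mulVec _⟩
  have : Module.Finite 𝒪[K] Λ := Module.Finite.iff_fg.2 hfg
  let b := Module.Free.chooseBasis 𝒪[K] Λ
  have hli : LinearIndependent K (fun i => (b i : Fin 2 → K)) := by
    rw [← LinearIndependent.iff_fractionRing 𝒪[K] K]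
    exact b.linearIndependent.map' Λ.subtype (Submodule.ker_subtype _)
  have hspan : ⊤ ≤ Submodule.span K (Set.range fun i => (b i : Fin 2 → K)) := by
    have h1 : ∀ l ∈ Λ, l ∈ Submodule.span K (Set.range fun i => (b i : Fin 2 → K)) := by
      intro l hl
      have h2 := b.sum_repr ⟨l, hl⟩
      have h3 := congrArg Λ.subtype h2
      rw [map_sum] at h3
      simp only [Submodule.subtype_apply, map_smul] at h3
      rw [← h3]
      refine sum_mem fun i _ => ?_
      rw [← algebraMap_smul K (b.repr ⟨l, hl⟩ i) (b i : Fin 2 → K)]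
      exact Submodule.smul_mem _ _ (Submodule.subset_span ⟨i, rfl⟩)
    intro l _
    have : l = l 0 • (Pi.single 0 1 : Fin 2 → K) + l 1 • (Pi.single 1 1 : Fin 2 → K) := by
      ext i; fin_cases i <;> simp
    rw [this]
    exact add_mem (Submodule.smul_mem _ _ (h1 _ (hunit 0)))
      (Submodule.smul_mem _ _ (h1 _ (hunit 1)))
  let bK := Module.Basis.mk hli hspan
  have hcard : Fintype.card (Module.Free.ChooseBasisIndex 𝒪[K] Λ) = 2 := by
    have := Module.finrank_eq_card_basis bK
    simpa using this.symm
  let e : Module.Free.ChooseBasisIndex 𝒪[K] Λ ≃ Fin 2 := Fintype.equivFinOfCardEq hcard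
  let b2 := b.reindex e
  let bK2 := bK.reindex e
  have hb2 : ∀ i, bK2 i = (b2 i : Fin 2 → K) := by
    intro i
    simp [bK2, bK, b2]
  let P : Mat K := (Pi.basisFun K (Fin 2)).toMatrix bK2
  have hP : ∀ i j, P i j = (b2 j : Fin 2 → K) i := by
    intro i j
    simp [P, Module.Basis.toMatrix_apply, hb2]
  let _ : Invertible P := (Pi.basisFun K (Fin 2)).invertibleToMatrix bK2
  refine ⟨unitOfInvertible P, fun x hx => ?_⟩
  rw [mem_conjOrder, mem_stdOrder, conj_symm_apply]
  let c : Mat K := fun i j => (b2.repr ⟨x *ᵥ (b2 j : Fin 2 → K), hstab x hx _ (b2 j).2⟩ i : 𝒪[K])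
  have hxP : x * P = P * c := by
    ext i j
    have h2 := b2.sum_repr ⟨x *ᵥ (b2 j : Fin 2 → K), hstab x hx _ (b2 j).2⟩
    have h3 := congrFun (congrArg Λ.subtype h2) i
    rw [map_sum, Fin.sum_univ_two] at h3
    simp only [Submodule.subtype_apply, map_smul, Pi.add_apply, Pi.smul_apply] at h3
    have hx2 : (x *ᵥ (b2 j : Fin 2 → K)) i = (x * P) i j := by
      simp [Matrix.mulVec, dotProduct, Matrix.mul_apply, hP]
    rw [← hx2, ← h3, Matrix.mul_apply, Fin.sum_univ_two, hP, hP]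
    simp only [Algebra.smul_def, c]
    rw [mul_comm, mul_comm (algebraMap _ _ _)]
    rfl
  have : ((unitOfInvertible P)⁻¹ : GL (Fin 2) K).1 * x * (unitOfInvertible P).1 = c := by
    rw [mul_assoc, val_unitOfInvertible, hxP, ← mul_assoc]
    change ⅟P * P * c = c
    rw [invOf_mul_self, one_mul]
  rw [this]
  intro i j
  exact (b2.repr ⟨x *ᵥ (b2 j : Fin 2 → K), hstab x hx _ (b2 j).2⟩ i).2

end

/-! ### Maximal orders up to conjugation -/

section

variable {K : Type u} [Field K] [ValuativeRel K]

theorem isFullOrder_stdOrder : IsFullOrder (stdOrder : Subalgebra 𝒪[K] (Mat K)) := by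
  constructor
  · let f : Matrix (Fin 2) (Fin 2) 𝒪[K] →ₗ[𝒪[K]] Mat K :=
      (Algebra.linearMap 𝒪[K] K).mapMatrix
    have : Subalgebra.toSubmodule (stdOrder : Subalgebra 𝒪[K] (Mat K)) = LinearMap.range f := by
      ext x
      constructor
      · intro h
        exact ⟨fun i j => ⟨x i j, h i j⟩, rfl⟩
      · rintro ⟨y, rfl⟩ i j
        exact (y i j).2
    rw [this]
    exact Module.Finite.iff_fg.1 (Module.Finite.range f)
  · rw [eq_top_iff]
    intro x _
    rw [Matrix.matrix_eq_sum_single x]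
    refine sum_mem fun i _ => sum_mem fun j _ => ?_
    have : Matrix.single i j (x i j) = x i j • Matrix.single i j (1 : K) := by
      rw [Matrix.smul_single, smul_eq_mul, mul_one]
    rw [this]
    refine Submodule.smul_mem _ _ (Submodule.subset_span ?_)
    intro k l
    rw [Matrix.single_apply]
    split_ifs
    · exact one_mem _
    · exact zero_mem _

section Integrality

variable [IsDiscreteValuationRing 𝒪[K]] {R : Subalgebra 𝒪[K] (Mat K)}

theorem trace_mem_integer (hR : (Subalgebra.toSubmodule R).FG) {x : Mat K} (hx : x ∈ R) :
    x.trace ∈ 𝒪[K] := by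
  obtain ⟨g, hg⟩ := exists_le_conjOrder_std hR
  have h := mem_conjOrder.1 (hg hx)
  rw [← trace_conj_symm g, Matrix.trace_fin_two]
  exact add_mem (h 0 0) (h 1 1)

theorem det_mem_integer (hR : (Subalgebra.toSubmodule R).FG) {x : Mat K} (hx : x ∈ R) :
    x.det ∈ 𝒪[K] := by
  obtain ⟨g, hg⟩ := exists_le_conjOrder_std hR
  have h := mem_conjOrder.1 (hg hx)
  rw [← det_conj_symm g, Matrix.det_fin_two]
  exact sub_mem (mul_mem (h 0 0) (h 1 1)) (mul_mem (h 0 1) (h 1 0))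

theorem isMaximalOrder_conjOrder_std (g : GL (Fin 2) K) :
    IsMaximalOrder (conjOrder g stdOrder) := by
  refine ⟨isFullOrder_stdOrder.conjOrder g, fun R hR hle x hx => ?_⟩
  rw [mem_conjOrder]
  intro i j
  have hs : Matrix.single j i (1 : K) ∈ stdOrder := by
    intro k l
    rw [Matrix.single_apply]
    split_ifs
    · exact one_mem _
    · exact zero_mem _
  -- the entries of `x` are traces of products of `x` with matrix units
  have h := trace_mem_integer hR.1 (mul_mem hx (hle (conj_mem_conjOrder.2 hs)))
  rw [← trace_conj_symm g, map_mul, AlgEquiv.symm_apply_apply, Matrix.trace_mul_single] at h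
  simpa using h

/-- Maximal orders are conjugate to `M₂(𝒪[K])`. -/
theorem IsMaximalOrder.exists_eq_conjOrder {D : Subalgebra 𝒪[K] (Mat K)}
    (hD : IsMaximalOrder D) : ∃ g : GL (Fin 2) K, D = conjOrder g stdOrder := by
  obtain ⟨g, hg⟩ := exists_le_conjOrder_std hD.1.1
  exact ⟨g, le_antisymm hg (hD.2 (isFullOrder_stdOrder.conjOrder g) hg)⟩

end Integrality

/-- `k` belongs to the image of `GL₂(𝒪[K])`. -/
def IsIntegralGL (k : GL (Fin 2) K) : Prop :=
  MemStd k.1 ∧ MemStd (k⁻¹ : GL (Fin 2) K).1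

theorem isIntegralGL_of_det {k : GL (Fin 2) K} (hk : MemStd k.1) (hdet : k.1.det⁻¹ ∈ 𝒪[K]) :
    IsIntegralGL k := by
  refine ⟨hk, ?_⟩
  rw [Matrix.coe_units_inv, Matrix.inv_def, Matrix.adjugate_fin_two, Ring.inverse_eq_inv']
  exact memStd_iff.2 ⟨mul_mem hdet (hk 1 1), mul_mem hdet (neg_mem (hk 0 1)),
    mul_mem hdet (neg_mem (hk 1 0)), mul_mem hdet (hk 0 0)⟩

theorem IsIntegralGL.mul {k l : GL (Fin 2) K} (hk : IsIntegralGL k) (hl : IsIntegralGL l) :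
    IsIntegralGL (k * l) := by
  refine ⟨stdOrder.mul_mem hk.1 hl.1, ?_⟩
  rw [mul_inv_rev]
  exact stdOrder.mul_mem hl.2 hk.2

theorem IsIntegralGL.conjOrder_std {k : GL (Fin 2) K} (hk : IsIntegralGL k) :
    conjOrder k stdOrder = stdOrder := by
  ext x
  rw [mem_conjOrder, conj_symm_apply]
  constructor
  · intro h
    have := stdOrder.mul_mem (stdOrder.mul_mem hk.1 h) hk.2
    simpa [mul_assoc] using this
  · intro h
    exact stdOrder.mul_mem (stdOrder.mul_mem hk.2 h) hk.1

/-- The invertible diagonal matrix with entries `a, b`. -/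
def diagGL (a b : K) (ha : a ≠ 0) (hb : b ≠ 0) : GL (Fin 2) K where
  val := !![a, 0; 0, b]
  inv := !![a⁻¹, 0; 0, b⁻¹]
  val_inv := by apply mat_ext <;> simp [ha, hb]
  inv_val := by apply mat_ext <;> simp [ha, hb]

theorem diagGL_val {K : Type*} [Field K] (a b : K) (ha : a ≠ 0) (hb : b ≠ 0) :
    (diagGL a b ha hb).1 = !![a, 0; 0, b] := rfl

theorem conj_diagGL_symm_apply (a b : K) (ha : a ≠ 0) (hb : b ≠ 0) (x : Mat K) :
    (conj (diagGL a b ha hb)).symm x =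
      !![x 0 0, a⁻¹ * x 0 1 * b; b⁻¹ * x 1 0 * a, x 1 1] := by
  rw [conj_symm_apply]
  change !![a⁻¹, 0; 0, b⁻¹] * x * !![a, 0; 0, b] = _
  apply mat_ext <;>
    simp [Matrix.mul_apply, Fin.sum_univ_two, Matrix.vecMul, dotProduct, mul_comm, ha, hb]

theorem conj_symm_eq_of_smul {g h : GL (Fin 2) K} {a : K} (ha : a ≠ 0) (hgh : h.1 = a • g.1)
    (x : Mat K) : (conj h).symm x = (conj g).symm x := by
  have e : h = diagGL a a ha ha * g := by
    ext1
    rw [Units.val_mul, diagGL_val, hgh]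
    apply mat_ext <;> simp [Matrix.mul_apply, Fin.sum_univ_two]
  rw [e, conj_symm_mul]
  congr 1
  rw [conj_diagGL_symm_apply]
  apply mat_ext <;> simp [ha, mul_comm _ a]

theorem conjOrder_std_eq {h g k : GL (Fin 2) K} {a : K} (ha : a ≠ 0)
    (hh : h.1 = a • (g * k).1) (hk : IsIntegralGL k) :
    conjOrder h stdOrder = conjOrder g stdOrder := by
  have h1 : conjOrder h stdOrder = conjOrder (g * k) stdOrder := by
    ext x
    rw [mem_conjOrder, mem_conjOrder, conj_symm_eq_of_smul ha hh]
  rw [h1, conjOrder_mul, hk.conjOrder_std]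

/-- The antidiagonal permutation matrix. -/
def swap : GL (Fin 2) K where
  val := !![0, 1; 1, 0]
  inv := !![0, 1; 1, 0]
  val_inv := by apply mat_ext <;> simp
  inv_val := by apply mat_ext <;> simp

theorem isIntegralGL_swap : IsIntegralGL (swap : GL (Fin 2) K) := by
  constructor <;> refine memStd_iff.2 ⟨?_, ?_, ?_, ?_⟩ <;>
    first | exact zero_mem _ | exact one_mem _

theorem isIntegralGL_one : IsIntegralGL (1 : GL (Fin 2) K) := by
  have : MemStd (1 : Mat K) := one_mem stdOrder
  exact ⟨this, by simpa using this⟩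

theorem swap_mul_mul {K : Type*} [Field K] (a b c d : K) :
    swap.1 * !![a, b; c, d] = !![c, d; a, b] ∧ !![a, b; c, d] * swap.1 = !![b, a; d, c] := by
  constructor <;> apply mat_ext <;>
    simp [swap, Matrix.mul_apply, Fin.sum_univ_two]

/-- Swapping rows and columns moves a nonzero entry that divides all the others to the
upper left corner. -/
theorem exists_eq_smul_mul_mul {h : Mat K} {i j : Fin 2} (ha : h i j ≠ 0)
    (hdiv : ∀ k l, h k l / h i j ∈ 𝒪[K]) : ∃ k₁ k₂ : GL (Fin 2) K,
      IsIntegralGL k₁ ∧ IsIntegralGL k₂ ∧ ∃ q s u : K, q ∈ 𝒪[K] ∧ s ∈ 𝒪[K] ∧ u ∈ 𝒪[K] ∧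
        h = h i j • (k₁.1 * !![1, q; s, u] * k₂.1) := by
  have key : h = h i j • !![h 0 0 / h i j, h 0 1 / h i j; h 1 0 / h i j, h 1 1 / h i j] := by
    apply mat_ext <;> simp [mul_div_cancel₀, ha]
  have h1 : h i j / h i j = 1 := div_self ha
  fin_cases i <;> fin_cases j <;> simp only [Fin.zero_eta, Fin.mk_one, Fin.isValue] at *
  · refine ⟨1, 1, isIntegralGL_one, isIntegralGL_one, _, _, _, hdiv 0 1, hdiv 1 0, hdiv 1 1, ?_⟩
    rw [h1] at key
    simpa only [Units.val_one, one_mul, mul_one] using key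
  · refine ⟨1, swap, isIntegralGL_one, isIntegralGL_swap, _, _, _, hdiv 0 0, hdiv 1 1, hdiv 1 0,
      ?_⟩
    rw [h1] at key
    simpa only [Units.val_one, one_mul, (swap_mul_mul _ _ _ _).2] using key
  · refine ⟨swap, 1, isIntegralGL_swap, isIntegralGL_one, _, _, _, hdiv 1 1, hdiv 0 0, hdiv 0 1,
      ?_⟩
    rw [h1] at key
    simpa only [Units.val_one, mul_one, (swap_mul_mul _ _ _ _).1] using key
  · refine ⟨swap, swap, isIntegralGL_swap, isIntegralGL_swap, _, _, _, hdiv 1 0, hdiv 0 1,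
      hdiv 0 0, ?_⟩
    rw [h1] at key
    simpa only [(swap_mul_mul _ _ _ _).1, (swap_mul_mul _ _ _ _).2] using key

section Cartan

variable {π : 𝒪[K]}

theorem coe_ne_zero_of_irreducible (hπ : Irreducible π) : (π : K) ≠ 0 := fun h =>
  hπ.ne_zero (Subtype.ext h)

theorem inv_mem_of_isUnit {a : 𝒪[K]} (ha : IsUnit a) : (a : K)⁻¹ ∈ 𝒪[K] := by
  obtain ⟨u, rfl⟩ := ha
  have h : ((u : 𝒪[K]) : K) * ((u⁻¹ : 𝒪[K]ˣ) : 𝒪[K]) = 1 := by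
    exact_mod_cast congrArg Subtype.val u.mul_inv
  rw [inv_eq_of_mul_eq_one_right h]
  exact ((u⁻¹ : 𝒪[K]ˣ) : 𝒪[K]).2

theorem isUnit_of_inv_mem {a : 𝒪[K]} (h0 : (a : K) ≠ 0) (h : (a : K)⁻¹ ∈ 𝒪[K]) : IsUnit a :=
  IsUnit.of_mul_eq_one ⟨_, h⟩ (Subtype.ext (mul_inv_cancel₀ h0))

/-- The matrix `diag(1, π)`, which moves the vertex `M₂(𝒪[K])` of the tree to a neighbour. -/
noncomputable def shift (hπ : Irreducible π) : GL (Fin 2) K :=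
  diagGL 1 π one_ne_zero (coe_ne_zero_of_irreducible hπ)

theorem shift_pow_val (hπ : Irreducible π) (d : ℕ) :
    (shift hπ ^ d).1 = !![1, 0; 0, (π : K) ^ d] := by
  induction d with
  | zero => apply mat_ext <;> simp
  | succ d ih =>
    rw [pow_succ, Units.val_mul, ih, shift, diagGL_val]
    apply mat_ext <;> simp [pow_succ]

theorem shift_pow_eq (hπ : Irreducible π) (d : ℕ) :
    shift hπ ^ d =
      diagGL 1 ((π : K) ^ d) one_ne_zero (pow_ne_zero d (coe_ne_zero_of_irreducible hπ)) :=
  Units.ext (shift_pow_val hπ d)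

/-- Cartan decomposition, in terms of maximal orders. -/
theorem exists_conjOrder_eq_shift_pow [IsDiscreteValuationRing 𝒪[K]] (hπ : Irreducible π)
    (h : GL (Fin 2) K) : ∃ (k : GL (Fin 2) K) (d : ℕ), IsIntegralGL k ∧
      conjOrder h stdOrder = conjOrder (k * shift hπ ^ d) stdOrder := by
  obtain ⟨⟨i, j⟩, hmax⟩ := Finite.exists_max fun p : Fin 2 × Fin 2 => valuation K (h.1 p.1 p.2)
  set a := h.1 i j with ha_def
  have hdet : h.1.det ≠ 0 := (Matrix.isUnits_det_units h).ne_zero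
  have ha : a ≠ 0 := by
    intro h0
    apply hdet
    have h1 : ∀ k l, h.1 k l = 0 := by
      intro k l
      have := hmax (k, l)
      rw [h0, map_zero] at this
      exact (map_eq_zero _).1 (le_zero_iff.1 this)
    rw [Matrix.det_fin_two, h1, h1 0 1]
    ring
  have hdiv : ∀ k l, h.1 k l / a ∈ 𝒪[K] := by
    intro k l
    rw [Valuation.mem_integer_iff, map_div₀]
    exact div_le_one_of_le₀ (hmax (k, l)) zero_le
  obtain ⟨k1, k2, hk1, hk2, q, s, u, hq, hs, hu, hh⟩ := exists_eq_smul_mul_mul ha hdiv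
  replace hh : h.1 = a • (k1.1 * !![1, q; s, u] * k2.1) := hh
  have hw0 : u - s * q ≠ 0 := by
    intro h0
    apply hdet
    have : (!![1, q; s, u] : Mat K).det = 0 := by
      rw [Matrix.det_fin_two_of, ← h0]; ring
    rw [hh, Matrix.det_smul, Matrix.det_mul, Matrix.det_mul, this]
    ring
  have hw : u - s * q ∈ 𝒪[K] := sub_mem hu (mul_mem hs hq)
  obtain ⟨d, ε, hε⟩ := IsDiscreteValuationRing.eq_unit_mul_pow_irreducible
    (x := (⟨u - s * q, hw⟩ : 𝒪[K])) (fun h => hw0 (congrArg Subtype.val h)) hπ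
  have hε' : u - s * q = (ε : 𝒪[K]) * (π : K) ^ d := congrArg Subtype.val hε
  have hε0 : ((ε : 𝒪[K]) : K) ≠ 0 := fun h => ε.ne_zero (Subtype.ext h)
  let A : GL (Fin 2) K := ⟨!![1, 0; s, 1], !![1, 0; -s, 1],
    by apply mat_ext <;> simp,
    by apply mat_ext <;> simp⟩
  let C : GL (Fin 2) K := ⟨!![1, q; 0, ((ε : 𝒪[K]) : K)],
    !![1, -q * ((ε : 𝒪[K]) : K)⁻¹; 0, ((ε : 𝒪[K]) : K)⁻¹],
    by apply mat_ext <;> simp [hε0],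
    by apply mat_ext <;> simp [hε0]⟩
  have hA : IsIntegralGL A := by
    constructor <;> refine memStd_iff.2 ⟨?_, ?_, ?_, ?_⟩ <;>
      first | exact zero_mem _ | exact one_mem _ | exact hs | exact neg_mem hs
  have hC : IsIntegralGL C := by
    refine isIntegralGL_of_det ?_ ?_
    · refine memStd_iff.2 ⟨?_, ?_, ?_, ?_⟩ <;>
        first | exact zero_mem _ | exact one_mem _ | exact hq | exact (ε : 𝒪[K]).2
    · change (!![1, q; 0, ((ε : 𝒪[K]) : K)] : Mat K).det⁻¹ ∈ _
      rw [Matrix.det_fin_two_of, one_mul, mul_zero, sub_zero]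
      exact inv_mem_of_isUnit ε.isUnit
  refine ⟨k1 * A, d, hk1.mul hA, conjOrder_std_eq ha ?_ (hC.mul hk2)⟩
  rw [hh, Units.val_mul, Units.val_mul, Units.val_mul, shift_pow_val]
  have : (!![1, q; s, u] : Mat K) = A.1 * !![1, 0; 0, (π : K) ^ d] * C.1 := by
    have hu' : u = (ε : 𝒪[K]) * (π : K) ^ d + s * q := by rw [← hε']; ring
    rw [hu']
    apply mat_ext <;> simp [A, C, Matrix.mul_apply, Fin.sum_univ_two]
    ring
  rw [this]
  simp only [mul_assoc, Units.val_mul]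

end Cartan

end

/-! ### Distances in the tree and Eichler orders -/

section

variable {K : Type u} [Field K] [ValuativeRel K]

variable {π : 𝒪[K]}

theorem conj_shift_pow_symm_apply (hπ : Irreducible π) (d : ℕ) (x : Mat K) :
    (conj (shift hπ ^ d)).symm x =
      !![x 0 0, x 0 1 * (π : K) ^ d; ((π : K) ^ d)⁻¹ * x 1 0, x 1 1] := by
  rw [shift_pow_eq, conj_diagGL_symm_apply]
  simp

theorem areNeighbors_shift (hπ : Irreducible π) (g : GL (Fin 2) K) :
    AreNeighbors (conjOrder g stdOrder) (conjOrder (g * shift hπ) stdOrder) := by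
  have h0 := coe_ne_zero_of_irreducible hπ
  refine ⟨π, hπ, g, fun x => ?_, fun x => ?_⟩
  · rw [mem_conjOrder]
    rfl
  · rw [mem_conjOrder, conj_symm_mul, ← pow_one (shift hπ), conj_shift_pow_symm_apply,
      ← conj_symm_apply]
    generalize (conj g).symm x = y
    rw [mem_stdOrder, pow_one]
    constructor
    · intro h
      refine ⟨h 0 0, ⟨_, h 0 1, ?_⟩, ⟨_, h 1 0, ?_⟩, h 1 1⟩
      · simp [h0, mul_comm]
      · simp [h0]
    · rintro ⟨ha, ⟨b, hb, hb'⟩, ⟨c, hc, hc'⟩, hd⟩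
      refine memStd_iff.2 ⟨?_, ?_, ?_, ?_⟩
      · exact ha
      · simpa [hb', h0, mul_comm] using hb
      · simpa [hc', h0] using hc
      · exact hd

section Distance

variable [IsDiscreteValuationRing 𝒪[K]]

/-- The vertex `g M₂(𝒪[K]) g⁻¹` of the tree. -/
noncomputable def vertex (g : GL (Fin 2) K) :
    {D : Subalgebra 𝒪[K] (Mat K) // IsMaximalOrder D} :=
  ⟨conjOrder g stdOrder, isMaximalOrder_conjOrder_std g⟩

theorem vertex_val (g : GL (Fin 2) K) : (vertex g).1 = conjOrder g stdOrder := rfl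

theorem exists_walk_vertex (hπ : Irreducible π) (g : GL (Fin 2) K) (d : ℕ) :
    ∃ p : (bruhatTits K).Walk (vertex g) (vertex (g * shift hπ ^ d)), p.length = d := by
  induction d with
  | zero =>
    rw [pow_zero, mul_one]
    exact ⟨.nil, rfl⟩
  | succ d ih =>
    obtain ⟨p, hp⟩ := ih
    have hadj : (bruhatTits K).Adj (vertex (g * shift hπ ^ d))
        (vertex (g * shift hπ ^ (d + 1))) := by
      rw [pow_succ, ← mul_assoc]
      exact areNeighbors_shift hπ _
    exact ⟨p.concat hadj, by rw [SimpleGraph.Walk.length_concat, hp]⟩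

theorem AreNeighbors.smul_mem (hπ : Irreducible π) {D D' : Subalgebra 𝒪[K] (Mat K)}
    (h : AreNeighbors D D') {x : Mat K} (hx : x ∈ D) : π • x ∈ D' := by
  obtain ⟨π', hπ', g, h1, h2⟩ := h
  rw [h1] at hx
  rw [h2, mul_smul_comm, smul_mul_assoc]
  generalize (g⁻¹ : GL (Fin 2) K).1 * x * g.1 = y at *
  have h0 := coe_ne_zero_of_irreducible hπ'
  obtain ⟨ε, hε⟩ := IsDiscreteValuationRing.associated_of_irreducible 𝒪[K] hπ' hπ
  have hε' : (π : K) = π' * (ε : 𝒪[K]) := (congrArg Subtype.val hε).symm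
  refine ⟨mul_mem π.2 (hx 0 0), ⟨π' * (π * y 0 1), mul_mem π'.2 (mul_mem π.2 (hx 0 1)), ?_⟩,
    ⟨(ε : 𝒪[K]) * y 1 0, mul_mem (ε : 𝒪[K]).2 (hx 1 0), ?_⟩, mul_mem π.2 (hx 1 1)⟩
  · rw [inv_mul_cancel_left₀ h0]
    rfl
  · rw [← mul_assoc, ← hε']
    rfl

/-- A walk of length `m` from `D` to `D'` forces `π^m D ⊆ D'`, which bounds distances from below. -/
theorem pow_smul_mem_of_walk (hπ : Irreducible π)
    {D D' : {D : Subalgebra 𝒪[K] (Mat K) // IsMaximalOrder D}} (p : (bruhatTits K).Walk D D')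
    {x : Mat K} (hx : x ∈ D.1) : π ^ p.length • x ∈ D'.1 := by
  induction p generalizing x with
  | nil => simpa using hx
  | cons h p ih =>
    rw [SimpleGraph.Walk.length_cons, pow_succ, mul_smul]
    exact ih (AreNeighbors.smul_mem hπ h hx)

theorem dist_vertex_shift_pow (hπ : Irreducible π) (g : GL (Fin 2) K) (d : ℕ) :
    (bruhatTits K).Reachable (vertex g) (vertex (g * shift hπ ^ d)) ∧
      (bruhatTits K).dist (vertex g) (vertex (g * shift hπ ^ d)) = d := by
  obtain ⟨p, hp⟩ := exists_walk_vertex hπ g d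
  refine ⟨p.reachable, le_antisymm ((SimpleGraph.dist_le p).trans_eq hp) ?_⟩
  obtain ⟨q, hq⟩ := p.reachable.exists_walk_length_eq_dist
  rw [← hq]
  by_contra! hlt
  have h0 := coe_ne_zero_of_irreducible hπ
  -- a walk of length `m` moves the lower left matrix unit into `π⁻ᵐ` times the second order
  have hx : conj g (Matrix.single 1 0 1) ∈ (vertex g).1 := by
    refine conj_mem_conjOrder.2 fun i j => ?_
    rw [Matrix.single_apply]
    split_ifs
    · exact one_mem _
    · exact zero_mem _
  have h1 := pow_smul_mem_of_walk hπ q hx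
  rw [vertex_val, mem_conjOrder, map_smul, conj_symm_mul, AlgEquiv.symm_apply_apply,
    conj_shift_pow_symm_apply] at h1
  have h2 := h1 1 0
  obtain ⟨k, hk⟩ := Nat.exists_eq_add_of_lt hlt
  have h3 : (π ^ q.length • !![(Matrix.single 1 0 (1 : K) : Mat K) 0 0,
      (Matrix.single 1 0 (1 : K) : Mat K) 0 1 * (π : K) ^ d;
      ((π : K) ^ d)⁻¹ * (Matrix.single 1 0 (1 : K) : Mat K) 1 0,
      (Matrix.single 1 0 (1 : K) : Mat K) 1 1] : Mat K) 1 0 = ((π ^ (k + 1) : 𝒪[K]) : K)⁻¹ := by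
    have : (π ^ q.length : 𝒪[K]) • ((π : K) ^ d)⁻¹ = ((π ^ (k + 1) : 𝒪[K]) : K)⁻¹ := by
      rw [Algebra.smul_def]
      change ((π ^ q.length : 𝒪[K]) : K) * _ = _
      push_cast
      have e : (π : K) ^ d = (π : K) ^ q.length * (π : K) ^ (k + 1) :=
        (congrArg (fun m => (π : K) ^ m) hk).trans (by ring)
      rw [e]
      field_simp
    simpa using this
  rw [h3] at h2
  have h4 : IsUnit (π ^ (k + 1)) := isUnit_of_inv_mem (by push_cast; exact pow_ne_zero _ h0) h2
  exact hπ.not_isUnit ((isUnit_pow_iff (Nat.succ_ne_zero k)).1 h4)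

end Distance

/-- The standard Eichler order of level `d`, with rows `(𝒪, 𝒪)` and `(π^d 𝒪, 𝒪)`. -/
noncomputable def eichler (hπ : Irreducible π) (d : ℕ) : Subalgebra 𝒪[K] (Mat K) :=
  stdOrder ⊓ conjOrder (shift hπ ^ d) stdOrder

theorem mem_eichler (hπ : Irreducible π) {d : ℕ} {x : Mat K} :
    x ∈ eichler hπ d ↔ x 0 0 ∈ 𝒪[K] ∧ x 0 1 ∈ 𝒪[K] ∧
      (∃ c ∈ 𝒪[K], x 1 0 = (π : K) ^ d * c) ∧ x 1 1 ∈ 𝒪[K] := by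
  have h0 := pow_ne_zero d (coe_ne_zero_of_irreducible hπ)
  rw [eichler, Algebra.mem_inf, mem_conjOrder, conj_shift_pow_symm_apply, mem_stdOrder,
    mem_stdOrder]
  constructor
  · rintro ⟨h1, h2⟩
    exact ⟨h1 0 0, h1 0 1, ⟨_, h2 1 0, by simp [h0]⟩, h1 1 1⟩
  · rintro ⟨ha, hb, ⟨c, hc, hc'⟩, hd⟩
    have hπd : (π : K) ^ d ∈ 𝒪[K] := pow_mem π.2 d
    constructor <;> refine memStd_iff.2 ⟨?_, ?_, ?_, ?_⟩
    · exact ha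
    · exact hb
    · simpa [hc'] using mul_mem hπd hc
    · exact hd
    · exact ha
    · simpa using mul_mem hb hπd
    · simpa [hc', h0] using hc
    · exact hd

theorem mem_eichler_one (hπ : Irreducible π) {y : Mat K} :
    y ∈ eichler hπ 1 ↔ MemStd y ∧ ∃ c : 𝒪[K], y 1 0 = π * c := by
  rw [mem_eichler, memStd_iff, pow_one]
  constructor
  · rintro ⟨h1, h2, ⟨c, hc, h3⟩, h4⟩
    exact ⟨⟨h1, h2, h3 ▸ mul_mem π.2 hc, h4⟩, ⟨c, hc⟩, h3⟩
  · rintro ⟨⟨h1, h2, -, h4⟩, c, h3⟩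
    exact ⟨h1, h2, ⟨c, c.2, h3⟩, h4⟩

theorem conjOrder_inf (g : GL (Fin 2) K) (R S : Subalgebra 𝒪[K] (Mat K)) :
    conjOrder g (R ⊓ S) = conjOrder g R ⊓ conjOrder g S := by
  ext x
  simp only [mem_conjOrder, Algebra.mem_inf]

variable [IsDiscreteValuationRing 𝒪[K]]

theorem isEichlerOfLevel_conjOrder (hπ : Irreducible π) (g : GL (Fin 2) K) (d : ℕ) :
    IsEichlerOfLevel (conjOrder g (eichler hπ d)) d := by
  obtain ⟨h1, h2⟩ := dist_vertex_shift_pow hπ g d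
  refine ⟨_, _, h1, h2, ?_⟩
  rw [eichler, conjOrder_inf, ← conjOrder_mul]
  rfl

/-- Two maximal orders are simultaneously conjugate to `M₂(𝒪[K])` and its conjugate by
`diag(1, π^d)`, where `d` is their distance. -/
theorem exists_eq_vertex (hπ : Irreducible π)
    (D D' : {D : Subalgebra 𝒪[K] (Mat K) // IsMaximalOrder D}) :
    ∃ (g : GL (Fin 2) K) (d : ℕ), D = vertex g ∧ D' = vertex (g * shift hπ ^ d) := by
  obtain ⟨g, hg⟩ := D.2.exists_eq_conjOrder
  obtain ⟨g', hg'⟩ := D'.2.exists_eq_conjOrder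
  obtain ⟨k, d, hk, h⟩ := exists_conjOrder_eq_shift_pow hπ (g⁻¹ * g')
  refine ⟨g * k, d, Subtype.ext ?_, Subtype.ext ?_⟩
  · rw [hg, vertex_val, conjOrder_mul, hk.conjOrder_std]
  · rw [hg', vertex_val, mul_assoc, conjOrder_mul, ← h, ← conjOrder_mul, mul_inv_cancel_left]

/-- Eichler orders of level `d` are conjugate to the standard one. -/
theorem IsEichlerOfLevel.exists_eq_conjOrder (hπ : Irreducible π)
    {E : Subalgebra 𝒪[K] (Mat K)} {d : ℕ} (hE : IsEichlerOfLevel E d) :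
    ∃ g : GL (Fin 2) K, E = conjOrder g (eichler hπ d) := by
  obtain ⟨D, D', -, hd, rfl⟩ := hE
  obtain ⟨g, m, rfl, rfl⟩ := exists_eq_vertex hπ D D'
  rw [(dist_vertex_shift_pow hπ g m).2] at hd
  subst hd
  refine ⟨g, ?_⟩
  rw [eichler, conjOrder_inf, ← conjOrder_mul]
  rfl

end

/-! ### Gorenstein orders -/

section

variable {K : Type u} [Field K] [ValuativeRel K]

theorem mem_codifferent {R : Subalgebra 𝒪[K] (Mat K)} {a : Mat K} :
    a ∈ codifferent R ↔ ∀ x ∈ R, (a * x).trace ∈ 𝒪[K] := Iff.rfl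

/-- If multiplication by an invertible `c` on either side identifies `R` with its codifferent,
then `R` is Gorenstein. The hypotheses say that the form `(x, y) ↦ tr(cxy)` makes `R` its own dual
on both sides. -/
theorem isGorenstein_of_selfDual {R : Subalgebra 𝒪[K] (Mat K)} (hR : IsFullOrder R)
    (c : GL (Fin 2) K)
    (hl : ∀ b : Mat K, (∀ r ∈ R, (c.1 * (b * r)).trace ∈ 𝒪[K]) ↔ b ∈ R)
    (hr : ∀ b : Mat K, (∀ r ∈ R, (c.1 * (r * b)).trace ∈ 𝒪[K]) ↔ b ∈ R) :
    IsGorenstein R := by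
  set ci : Mat K := (c⁻¹ : GL (Fin 2) K).1 with hci
  have hcci : c.1 * ci = 1 := c.mul_inv
  have hcic : ci * c.1 = 1 := c.inv_mul
  have hcl : ∀ x : Mat K, c.1 * (ci * x) = x := fun x => by rw [← mul_assoc, hcci, one_mul]
  have hcl' : ∀ x : Mat K, ci * (c.1 * x) = x := fun x => by rw [← mul_assoc, hcic, one_mul]
  have hIl : ∀ a : Mat K, a ∈ codifferent R ↔ ci * a ∈ R := by
    intro a
    rw [← hl, mem_codifferent]
    simp only [mul_assoc, hcl]
  have hIr : ∀ a : Mat K, a ∈ codifferent R ↔ a * ci ∈ R := by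
    intro a
    rw [← hr, mem_codifferent]
    have : ∀ r : Mat K, (a * r).trace = (c.1 * (r * (a * ci))).trace := by
      intro r
      rw [← mul_assoc, ← mul_assoc, Matrix.trace_mul_comm _ ci, ← mul_assoc, ← mul_assoc, hcic,
        one_mul, Matrix.trace_mul_comm]
    simp only [this]
  let f : Mat K ≃ₗ[K] Mat K :=
    { toFun := fun x => c.1 * x
      invFun := fun x => ci * x
      map_add' := fun x y => mul_add _ _ _
      map_smul' := fun a x => mul_smul_comm _ _ _
      left_inv := hcl'
      right_inv := hcl }
  let J : Submodule 𝒪[K] (Mat K) := (Subalgebra.toSubmodule R).map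
    (f.symm.toLinearMap.restrictScalars 𝒪[K])
  have hJ : ∀ b : Mat K, b ∈ J ↔ c.1 * b ∈ R := by
    intro b
    constructor
    · rintro ⟨x, hx, rfl⟩
      change c.1 * (ci * x) ∈ R
      rwa [hcl]
    · intro h
      exact ⟨_, h, hcl' b⟩
  have hI : codifferent R = (Subalgebra.toSubmodule R).map
      (f.toLinearMap.restrictScalars 𝒪[K]) := by
    ext a
    rw [hIl]
    constructor
    · intro h
      exact ⟨_, h, hcl a⟩
    · rintro ⟨x, hx, rfl⟩
      change ci * (c.1 * x) ∈ R
      rwa [hcl']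
  -- conjugation by `c` preserves `R`
  have hcon : ∀ x ∈ R, c.1 * x * ci ∈ R := fun x hx =>
    (hIr _).1 ((hIl _).2 (by rwa [hcl']))
  have hcon' : ∀ x ∈ R, ci * (x * c.1) ∈ R := fun x hx =>
    (hIl _).1 ((hIr _).2 (by rwa [mul_assoc, hcci, mul_one]))
  have hJ' : ∀ b ∈ J, b * c.1 ∈ R := by
    intro b hb
    have := hcon' _ ((hJ b).1 hb)
    rwa [mul_assoc, hcl'] at this
  refine ⟨hR, ⟨hI ▸ IsFullLattice.map hR f, fun x hx a ha => ⟨?_, ?_⟩⟩, J,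
    ⟨IsFullLattice.map hR f.symm, fun x hx b hb => ⟨?_, ?_⟩⟩, ?_, ?_⟩
  · rw [hIr, mul_assoc]
    exact mul_mem hx ((hIr a).1 ha)
  · rw [hIl, ← mul_assoc]
    exact mul_mem ((hIl a).1 ha) hx
  · rw [hJ]
    have := mul_mem (hcon x hx) ((hJ b).1 hb)
    rwa [mul_assoc, hcl', mul_assoc] at this
  · rw [hJ, ← mul_assoc]
    exact mul_mem ((hJ b).1 hb) hx
  · refine le_antisymm (Submodule.mul_le.2 fun a ha b hb => ?_) fun x hx => ?_
    · have := mul_mem ((hIr a).1 ha) ((hJ b).1 hb)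
      rwa [mul_assoc, hcl'] at this
    · have h1 : x * c.1 ∈ codifferent R := (hIr _).2 (by rwa [mul_assoc, hcci, mul_one])
      have h2 : ci ∈ J := (hJ _).2 (by rw [hcci]; exact one_mem R)
      have := Submodule.mul_mem_mul h1 h2
      rwa [mul_assoc, hcci, mul_one] at this
  · refine le_antisymm (Submodule.mul_le.2 fun b hb a ha => ?_) fun x hx => ?_
    · have := mul_mem (hJ' b hb) ((hIl a).1 ha)
      rwa [mul_assoc, hcl] at this
    · have h1 : c.1 * x ∈ codifferent R := (hIl _).2 (by rwa [hcl'])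
      have h2 : ci ∈ J := (hJ _).2 (by rw [hcci]; exact one_mem R)
      have := Submodule.mul_mem_mul h2 h1
      rwa [hcl'] at this

theorem IsFullLattice.conj_map {N : Submodule 𝒪[K] (Mat K)} (hN : IsFullLattice N)
    (g : GL (Fin 2) K) : IsFullLattice (N.map (conj g).toLinearMap) := by
  let f : Mat K ≃ₗ[K] Mat K :=
    { conj g with
      map_smul' := fun c x => conj_smul g c x }
  exact IsFullLattice.map hN f

theorem codifferent_conjOrder (g : GL (Fin 2) K) (R : Subalgebra 𝒪[K] (Mat K)) :
    codifferent (conjOrder g R) = (codifferent R).map (conj g).toLinearMap := by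
  ext a
  constructor
  · intro h
    refine ⟨(conj g).symm a, fun x hx => ?_, (conj g).apply_symm_apply a⟩
    have := h _ (conj_mem_conjOrder.2 hx)
    rwa [← trace_conj_symm g, map_mul, AlgEquiv.symm_apply_apply] at this
  · rintro ⟨b, hb, rfl⟩ x hx
    have := hb _ (mem_conjOrder.1 hx)
    rwa [← trace_conj g, map_mul, AlgEquiv.apply_symm_apply] at this

theorem IsTwoSidedFractionalIdeal.conj_map {R : Subalgebra 𝒪[K] (Mat K)}
    {I : Submodule 𝒪[K] (Mat K)} (hI : IsTwoSidedFractionalIdeal R I) (g : GL (Fin 2) K) :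
    IsTwoSidedFractionalIdeal (conjOrder g R) (I.map (conj g).toLinearMap) := by
  refine ⟨hI.1.conj_map g, ?_⟩
  rintro _ ⟨x, hx, rfl⟩ _ ⟨a, ha, rfl⟩
  exact ⟨⟨_, (hI.2 x hx a ha).1, map_mul (conj g) x a⟩,
    ⟨_, (hI.2 x hx a ha).2, map_mul (conj g) a x⟩⟩

theorem IsGorenstein.conjOrder {R : Subalgebra 𝒪[K] (Mat K)} (hR : IsGorenstein R)
    (g : GL (Fin 2) K) : IsGorenstein (conjOrder g R) := by
  obtain ⟨h1, h2, J, h3, h4, h5⟩ := hR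
  have key : ∀ M N : Submodule 𝒪[K] (Mat K), M.map (conj g).toLinearMap *
      N.map (conj g).toLinearMap = (M * N).map (conj g).toLinearMap := fun M N =>
    (Submodule.map_mul M N (conj g).toAlgHom).symm
  refine ⟨h1.conjOrder g, ?_⟩
  rw [IsInvertibleIdeal, codifferent_conjOrder]
  refine ⟨h2.conj_map g, _, h3.conj_map g, ?_, ?_⟩
  · rw [key, h4]
    rfl
  · rw [key, h5]
    rfl

end

/-! ### Orders with a nontrivial idempotent -/

section

variable {K : Type u} [Field K] [ValuativeRel K]

/-- Hensel's lemma for a quadratic polynomial that splits with distinct roots modulo `𝓂[K]`. -/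
theorem exists_root_of_isUnit [TopologicalSpace K] [IsNonarchimedeanLocalField K] {t n : 𝒪[K]}
    (ht : IsUnit t) (hn : ¬ IsUnit n) : ∃ a : 𝒪[K], a ^ 2 - t * a + n = 0 ∧ ¬ IsUnit a := by
  let _ := IsTopologicalAddGroup.rightUniformSpace K
  have _ := isUniformAddGroup_of_addCommGroup (G := K)
  have hmon : (Polynomial.X ^ 2 - Polynomial.C t * Polynomial.X + Polynomial.C n).Monic := by
    monicity!
  obtain ⟨a, ha, ha0⟩ := HenselianRing.is_henselian (I := 𝓂[K])
    (Polynomial.X ^ 2 - Polynomial.C t * Polynomial.X + Polynomial.C n) hmon 0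
    (by simpa using hn) (by
      refine IsUnit.map _ ?_
      simpa using ht.neg)
  refine ⟨a, by simpa using ha, ?_⟩
  simpa using ha0

theorem mul_self_eq {K : Type*} [Field K] (x : Mat K) :
    x * x = x.trace • x - x.det • (1 : Mat K) := by
  apply mat_ext <;>
    simp [Matrix.mul_apply, Fin.sum_univ_two, Matrix.trace_fin_two, Matrix.det_fin_two] <;> ring

/-- An idempotent of rank one is conjugate to `diag(1, 0)`. -/
theorem exists_conj_eq_diag {e : Mat K} (ht : e.trace = 1) (hd : e.det = 0) :
    ∃ g : GL (Fin 2) K, (conj g).symm e = !![1, 0; 0, 0] := by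
  rw [Matrix.trace_fin_two] at ht
  rw [Matrix.det_fin_two] at hd
  have key : ∀ m : Mat K, m.det ≠ 0 → e * m = m * !![1, 0; 0, 0] →
      ∃ g : GL (Fin 2) K, (conj g).symm e = !![1, 0; 0, 0] := by
    intro m hm h
    refine ⟨Matrix.GeneralLinearGroup.mkOfDetNeZero m hm, ?_⟩
    rw [conj_symm_apply, mul_assoc, Units.inv_mul_eq_iff_eq_mul]
    exact h
  by_cases h0 : e 0 0 = 0
  · refine key !![e 0 1, e 1 1; e 1 1, -e 1 0] ?_ ?_
    · rw [Matrix.det_fin_two_of]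
      have h1 : e 1 1 = 1 := by rw [← ht, h0, zero_add]
      have h2 : e 0 1 * e 1 0 = 0 := by rw [h0] at hd; linear_combination -hd
      rw [h1]
      intro h3
      have : (1 : K) = 0 := by linear_combination -h3 - h2
      exact one_ne_zero this
    · apply mat_ext <;> simp [Matrix.mul_apply, Fin.sum_univ_two]
      · linear_combination e 0 1 * ht
      · linear_combination hd
      · linear_combination (-1 : K) * hd + e 1 1 * ht
      · ring
  · refine key !![e 0 0, -e 0 1; e 1 0, e 0 0] ?_ ?_
    · rw [Matrix.det_fin_two_of]
      intro h3
      apply h0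
      linear_combination h3 + hd - e 0 0 * ht
    · apply mat_ext <;> simp [Matrix.mul_apply, Fin.sum_univ_two]
      · linear_combination (-1 : K) * hd + e 0 0 * ht
      · ring
      · linear_combination e 1 0 * ht
      · linear_combination hd

/-- A nonzero `𝒪[K]`-submodule of `K` with bounded denominators is generated by one element. -/
theorem exists_generator [IsDiscreteValuationRing 𝒪[K]] {N : Submodule 𝒪[K] K} (hN : N ≠ ⊥)
    {c : K} (hc : c ≠ 0) (hcN : ∀ a ∈ N, a * c ∈ 𝒪[K]) :
    ∃ y : K, y ≠ 0 ∧ ∀ a, a ∈ N ↔ ∃ z ∈ 𝒪[K], a = z * y := by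
  let I : Ideal 𝒪[K] := N.comap (LinearMap.toSpanSingleton 𝒪[K] K c⁻¹)
  have hI : ∀ z : 𝒪[K], z ∈ I ↔ (z : K) * c⁻¹ ∈ N := fun z => Iff.rfl
  obtain ⟨γ, hγ⟩ := (IsPrincipalIdealRing.principal I).principal
  have h1 : ∀ a, a ∈ N ↔ ∃ z ∈ 𝒪[K], a = z * (γ * c⁻¹) := by
    intro a
    constructor
    · intro ha
      have h2 : (⟨a * c, hcN a ha⟩ : 𝒪[K]) ∈ I := by
        rw [hI]
        simpa [hc] using ha
      rw [hγ] at h2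
      obtain ⟨z, hz⟩ := Submodule.mem_span_singleton.1 h2
      have hz' : (z : K) * γ = a * c := congrArg Subtype.val hz
      refine ⟨z, z.2, ?_⟩
      rw [← mul_assoc, hz', mul_inv_cancel_right₀ hc]
    · rintro ⟨z, hz, rfl⟩
      have h2 : γ ∈ I := hγ ▸ Submodule.mem_span_singleton_self γ
      exact N.smul_mem ⟨z, hz⟩ ((hI γ).1 h2)
  refine ⟨_, ?_, h1⟩
  intro h0
  apply hN
  rw [eq_bot_iff]
  intro a ha
  obtain ⟨z, -, rfl⟩ := (h1 a).1 ha
  rw [h0, mul_zero]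
  exact zero_mem _

theorem single_mul_mul_single {A : Type*} [CommRing A] (x : Matrix (Fin 2) (Fin 2) A)
    (i j : Fin 2) :
    Matrix.single i i 1 * x * Matrix.single j j 1 = Matrix.single i j (x i j) := by
  ext k l
  simp only [Matrix.single_mul_mul_single, one_mul, mul_one]

/-- A full order containing `diag(1, 0)` is diagonally conjugate to a standard Eichler order. -/
theorem exists_eq_conjOrder_eichler_of_diag [IsDiscreteValuationRing 𝒪[K]] {π : 𝒪[K]}
    (hπ : Irreducible π) {R : Subalgebra 𝒪[K] (Mat K)} (hR : IsFullOrder R)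
    (he : !![1, 0; 0, 0] ∈ R) : ∃ (g : GL (Fin 2) K) (d : ℕ), R = conjOrder g (eichler hπ d) := by
  have he' : ∀ i : Fin 2, Matrix.single i i (1 : K) ∈ R := by
    have h0 : Matrix.single 0 0 (1 : K) = !![1, 0; 0, 0] := by
      apply mat_ext <;> simp
    have h1 : Matrix.single 1 1 (1 : K) = 1 - !![1, 0; 0, 0] := by
      apply mat_ext <;> simp
    rw [Fin.forall_fin_two, h0, h1]
    exact ⟨he, sub_mem (one_mem _) he⟩
  let N : Fin 2 → Fin 2 → Submodule 𝒪[K] K := fun i j =>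
    (Subalgebra.toSubmodule R).comap (Matrix.singleLinearMap 𝒪[K] i j)
  have hN : ∀ i j a, a ∈ N i j ↔ Matrix.single i j a ∈ R := fun i j a => Iff.rfl
  have hmem : ∀ x : Mat K, x ∈ R ↔ ∀ i j, x i j ∈ N i j := by
    intro x
    constructor
    · intro hx i j
      rw [hN, ← single_mul_mul_single]
      exact mul_mem (mul_mem (he' i) hx) (he' j)
    · intro h
      rw [Matrix.matrix_eq_sum_single x]
      exact sum_mem fun i _ => sum_mem fun j _ => h i j
  have hdiag : ∀ i a, a ∈ N i i ↔ a ∈ 𝒪[K] := by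
    intro i a
    constructor
    · intro h
      simpa using trace_mem_integer hR.1 ((hN i i a).1 h)
    · intro h
      have := (N i i).smul_mem ⟨a, h⟩ ((hN i i 1).2 (he' i))
      rwa [Algebra.smul_def, mul_one] at this
  have hmul : ∀ a ∈ N 0 1, ∀ b ∈ N 1 0, a * b ∈ 𝒪[K] := by
    intro a ha b hb
    rw [← hdiag 0, hN]
    simpa using mul_mem ((hN _ _ _).1 ha) ((hN _ _ _).1 hb)
  have hne : ∀ i j, N i j ≠ ⊥ := by
    intro i j h
    let φ : Mat K →ₗ[K] K := Matrix.entryLinearMap K K i j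
    have h1 : Submodule.span K ((Subalgebra.toSubmodule R : Submodule 𝒪[K] (Mat K)) :
        Set (Mat K)) ≤ LinearMap.ker φ := by
      rw [Submodule.span_le]
      intro x hx
      have h2 := (hmem x).1 hx i j
      rw [h] at h2
      exact h2
    rw [hR.2] at h1
    have h3 : φ (Matrix.single i j 1) = 0 := h1 trivial
    simp [φ] at h3
  obtain ⟨b0, hb0, hb0'⟩ := Submodule.exists_mem_ne_zero_of_ne_bot (hne 1 0)
  obtain ⟨a0, ha0, ha0'⟩ := Submodule.exists_mem_ne_zero_of_ne_bot (hne 0 1)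
  obtain ⟨a, ha, hNa⟩ := exists_generator (hne 0 1) hb0' fun a h => hmul a h b0 hb0
  obtain ⟨b, hb, hNb⟩ := exists_generator (hne 1 0) ha0' fun b h => by
    rw [mul_comm]; exact hmul a0 ha0 b h
  have hab : a * b ∈ 𝒪[K] :=
    hmul a ((hNa a).2 ⟨1, one_mem _, (one_mul a).symm⟩) b
      ((hNb b).2 ⟨1, one_mem _, (one_mul b).symm⟩)
  obtain ⟨d, ε, hε⟩ := IsDiscreteValuationRing.eq_unit_mul_pow_irreducible
    (x := (⟨a * b, hab⟩ : 𝒪[K])) (fun h => mul_ne_zero ha hb (congrArg Subtype.val h)) hπ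
  have hε' : a * b = (ε : 𝒪[K]) * (π : K) ^ d := congrArg Subtype.val hε
  have hε0 : ((ε : 𝒪[K]) : K) ≠ 0 := fun h => ε.ne_zero (Subtype.ext h)
  refine ⟨diagGL a 1 ha one_ne_zero, d, ?_⟩
  ext x
  rw [mem_conjOrder, mem_eichler, conj_diagGL_symm_apply, hmem]
  simp only [Fin.forall_fin_two, hdiag, hNa, hNb, and_assoc, Matrix.of_apply, Matrix.cons_val',
    Matrix.cons_val_zero, Matrix.cons_val_one, Matrix.cons_val_fin_one, mul_one, inv_one, one_mul]
  refine and_congr Iff.rfl (and_congr ?_ (and_congr ?_ Iff.rfl))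
  · constructor
    · rintro ⟨z, hz, h⟩
      rw [h, mul_comm z, inv_mul_cancel_left₀ ha]
      exact hz
    · intro h
      exact ⟨_, h, by rw [mul_comm, mul_inv_cancel_left₀ ha]⟩
  · constructor
    · rintro ⟨z, hz, h⟩
      exact ⟨(ε : 𝒪[K]) * z, mul_mem (ε : 𝒪[K]).2 hz, by rw [h]; linear_combination z * hε'⟩
    · rintro ⟨c, hc, h⟩
      refine ⟨_, mul_mem (inv_mem_of_isUnit ε.isUnit) hc, mul_right_cancel₀ ha ?_⟩
      rw [h]
      field_simp
      linear_combination - c * hε'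

theorem isFullOrder_eichler [IsDiscreteValuationRing 𝒪[K]] {π : 𝒪[K]} (hπ : Irreducible π)
    (d : ℕ) : IsFullOrder (eichler hπ d) := by
  have h0 := pow_ne_zero d (coe_ne_zero_of_irreducible hπ)
  have := isFullOrder_stdOrder (K := K)
  refine ⟨Submodule.FG.of_le this.1 (inf_le_left (a := (stdOrder : Subalgebra 𝒪[K] (Mat K)))), ?_⟩
  rw [eq_top_iff, ← this.2, Submodule.span_le]
  intro x hx
  have h1 : π ^ d • x ∈ eichler hπ d := by
    rw [mem_eichler]
    have hπd : (π : K) ^ d ∈ 𝒪[K] := pow_mem π.2 d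
    have h2 : MemStd (π ^ d • x) := stdOrder.smul_mem hx _
    exact ⟨h2 0 0, h2 0 1, ⟨x 1 0, hx 1 0, rfl⟩, h2 1 1⟩
  have h3 : x = ((π : K) ^ d)⁻¹ • (π ^ d • x) := by
    change x = ((π : K) ^ d)⁻¹ • ((π : K) ^ d • x)
    rw [inv_smul_smul₀ h0]
  rw [h3]
  exact Submodule.smul_mem _ _ (Submodule.subset_span h1)

theorem isGorenstein_eichler [IsDiscreteValuationRing 𝒪[K]] {π : 𝒪[K]} (hπ : Irreducible π)
    (d : ℕ) : IsGorenstein (eichler hπ d) := by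
  have h0 := pow_ne_zero d (coe_ne_zero_of_irreducible hπ)
  let c : GL (Fin 2) K := ⟨!![0, ((π : K) ^ d)⁻¹; 1, 0], !![0, 1; (π : K) ^ d, 0],
    by apply mat_ext <;> simp [h0], by apply mat_ext <;> simp [h0]⟩
  have htr : ∀ y : Mat K, (c.1 * y).trace = ((π : K) ^ d)⁻¹ * y 1 0 + y 0 1 := by
    intro y
    rw [Matrix.trace_fin_two, Matrix.mul_apply, Matrix.mul_apply, Fin.sum_univ_two,
      Fin.sum_univ_two]
    simp [c]
  have hmem : ∀ y ∈ eichler hπ d, (c.1 * y).trace ∈ 𝒪[K] := by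
    intro y hy
    obtain ⟨-, hb, ⟨c, hc, h⟩, -⟩ := (mem_eichler hπ).1 hy
    rw [htr, h, inv_mul_cancel_left₀ h0]
    exact add_mem hc hb
  have e00 : !![1, 0; 0, 0] ∈ eichler hπ d := (mem_eichler hπ).2
    ⟨one_mem _, zero_mem _, ⟨0, zero_mem _, (mul_zero _).symm⟩, zero_mem _⟩
  have e11 : !![0, 0; 0, 1] ∈ eichler hπ d := (mem_eichler hπ).2
    ⟨zero_mem _, zero_mem _, ⟨0, zero_mem _, (mul_zero _).symm⟩, one_mem _⟩
  have e01 : !![0, 1; 0, 0] ∈ eichler hπ d := (mem_eichler hπ).2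
    ⟨zero_mem _, one_mem _, ⟨0, zero_mem _, (mul_zero _).symm⟩, zero_mem _⟩
  have e10 : !![0, 0; (π : K) ^ d, 0] ∈ eichler hπ d := (mem_eichler hπ).2
    ⟨zero_mem _, zero_mem _, ⟨1, one_mem _, (mul_one _).symm⟩, zero_mem _⟩
  refine isGorenstein_of_selfDual (isFullOrder_eichler hπ d) c
    (fun b => ⟨fun h => ?_, fun hb r hr => hmem _ (mul_mem hb hr)⟩)
    (fun b => ⟨fun h => ?_, fun hb r hr => hmem _ (mul_mem hr hb)⟩)
  all_goals
    have h1 := h _ e00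
    have h2 := h _ e11
    have h3 := h _ e01
    have h4 := h _ e10
    simp only [htr, Matrix.mul_apply, Fin.sum_univ_two, Matrix.of_apply, Matrix.cons_val',
      Matrix.cons_val_zero, Matrix.cons_val_one, Matrix.cons_val_fin_one, mul_one, mul_zero,
      add_zero, zero_add, one_mul, zero_mul] at h1 h2 h3 h4
    rw [mem_eichler]
  · rw [mul_comm (b 1 1), inv_mul_cancel_left₀ h0] at h4
    exact ⟨h3, h2, ⟨_, h1, (mul_inv_cancel_left₀ h0 _).symm⟩, h4⟩
  · rw [inv_mul_cancel_left₀ h0] at h4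
    exact ⟨h4, h1, ⟨_, h2, (mul_inv_cancel_left₀ h0 _).symm⟩, h3⟩

/-- `R` contains an element whose characteristic polynomial has two distinct roots in the residue
field, expressed by `tr x` being a unit and `det x` a nonunit. -/
def HasSplitElement (R : Subalgebra 𝒪[K] (Mat K)) : Prop :=
  ∃ x ∈ R, ∃ t n : 𝒪[K], x.trace = t ∧ x.det = n ∧ IsUnit t ∧ ¬ IsUnit n

/-- The Hensel factorisation of its characteristic polynomial turns a split element into an
idempotent of `R`, which is diagonal in a suitable basis. -/
theorem HasSplitElement.exists_eq_conjOrder_eichler [TopologicalSpace K]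
    [IsNonarchimedeanLocalField K] {π : 𝒪[K]} (hπ : Irreducible π)
    {R : Subalgebra 𝒪[K] (Mat K)} (hR : IsFullOrder R) (h : HasSplitElement R) :
    ∃ (g : GL (Fin 2) K) (d : ℕ), R = conjOrder g (eichler hπ d) := by
  obtain ⟨x, hx, t, n, ht, hn, htu, hnu⟩ := h
  obtain ⟨a, ha, hau⟩ := exists_root_of_isUnit htu hnu
  have hu : IsUnit (t - 2 * a) := by
    by_contra h
    refine (IsLocalRing.mem_maximalIdeal t).1 ?_ htu
    have h2 : t = (t - 2 * a) + 2 * a := by ring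
    rw [h2]
    exact add_mem h (Ideal.mul_mem_left _ _ hau)
  obtain ⟨w, hw⟩ := hu.exists_right_inv
  -- the idempotent attached to the root `t - a`
  let e : Mat K := w • (x - algebraMap 𝒪[K] (Mat K) a)
  have heR : e ∈ R := R.smul_mem (sub_mem hx (R.algebraMap_mem a)) w
  have he : e = (w : K) • (x - (a : K) • (1 : Mat K)) := by
    change w • (x - algebraMap 𝒪[K] (Mat K) a) = _
    rw [Algebra.algebraMap_eq_smul_one]
    rfl
  have hw' : ((t : K) - 2 * a) * w = 1 := congrArg Subtype.val hw
  have ha' : (a : K) ^ 2 - t * a + n = 0 := congrArg Subtype.val ha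
  have h1 : e.trace = 1 := by
    rw [he, Matrix.trace_smul, Matrix.trace_sub, Matrix.trace_smul, ht, Matrix.trace_one]
    simp only [smul_eq_mul, Fintype.card_fin, Nat.cast_ofNat]
    linear_combination hw'
  have h2 : e.det = 0 := by
    rw [Matrix.trace_fin_two] at ht
    rw [Matrix.det_fin_two] at hn
    rw [he, Matrix.det_smul, Matrix.det_fin_two]
    simp
    right
    linear_combination ha' + hn - a * ht
  obtain ⟨g, hg⟩ := exists_conj_eq_diag h1 h2
  have h3 : !![1, 0; 0, 0] ∈ conjOrder g⁻¹ R := by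
    rw [mem_conjOrder, ← hg, conj_symm_eq, inv_inv, AlgEquiv.apply_symm_apply]
    exact heR
  obtain ⟨g', d, h4⟩ := exists_eq_conjOrder_eichler_of_diag hπ (hR.conjOrder g⁻¹) h3
  exact ⟨g * g', d, by rw [conjOrder_mul, ← h4, conjOrder_conjOrder_inv]⟩

theorem HasSplitElement.isGorenstein [TopologicalSpace K] [IsNonarchimedeanLocalField K]
    {R : Subalgebra 𝒪[K] (Mat K)} (hR : IsFullOrder R) (h : HasSplitElement R) :
    IsGorenstein R := by
  obtain ⟨π, hπ⟩ := IsDiscreteValuationRing.exists_irreducible 𝒪[K]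
  obtain ⟨g, d, rfl⟩ := h.exists_eq_conjOrder_eichler hπ hR
  exact (isGorenstein_eichler hπ d).conjOrder g

theorem HasSplitElement.mono {R S : Subalgebra 𝒪[K] (Mat K)} (h : HasSplitElement R)
    (hRS : R ≤ S) : HasSplitElement S := by
  obtain ⟨x, hx, h⟩ := h
  exact ⟨x, hRS hx, h⟩

theorem hasSplitElement_conjOrder_eichler [IsDiscreteValuationRing 𝒪[K]] {π : 𝒪[K]}
    (hπ : Irreducible π) (g : GL (Fin 2) K) (d : ℕ) :
    HasSplitElement (conjOrder g (eichler hπ d)) := by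
  refine ⟨conj g !![1, 0; 0, 0], conj_mem_conjOrder.2 ((mem_eichler hπ).2
    ⟨one_mem _, zero_mem _, ⟨0, zero_mem _, (mul_zero _).symm⟩, zero_mem _⟩), 1, 0, ?_, ?_,
    isUnit_one, not_isUnit_zero⟩
  · rw [trace_conj, Matrix.trace_fin_two_of]
    simp
  · rw [det_conj, Matrix.det_fin_two_of]
    simp

end

/-! ### Orders of the form `𝒪 + πR` -/

section

variable {K : Type u} [Field K] [ValuativeRel K]

theorem not_isUnit_iff_dvd {A : Type*} [CommRing A] [IsDomain A] [IsDiscreteValuationRing A]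
    {π : A} (hπ : Irreducible π) {a : A} :
    ¬ IsUnit a ↔ π ∣ a := by
  rw [← mem_nonunits_iff, ← IsLocalRing.mem_maximalIdeal,
    (IsDiscreteValuationRing.irreducible_iff_uniformizer π).1 hπ, Ideal.mem_span_singleton]

theorem add_smul_mul_add_smul {A R : Type*} [CommRing A] [Ring R] [Algebra A R] (a b p : A)
    (y z : R) : (algebraMap A R a + p • y) * (algebraMap A R b + p • z) =
      algebraMap A R (a * b) + p • (a • z + b • y + p • (y * z)) := by
  simp only [Algebra.algebraMap_eq_smul_one, mul_add, add_mul, smul_mul_assoc, mul_smul_comm,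
    one_mul, mul_one]
  module

/-- The order `𝒪[K] + πR`. -/
def scalarOrder (π : 𝒪[K]) (R : Subalgebra 𝒪[K] (Mat K)) : Subalgebra 𝒪[K] (Mat K) where
  carrier := {x | ∃ a : 𝒪[K], ∃ y ∈ R, x = algebraMap 𝒪[K] (Mat K) a + π • y}
  mul_mem' := by
    rintro _ _ ⟨a, y, hy, rfl⟩ ⟨b, z, hz, rfl⟩
    exact ⟨a * b, a • z + b • y + π • (y * z), add_mem (add_mem (R.smul_mem hz _)
      (R.smul_mem hy _)) (R.smul_mem (mul_mem hy hz) _), add_smul_mul_add_smul a b π y z⟩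
  add_mem' := by
    rintro _ _ ⟨a, y, hy, rfl⟩ ⟨b, z, hz, rfl⟩
    refine ⟨a + b, y + z, add_mem hy hz, ?_⟩
    rw [map_add, smul_add]
    abel
  algebraMap_mem' := fun r => ⟨r, 0, zero_mem _, by simp⟩

theorem mem_scalarOrder {π : 𝒪[K]} {R : Subalgebra 𝒪[K] (Mat K)} {x : Mat K} :
    x ∈ scalarOrder π R ↔ ∃ a : 𝒪[K], ∃ y ∈ R, x = algebraMap 𝒪[K] (Mat K) a + π • y := Iff.rfl

theorem smul_mem_scalarOrder {π : 𝒪[K]} {R : Subalgebra 𝒪[K] (Mat K)} {y : Mat K} (hy : y ∈ R) :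
    π • y ∈ scalarOrder π R := ⟨0, y, hy, by simp⟩

theorem scalarOrder_le (π : 𝒪[K]) (R : Subalgebra 𝒪[K] (Mat K)) : scalarOrder π R ≤ R := by
  rintro _ ⟨a, y, hy, rfl⟩
  exact add_mem (R.algebraMap_mem a) (R.smul_mem hy π)

variable [IsDiscreteValuationRing 𝒪[K]]

theorem isFullOrder_scalarOrder {π : 𝒪[K]} (hπ : Irreducible π)
    {R : Subalgebra 𝒪[K] (Mat K)} (hR : IsFullOrder R) : IsFullOrder (scalarOrder π R) := by
  have h0 := coe_ne_zero_of_irreducible hπ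
  refine ⟨Submodule.FG.of_le hR.1 (scalarOrder_le π R), ?_⟩
  rw [eq_top_iff, ← hR.2, Submodule.span_le]
  intro x hx
  have h3 : x = (π : K)⁻¹ • (π • x) := by
    change x = (π : K)⁻¹ • ((π : K) • x)
    rw [inv_smul_smul₀ h0]
  rw [h3]
  exact Submodule.smul_mem _ _ (Submodule.subset_span (smul_mem_scalarOrder hx))

/-- By Nakayama's lemma a full lattice is not generated modulo `π` by two elements. -/
theorem exists_notMem_span_pair {π : 𝒪[K]} (hπ : Irreducible π)
    {R : Subalgebra 𝒪[K] (Mat K)} (hR : IsFullOrder R) (e : Mat K) :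
    ∃ x ∈ R, ∀ a b : 𝒪[K], ∀ y ∈ R, x ≠ algebraMap 𝒪[K] (Mat K) a + b • e + π • y := by
  classical
  by_contra! h
  have hle : Subalgebra.toSubmodule R ≤
      Submodule.span 𝒪[K] {1, e} ⊔ Ideal.span {π} • Subalgebra.toSubmodule R := by
    intro x hx
    obtain ⟨a, b, y, hy, rfl⟩ := h x hx
    refine Submodule.add_mem_sup ?_ (Submodule.smul_mem_smul (Ideal.mem_span_singleton_self π) hy)
    rw [Algebra.algebraMap_eq_smul_one]
    exact Submodule.mem_span_pair.2 ⟨a, b, rfl⟩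
  have hle' := Submodule.le_of_le_smul_of_le_jacobson_bot hR.1 (by
    rw [IsLocalRing.jacobson_eq_maximalIdeal ⊥ bot_ne_top,
      (IsDiscreteValuationRing.irreducible_iff_uniformizer π).1 hπ]) hle
  have htop : (⊤ : Submodule K (Mat K)) ≤ Submodule.span K (({1, e} : Finset (Mat K)) : Set _) := by
    rw [← hR.2, Submodule.span_le]
    intro x hx
    obtain ⟨a, b, rfl⟩ := Submodule.mem_span_pair.1 (hle' hx)
    refine add_mem ?_ ?_
    · exact Submodule.smul_mem _ (a : K) (Submodule.subset_span (by simp))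
    · exact Submodule.smul_mem _ (b : K) (Submodule.subset_span (by simp))
  have h4 := (finrank_span_finset_le_card (R := K) ({1, e} : Finset (Mat K))).trans
    Finset.card_le_two
  rw [Set.finrank, top_le_iff.1 htop, finrank_top, Module.finrank_matrix] at h4
  simp at h4

/-- In `𝒪[K] + πR` every element outside the ideal `πR` modulo scalars in `𝓂[K]` is invertible. -/
theorem exists_inverse_of_isUnit {π : 𝒪[K]} (hπ : Irreducible π)
    {R : Subalgebra 𝒪[K] (Mat K)} (hR : IsFullOrder R) {x : Mat K} (hx : x ∈ scalarOrder π R)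
    (hx' : ∀ y ∈ R, x ≠ π • y) : ∃ v ∈ scalarOrder π R, x * v = 1 := by
  obtain ⟨a, y, hy, hxy⟩ := mem_scalarOrder.1 hx
  have ha : IsUnit a := by
    by_contra h
    obtain ⟨b, rfl⟩ := (not_isUnit_iff_dvd hπ).1 h
    refine hx' (algebraMap 𝒪[K] (Mat K) b + y) (add_mem (R.algebraMap_mem b) hy) ?_
    rw [hxy, smul_add, map_mul, ← Algebra.smul_def]
  obtain ⟨τ, hτ⟩ : ∃ τ : 𝒪[K], y.trace = τ := ⟨⟨_, trace_mem_integer hR.1 hy⟩, rfl⟩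
  obtain ⟨ν, hν⟩ : ∃ ν : 𝒪[K], y.det = ν := ⟨⟨_, det_mem_integer hR.1 hy⟩, rfl⟩
  have hN : IsUnit (a ^ 2 + π * (a * τ + π * ν)) := by
    by_contra h
    refine (not_isUnit_iff_dvd hπ).2 ?_ (ha.pow 2)
    exact (dvd_add_left (dvd_mul_right π _)).1 ((not_isUnit_iff_dvd hπ).1 h)
  obtain ⟨w, hw⟩ := hN.exists_right_inv
  refine ⟨w • (algebraMap 𝒪[K] (Mat K) (2 * a + π * τ) - x),
    Subalgebra.smul_mem _ (sub_mem (Subalgebra.algebraMap_mem _ _) hx) _, ?_⟩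
  have hw' : ((a : K) ^ 2 + π * (a * τ + π * ν)) * w = 1 := congrArg Subtype.val hw
  have hxy' : x = (a : K) • (1 : Mat K) + (π : K) • y := by
    rw [hxy, Algebra.algebraMap_eq_smul_one]
    rfl
  have e1 : w • (algebraMap 𝒪[K] (Mat K) (2 * a + π * τ) - x) =
      (w : K) • (((2 : K) * a + π * τ) • (1 : Mat K) - x) := by
    rw [Algebra.algebraMap_eq_smul_one]
    rfl
  have hyy := mul_self_eq y
  rw [hτ, hν] at hyy
  rw [e1]
  have e2 : x * ((w : K) • (((2 : K) * a + π * τ) • (1 : Mat K) - x)) =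
      (((a : K) ^ 2 + π * (a * τ + π * ν)) * w) • (1 : Mat K) := by
    rw [hxy']
    simp only [mul_sub, mul_add, add_mul, smul_sub, smul_add, smul_mul_assoc, mul_smul_comm,
      one_mul, mul_one, hyy, smul_smul]
    module
  rw [e2, hw', one_smul]

/-- An order `𝒪[K] + πR` is not Gorenstein. If its codifferent were invertible, it would be
principal, `I = c(𝒪[K] + πR)`, since the order is local. Then every `e ∈ R` with `tr(ce)` integral
lies in `𝒪[K] + πR`; but `e ↦ π tr(ce)` is one linear condition modulo `π`, while `R` is not
generated modulo `π` by two elements. -/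
theorem not_isGorenstein_scalarOrder {π : 𝒪[K]} (hπ : Irreducible π)
    {R : Subalgebra 𝒪[K] (Mat K)} (hR : IsFullOrder R) : ¬ IsGorenstein (scalarOrder π R) := by
  rintro ⟨-, hI, J, hJ, hIJ, hJI⟩
  set S := scalarOrder π R with hS
  set I := codifferent S with hI_def
  have h0 := coe_ne_zero_of_irreducible hπ
  obtain ⟨a, ha, b, hb, hab⟩ : ∃ a ∈ I, ∃ b ∈ J, ∀ y ∈ R, a * b ≠ π • y := by
    by_contra! h
    have hle : I * J ≤ (Subalgebra.toSubmodule R).map (LinearMap.lsmul 𝒪[K] (Mat K) π) := by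
      refine Submodule.mul_le.2 fun a ha b hb => ?_
      obtain ⟨y, hy, hab⟩ := h a ha b hb
      exact ⟨y, hy, hab.symm⟩
    rw [hIJ] at hle
    obtain ⟨y, hy, h1⟩ := hle (one_mem S)
    have h1' : (π : K) • y = 1 := h1
    have h2 := congrArg Matrix.det h1'
    rw [Matrix.det_smul, Matrix.det_one] at h2
    have h3 : π ^ 2 * (⟨y.det, det_mem_integer hR.1 hy⟩ : 𝒪[K]) = 1 :=
      Subtype.ext (by simpa using h2)
    exact hπ.not_isUnit (isUnit_pow_iff two_ne_zero |>.1 (IsUnit.of_mul_eq_one _ h3))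
  have habS : a * b ∈ S := by
    have := Submodule.mul_mem_mul ha hb
    rwa [hIJ] at this
  obtain ⟨v, hv, hv1⟩ := exists_inverse_of_isUnit hπ hR habS hab
  -- `c` generates the codifferent, with inverse `b`
  obtain ⟨c, hc, hbc⟩ : ∃ c ∈ I, b * c = 1 := by
    refine ⟨v * a, (hI.2 v hv a ha).1, ?_⟩
    rw [← mul_assoc]
    rw [mul_assoc] at hv1
    exact mul_eq_one_comm.1 hv1
  have hkey : ∀ e ∈ R, (c * e).trace ∈ 𝒪[K] → e ∈ S := by
    intro e he hce
    have h1 : c * e ∈ I := by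
      rw [hI_def, mem_codifferent]
      intro x hx
      obtain ⟨o, y, hy, rfl⟩ := mem_scalarOrder.1 hx
      have h2 := mem_codifferent.1 hc _ (smul_mem_scalarOrder (π := π) (mul_mem he hy))
      rw [mul_add, Matrix.trace_add, ← Algebra.commutes, ← Algebra.smul_def, Matrix.trace_smul,
        mul_smul_comm, mul_assoc, ← mul_smul_comm]
      exact add_mem (mul_mem o.2 hce) h2
    have h2 := Submodule.mul_mem_mul hb h1
    rw [hJI, ← mul_assoc, hbc, one_mul] at h2
    exact h2
  have htr : ∀ e ∈ R, (π : K) * (c * e).trace ∈ 𝒪[K] := by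
    intro e he
    have := mem_codifferent.1 hc _ (smul_mem_scalarOrder (π := π) he)
    rw [mul_smul_comm, Matrix.trace_smul] at this
    exact this
  obtain ⟨e₁, he₁, h1⟩ := exists_notMem_span_pair hπ hR 0
  obtain ⟨e₂, he₂, h2⟩ := exists_notMem_span_pair hπ hR e₁
  have hu : IsUnit (⟨_, htr e₁ he₁⟩ : 𝒪[K]) := by
    by_contra h
    obtain ⟨z, hz⟩ := (not_isUnit_iff_dvd hπ).1 h
    have hz' : (π : K) * (c * e₁).trace = π * z := congrArg Subtype.val hz
    obtain ⟨o, y, hy, h3⟩ := mem_scalarOrder.1 (hkey e₁ he₁ (by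
      rw [mul_left_cancel₀ h0 hz']; exact z.2))
    exact h1 o 0 y hy (by rw [h3]; simp)
  obtain ⟨w, hw⟩ := hu.exists_right_inv
  have hw' : (π : K) * (c * e₁).trace * w = 1 := congrArg Subtype.val hw
  set l : 𝒪[K] := ⟨_, htr e₂ he₂⟩ * w with hl
  have hl' : (l : K) = (π : K) * (c * e₂).trace * w := rfl
  obtain ⟨o, y, hy, h3⟩ := mem_scalarOrder.1 (hkey (e₂ - l • e₁)
    (sub_mem he₂ (R.smul_mem he₁ l)) (by
      rw [mul_sub, Matrix.trace_sub, mul_smul_comm, Matrix.trace_smul]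
      have : (c * e₂).trace - l • (c * e₁).trace = 0 := by
        change (c * e₂).trace - (l : K) * (c * e₁).trace = 0
        rw [hl']
        linear_combination - (c * e₂).trace * hw'
      rw [this]
      exact zero_mem _))
  refine h2 o l y hy ?_
  rw [add_right_comm, ← h3, sub_add_cancel]

end

/-! ### Elements of Bass orders -/

section

section SquareClosed

variable {A R : Type*} [CommRing A] [Ring R] [Algebra A R] {M : Submodule A R}

theorem mul_add_mul_mem_of_sq (hsq : ∀ x ∈ M, x * x ∈ M) {x y : R} (hx : x ∈ M) (hy : y ∈ M) :
    x * y + y * x ∈ M := by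
  have h := sub_mem (sub_mem (hsq _ (add_mem hx hy)) (hsq x hx)) (hsq y hy)
  have e : (x + y) * (x + y) - x * x - y * y = x * y + y * x := by noncomm_ring
  rwa [e] at h

theorem list_prod_mem_pow {l : List R} (hl : ∀ x ∈ l, x ∈ M) : l.prod ∈ M ^ l.length := by
  induction l with
  | nil => simpa using ⟨1, map_one _⟩
  | cons x l ih =>
    rw [List.prod_cons, List.length_cons, pow_succ']
    exact Submodule.mul_mem_mul (hl x List.mem_cons_self)
      (ih fun y hy => hl y (List.mem_cons_of_mem x hy))

/-- Permuting the factors of a product of elements of `M` changes it by a sign, up to products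
with fewer factors. -/
theorem list_prod_perm (hsq : ∀ x ∈ M, x * x ∈ M) {l l' : List R} (h : l.Perm l')
    (hl : ∀ x ∈ l, x ∈ M) :
    l.prod - l'.prod ∈ M ^ (l.length - 1) ∨ l.prod + l'.prod ∈ M ^ (l.length - 1) := by
  induction h with
  | nil => left; simp
  | @cons x l l' h ih =>
    rw [List.prod_cons, List.prod_cons, List.length_cons, Nat.add_sub_cancel]
    rcases l with _ | ⟨y, l⟩
    · rw [h.nil_eq]
      left
      simp
    · have hx : x ∈ M := hl x List.mem_cons_self
      have e : (y :: l).length = (y :: l).length - 1 + 1 := by simp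
      rw [e, pow_succ', ← mul_sub, ← mul_add]
      exact (ih fun y hy => hl y (List.mem_cons_of_mem x hy)).imp
        (Submodule.mul_mem_mul hx) (Submodule.mul_mem_mul hx)
  | swap x y l =>
    right
    have e : (y :: x :: l).length - 1 = l.length + 1 := by simp
    rw [e, pow_succ']
    have e2 : (y :: x :: l).prod + (x :: y :: l).prod = (y * x + x * y) * l.prod := by
      simp only [List.prod_cons]
      noncomm_ring
    rw [e2]
    exact Submodule.mul_mem_mul (mul_add_mul_mem_of_sq hsq (hl y (by simp)) (hl x (by simp)))
      (list_prod_mem_pow fun z hz => hl z (by simp [hz]))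
  | @trans l₁ l₂ l₃ h₁ h₂ ih₁ ih₂ =>
    have h3 := ih₂ fun x hx => hl x (h₁.mem_iff.2 hx)
    rw [← h₁.length_eq] at h3
    rcases ih₁ hl with h4 | h4 <;> rcases h3 with h5 | h5
    · left; simpa using add_mem h4 h5
    · right; convert add_mem h4 h5 using 1; abel
    · right; convert sub_mem h4 h5 using 1; abel
    · left; convert sub_mem h4 h5 using 1; abel

/-- A finitely generated module containing `1` and the squares of its elements generates a
finitely generated algebra: in a product of more elements than there are generators two
coincide, and may be moved next to each other. -/
theorem exists_subalgebra_of_sq_mem (hM : M.FG) (h1 : (1 : R) ∈ M) (hsq : ∀ x ∈ M, x * x ∈ M) :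
    ∃ T : Subalgebra A R, (Subalgebra.toSubmodule T).FG ∧ M ≤ Subalgebra.toSubmodule T := by
  classical
  obtain ⟨s, hs⟩ := hM
  set n := s.card with hn
  have hsM : ∀ x ∈ s, x ∈ M := fun x hx => hs ▸ Submodule.subset_span hx
  have hstep : M ^ (n + 1) ≤ M ^ n := by
    conv_lhs => rw [← hs]
    rw [Submodule.span_pow, Submodule.span_le]
    intro x hx
    obtain ⟨f, rfl⟩ := Set.mem_pow.1 hx
    set l : List R := List.ofFn fun i => (f i : R) with hl
    have hlen : l.length = n + 1 := by simp [hl]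
    have hls : ∀ x ∈ l, x ∈ s := by
      intro x hx
      obtain ⟨i, rfl⟩ := (List.mem_ofFn' _ _).1 hx
      exact (f i).2
    have hdup : ¬ l.Nodup := by
      intro h
      have h2 := Finset.card_le_card (s := l.toFinset) (t := s) fun x hx =>
        hls x (List.mem_toFinset.1 hx)
      rw [List.toFinset_card_of_nodup h, hlen] at h2
      omega
    obtain ⟨a, ha⟩ := List.exists_duplicate_iff_not_nodup.2 hdup
    obtain ⟨l', hl'⟩ := (List.duplicate_iff_sublist.1 ha).exists_perm_append
    have hlM : ∀ x ∈ l, x ∈ M := fun x hx => hsM x (hls x hx)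
    have h3 : ([a, a] ++ l').prod ∈ M ^ n := by
      have hlen' : n = l'.length + 1 := by
        have := hl'.length_eq
        simp at this
        omega
      have haM : a ∈ M := hlM a ha.mem
      rw [List.prod_append, hlen', pow_succ']
      refine Submodule.mul_mem_mul (by simpa using hsq a haM)
        (list_prod_mem_pow fun x hx => hlM x (hl'.mem_iff.2 (by simp [hx])))
    have h4 := list_prod_perm hsq hl' hlM
    rw [hlen, Nat.add_sub_cancel] at h4
    rcases h4 with h4 | h4
    · simpa using add_mem h4 h3
    · simpa using sub_mem h4 h3
  have hle : ∀ k, M ^ (n + k) ≤ M ^ n := by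
    intro k
    induction k with
    | zero => exact le_rfl
    | succ k ih =>
      rw [← add_assoc, pow_succ]
      refine (mul_le_mul' ih le_rfl).trans ?_
      rw [← pow_succ]
      exact hstep
  have hone : (1 : R) ∈ M ^ n := by
    have := Submodule.pow_mem_pow M h1 n
    rwa [one_pow] at this
  refine ⟨(M ^ n).toSubalgebra hone fun x y hx hy => hle n ?_, ?_, fun x hx => ?_⟩
  · rw [pow_add]
    exact Submodule.mul_mem_mul hx hy
  · exact Submodule.FG.pow ⟨s, hs⟩ n
  · refine hstep ?_
    rw [pow_succ]
    have := Submodule.mul_mem_mul hone hx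
    rwa [one_mul] at this

end SquareClosed

variable {K : Type u} [Field K] [ValuativeRel K]

/-- `R` contains an element whose characteristic polynomial is irreducible over the residue
field. -/
def HasUnramifiedElement (R : Subalgebra 𝒪[K] (Mat K)) : Prop :=
  ∃ x ∈ R, ∃ t n : 𝒪[K], x.trace = t ∧ x.det = n ∧ ∀ a : 𝒪[K], IsUnit (a ^ 2 - t * a + n)

/-- `R` contains an element whose characteristic polynomial is an Eisenstein polynomial. -/
def HasEisensteinElement (R : Subalgebra 𝒪[K] (Mat K)) : Prop :=
  ∃ x ∈ R, ∃ t n : 𝒪[K], x.trace = t ∧ x.det = n ∧ ¬ IsUnit t ∧ Irreducible n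

theorem det_add_eq {A : Type*} [CommRing A] (x y : Matrix (Fin 2) (Fin 2) A) :
    (x + y).det = x.det + y.det + (x.trace * y.trace - (x * y).trace) := by
  simp only [Matrix.det_fin_two, Matrix.trace_fin_two, Matrix.mul_apply, Fin.sum_univ_two,
    Matrix.add_apply]
  ring

theorem coe_smul_eq (c : 𝒪[K]) (x : Mat K) : c • x = (c : K) • x := rfl

/-- If the characteristic polynomials of all elements of `B` are squares modulo `𝓂[K]` and none is
Eisenstein after a translation, then `B` lies in `𝒪[K] + πR` for a full order `R`, because
`π⁻¹ {x ∈ B | det x ∈ 𝓂[K]}` is a lattice closed under squares. -/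
theorem exists_le_scalarOrder [IsDiscreteValuationRing 𝒪[K]] {π : 𝒪[K]} (hπ : Irreducible π)
    {B : Subalgebra 𝒪[K] (Mat K)} (hB : IsFullOrder B) (hs : ¬ HasSplitElement B)
    (hu : ¬ HasUnramifiedElement B) (hr : ¬ HasEisensteinElement B) :
    ∃ R : Subalgebra 𝒪[K] (Mat K), IsFullOrder R ∧ B ≤ scalarOrder π R := by
  have h0 := coe_ne_zero_of_irreducible hπ
  have htr : ∀ x ∈ B, ∃ t : 𝒪[K], x.trace = t := fun x hx => ⟨⟨_, trace_mem_integer hB.1 hx⟩, rfl⟩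
  have hdet : ∀ x ∈ B, ∃ n : 𝒪[K], x.det = n := fun x hx => ⟨⟨_, det_mem_integer hB.1 hx⟩, rfl⟩
  have hJ : ∀ x ∈ B, ∀ n : 𝒪[K], x.det = n → π ∣ n →
      (∃ τ : 𝒪[K], x.trace = (π * τ : 𝒪[K])) ∧ ∃ ν : 𝒪[K], x.det = (π ^ 2 * ν : 𝒪[K]) := by
    intro x hx n hn hπn
    obtain ⟨t, ht⟩ := htr x hx
    have hnu := (not_isUnit_iff_dvd hπ).2 hπn
    have htu : ¬ IsUnit t := fun h => hs ⟨x, hx, t, n, ht, hn, h, hnu⟩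
    obtain ⟨τ, rfl⟩ := (not_isUnit_iff_dvd hπ).1 htu
    obtain ⟨m, rfl⟩ := hπn
    have hmu : ¬ IsUnit m := fun h =>
      hr ⟨x, hx, _, _, ht, hn, htu, (irreducible_mul_isUnit h).2 hπ⟩
    obtain ⟨ν, rfl⟩ := (not_isUnit_iff_dvd hπ).1 hmu
    exact ⟨⟨τ, ht⟩, ν, by rw [hn, sq, mul_assoc]⟩
  have htrs : ∀ m : Mat K, (π • m).trace = π * m.trace := fun m => by
    rw [coe_smul_eq, Matrix.trace_smul, smul_eq_mul]
  have hdets : ∀ m : Mat K, (π • m).det = (π : K) ^ 2 * m.det := fun m => by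
    rw [coe_smul_eq, Matrix.det_smul, Fintype.card_fin]
  -- an element of `B` with nonunit determinant is divisible by `π` among the integral matrices
  have hJ' : ∀ m : Mat K, π • m ∈ B → ∀ n : 𝒪[K], (π • m).det = n → π ∣ n →
      m.trace ∈ 𝒪[K] ∧ m.det ∈ 𝒪[K] := by
    intro m hm n hn hπn
    obtain ⟨⟨τ, hτ⟩, ν, hν⟩ := hJ _ hm n hn hπn
    rw [htrs] at hτ
    rw [hdets] at hν
    push_cast at hτ hν
    rw [mul_left_cancel₀ h0 hτ, mul_left_cancel₀ (pow_ne_zero 2 h0) hν]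
    exact ⟨τ.2, ν.2⟩
  let M : Submodule 𝒪[K] (Mat K) :=
    { carrier := {m | π • m ∈ B ∧ m.trace ∈ 𝒪[K] ∧ m.det ∈ 𝒪[K]}
      zero_mem' := by simp [zero_mem]
      smul_mem' := by
        rintro c m ⟨hm, ht, hd⟩
        refine ⟨?_, ?_, ?_⟩
        · rw [smul_comm]
          exact B.smul_mem hm c
        · rw [coe_smul_eq, Matrix.trace_smul]
          exact mul_mem c.2 ht
        · rw [coe_smul_eq, Matrix.det_smul]
          exact mul_mem (pow_mem c.2 _) hd
      add_mem' := by
        rintro m m' ⟨hm, ht, hd⟩ ⟨hm', ht', hd'⟩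
        have hadd : π • (m + m') ∈ B := by
          rw [smul_add]
          exact add_mem hm hm'
        obtain ⟨⟨τ, hτ⟩, -⟩ := hJ _ (mul_mem hm hm') (π ^ 4 * (⟨_, hd⟩ * ⟨_, hd'⟩)) (by
          rw [Matrix.det_mul, hdets, hdets]
          push_cast
          ring) (Dvd.dvd.mul_right (dvd_pow_self π (by norm_num)) _)
        refine ⟨hadd, hJ' _ hadd (π * (π * ⟨_, hd⟩ + π * ⟨_, hd'⟩ + π * ⟨_, ht⟩ * ⟨_, ht'⟩ - τ)) ?_
          (dvd_mul_right _ _)⟩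
        rw [smul_add, det_add_eq, hτ, hdets, hdets, htrs, htrs]
        push_cast
        ring }
  have hM : ∀ m, m ∈ M ↔ π • m ∈ B ∧ m.trace ∈ 𝒪[K] ∧ m.det ∈ 𝒪[K] := fun m => Iff.rfl
  have h1 : (1 : Mat K) ∈ M := by
    refine (hM _).2 ⟨B.smul_mem (one_mem B) π, ?_, ?_⟩
    · rw [Matrix.trace_one, Fintype.card_fin]
      exact natCast_mem _ 2
    · rw [Matrix.det_one]
      exact one_mem _
  have hfg : M.FG := by
    let f : Mat K →ₗ[𝒪[K]] Mat K := ((π : K)⁻¹ • (LinearMap.id : Mat K →ₗ[K] Mat K)).restrictScalars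
      𝒪[K]
    refine Submodule.FG.of_le (hB.1.map f) fun m hm => ⟨π • m, hm.1, ?_⟩
    change (π : K)⁻¹ • ((π : K) • m) = m
    rw [inv_smul_smul₀ h0]
  obtain ⟨R, hRfg, hMR⟩ := exists_subalgebra_of_sq_mem hfg h1 fun x hx => by
    rw [mul_self_eq]
    exact sub_mem (M.smul_mem ⟨_, hx.2.1⟩ hx) (M.smul_mem ⟨_, hx.2.2⟩ h1)
  have hBR : B ≤ scalarOrder π R := by
    intro x hx
    obtain ⟨t, ht⟩ := htr x hx
    obtain ⟨n, hn⟩ := hdet x hx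
    obtain ⟨a, ha⟩ : ∃ a : 𝒪[K], ¬ IsUnit (a ^ 2 - t * a + n) := by
      by_contra! h
      exact hu ⟨x, hx, t, n, ht, hn, h⟩
    set m : Mat K := (π : K)⁻¹ • (x - algebraMap 𝒪[K] (Mat K) a) with hm_def
    have hm : π • m = x - algebraMap 𝒪[K] (Mat K) a := by
      rw [coe_smul_eq, hm_def, smul_inv_smul₀ h0]
    have hmB : π • m ∈ B := by
      rw [hm]
      exact sub_mem hx (B.algebraMap_mem a)
    have hmM : m ∈ M := by
      refine (hM _).2 ⟨hmB, hJ' m hmB _ ?_ ((not_isUnit_iff_dvd hπ).1 ha)⟩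
      rw [hm, Algebra.algebraMap_eq_smul_one, coe_smul_eq, Matrix.det_fin_two]
      rw [Matrix.trace_fin_two] at ht
      rw [Matrix.det_fin_two] at hn
      simp
      linear_combination hn - a * ht
    exact mem_scalarOrder.2 ⟨a, m, hMR hmM, by rw [hm, add_sub_cancel]⟩
  refine ⟨R, ⟨hRfg, ?_⟩, hBR⟩
  rw [eq_top_iff, ← hB.2]
  exact Submodule.span_mono fun x hx => scalarOrder_le π R (hBR hx)

/-- A Bass order contains an element of one of the three kinds, since it does not lie in any of the
non-Gorenstein orders `𝒪[K] + πR`. -/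
theorem IsBass.exists_element [IsDiscreteValuationRing 𝒪[K]] {B : Subalgebra 𝒪[K] (Mat K)}
    (hB : IsBass B) : HasSplitElement B ∨ HasUnramifiedElement B ∨ HasEisensteinElement B := by
  by_contra! h
  obtain ⟨π, hπ⟩ := IsDiscreteValuationRing.exists_irreducible 𝒪[K]
  obtain ⟨R, hR, hBR⟩ := exists_le_scalarOrder hπ hB.1 h.1 h.2.1 h.2.2
  exact not_isGorenstein_scalarOrder hπ hR (hB.2 _ (isFullOrder_scalarOrder hπ hR) hBR)

end

/-! ### Maximal quadratic orders -/

section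

section Pairs

variable {A : Type*} [CommRing A]

/-- The norm form `a² + tab + nb²`, the norm of `a + bθ` where `θ² = tθ - n`. -/
def normForm (t n a b : A) : A := a ^ 2 + t * a * b + n * b ^ 2

/-- The pair `(t, n)` defines a maximal order `A[θ]`, `θ² = tθ - n`, which is a discrete valuation
ring with uniformizer `p + qθ`. Divisibility by `p + qθ` and the values of the norm are written out
in the basis `1, θ`. -/
structure IsUniformizerPair (t n p q : A) : Prop where
  norm_not_isUnit : ¬ IsUnit (normForm t n p q)
  exists_eq : ∀ a b, ¬ IsUnit (normForm t n a b) →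
    ∃ a' b', a = p * a' - n * q * b' ∧ b = p * b' + q * a' + t * q * b'
  dvd_of_sq_dvd : ∀ π a b, Irreducible π → π ^ 2 ∣ normForm t n a b → π ∣ a ∧ π ∣ b

variable [IsDomain A] [IsDiscreteValuationRing A]

/-- If `X² - tX + n` has no root in the residue field, then the norm form is anisotropic over it. -/
theorem dvd_of_dvd_normForm {t n π : A} (hπ : Irreducible π)
    (h : ∀ a : A, IsUnit (a ^ 2 - t * a + n)) {a b : A} (hab : π ∣ normForm t n a b) :
    π ∣ a ∧ π ∣ b := by
  have hb : π ∣ b := by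
    by_contra hb
    obtain ⟨c, hc⟩ := (not_not.1 (mt (not_isUnit_iff_dvd hπ).1 hb)).exists_right_inv
    refine (not_isUnit_iff_dvd hπ).2 ?_ (h (-(a * c)))
    have e : (-(a * c)) ^ 2 - t * -(a * c) + n =
        normForm t n a b * c ^ 2 - (b * c - 1) * (t * a * c + n * (b * c + 1)) := by
      rw [normForm]; ring
    rw [e, hc, sub_self, zero_mul, sub_zero]
    exact hab.mul_right _
  refine ⟨hπ.prime.dvd_of_dvd_pow (n := 2) ?_, hb⟩
  have e : a ^ 2 = normForm t n a b - b * (t * a + n * b) := by rw [normForm]; ring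
  rw [e]
  exact dvd_sub hab (hb.mul_right _)

theorem isUniformizerPair_of_unramified {t n π : A} (hπ : Irreducible π)
    (h : ∀ a : A, IsUnit (a ^ 2 - t * a + n)) : IsUniformizerPair t n π 0 where
  norm_not_isUnit := (not_isUnit_iff_dvd hπ).2 (by simp [normForm, sq])
  exists_eq := by
    intro a b hab
    obtain ⟨⟨a', rfl⟩, ⟨b', rfl⟩⟩ := dvd_of_dvd_normForm hπ h ((not_isUnit_iff_dvd hπ).1 hab)
    exact ⟨a', b', by ring, by ring⟩
  dvd_of_sq_dvd := fun _ _ _ hϖ hab =>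
    dvd_of_dvd_normForm hϖ h ((dvd_pow_self _ two_ne_zero).trans hab)

theorem isUniformizerPair_of_eisenstein {t n : A} (ht : ¬ IsUnit t) (hn : Irreducible n) :
    IsUniformizerPair t n 0 1 := by
  obtain ⟨s, rfl⟩ := (not_isUnit_iff_dvd hn).1 ht
  have key : ∀ π a b : A, Irreducible π → π ∣ normForm (n * s) n a b → π ∣ a := by
    intro π a b hπ hab
    have hn' : π ∣ n := (not_isUnit_iff_dvd hπ).1 hn.not_isUnit
    refine hπ.prime.dvd_of_dvd_pow (n := 2) ?_
    have e : a ^ 2 = normForm (n * s) n a b - n * (s * a * b + b ^ 2) := by rw [normForm]; ring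
    rw [e]
    exact dvd_sub hab (hn'.mul_right _)
  refine ⟨(not_isUnit_iff_dvd hn).2 (by simp [normForm]), ?_, ?_⟩
  · intro a b hab
    obtain ⟨a', rfl⟩ := key n a b hn ((not_isUnit_iff_dvd hn).1 hab)
    exact ⟨b + n * s * a', -a', by ring, by ring⟩
  · intro π a b hπ hab
    have ha := key π a b hπ ((dvd_pow_self _ two_ne_zero).trans hab)
    refine ⟨ha, ?_⟩
    obtain ⟨ε, rfl⟩ := IsDiscreteValuationRing.associated_of_irreducible A hπ hn
    obtain ⟨a', rfl⟩ := ha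
    refine hπ.prime.dvd_of_dvd_pow (n := 2) ?_
    have e : normForm (π * ε * s) (π * ε) (π * a') b =
        π ^ 2 * (a' ^ 2 + ε * s * a' * b) + π * ε * b ^ 2 := by rw [normForm]; ring
    rw [e, dvd_add_right (dvd_mul_right _ _), sq π, mul_assoc] at hab
    have h2 := (mul_dvd_mul_iff_left hπ.ne_zero).1 hab
    rwa [mul_comm, Units.dvd_mul_right] at h2

variable {t n p q : A}

theorem IsUniformizerPair.dvd_of_normForm_eq (h : IsUniformizerPair t n p q) {s : A} (hs : s ≠ 0) :
    ∀ {a b m : A}, normForm t n a b = m * s ^ 2 → s ∣ a ∧ s ∣ b := by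
  induction s using WfDvdMonoid.induction_on_irreducible with
  | zero => exact absurd rfl hs
  | unit u hu => exact fun _ => ⟨hu.dvd, hu.dvd⟩
  | mul s π hs' hπ ih =>
    intro a b m hab
    obtain ⟨⟨a', rfl⟩, ⟨b', rfl⟩⟩ := h.dvd_of_sq_dvd π a b hπ ⟨m * s ^ 2, by rw [hab]; ring⟩
    have h1 : normForm t n a' b' = m * s ^ 2 := by
      refine mul_left_cancel₀ (pow_ne_zero 2 hπ.ne_zero) ?_
      rw [normForm] at hab ⊢
      linear_combination hab
    obtain ⟨h2, h3⟩ := ih hs' h1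
    exact ⟨mul_dvd_mul_left π h2, mul_dvd_mul_left π h3⟩

theorem IsUniformizerPair.eq_zero (h : IsUniformizerPair t n p q) {a b : A}
    (hab : normForm t n a b = 0) : a = 0 ∧ b = 0 := by
  obtain ⟨π, hπ⟩ := IsDiscreteValuationRing.exists_irreducible A
  have key : ∀ s, s ≠ 0 → s ∣ a ∧ s ∣ b := fun s hs =>
    h.dvd_of_normForm_eq hs (m := 0) (by rw [hab, zero_mul])
  -- a nonzero element is not divisible by its product with `π`
  have key2 : ∀ s : A, s ≠ 0 → ¬ π * s ∣ s := fun s hs hd =>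
    hπ.not_isUnit (isUnit_of_dvd_one ((mul_dvd_mul_iff_right hs).1 (by rwa [one_mul])))
  constructor
  · by_contra ha
    exact key2 a ha (key _ (mul_ne_zero hπ.ne_zero ha)).1
  · by_contra hb
    exact key2 b hb (key _ (mul_ne_zero hπ.ne_zero hb)).2

theorem IsUniformizerPair.ne_zero (h : IsUniformizerPair t n p q) : n ≠ 0 := fun hn =>
  one_ne_zero (h.eq_zero (a := 0) (b := 1) (by rw [normForm, hn]; ring)).2

theorem IsUniformizerPair.normForm_ne_zero (h : IsUniformizerPair t n p q) :
    normForm t n p q ≠ 0 := by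
  intro h0
  obtain ⟨rfl, rfl⟩ := h.eq_zero h0
  obtain ⟨π, hπ⟩ := IsDiscreteValuationRing.exists_irreducible A
  obtain ⟨a', b', h1, -⟩ := h.exists_eq π 0 ((not_isUnit_iff_dvd hπ).2 (by simp [normForm, sq]))
  exact hπ.ne_zero (by rw [h1]; ring)

end Pairs

section Matrices

variable {K : Type u} [Field K]

/-- The matrix of `a + bθ`, `θ² = tθ - n`, acting on `K[θ]` by multiplication in the basis
`θ, 1`. -/
def quadMat (t n a b : K) : Mat K := !![a + b * t, b; -(n * b), a]

theorem quadMat_mul (t n a b c d : K) : quadMat t n a b * quadMat t n c d =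
    quadMat t n (a * c - n * b * d) (a * d + b * c + t * b * d) := by
  apply mat_ext <;> simp [quadMat] <;> ring

theorem quadMat_mul_comm (t n a b c d : K) :
    quadMat t n a b * quadMat t n c d = quadMat t n c d * quadMat t n a b := by
  rw [quadMat_mul, quadMat_mul]
  congr 1 <;> ring

theorem quadMat_add (t n a b c d : K) : quadMat t n a b + quadMat t n c d =
    quadMat t n (a + c) (b + d) := by
  apply mat_ext <;> simp [quadMat] <;> ring

theorem quadMat_one (t n : K) : quadMat t n 1 0 = 1 := by
  apply mat_ext <;> simp [quadMat]

theorem quadMat_eq (t n a b : K) : quadMat t n a b = a • (1 : Mat K) + b • quadMat t n 0 1 := by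
  apply mat_ext <;> simp [quadMat, mul_comm]

theorem trace_quadMat (t n a b : K) : (quadMat t n a b).trace = 2 * a + t * b := by
  rw [quadMat, Matrix.trace_fin_two_of]
  ring

theorem det_quadMat (t n a b : K) : (quadMat t n a b).det = normForm t n a b := by
  rw [quadMat, Matrix.det_fin_two_of, normForm]
  ring

/-- The matrix unit `e₂₂`; together with `1` it is a basis of `M₂(K)` over `K[θ]`. -/
def cornerMat : Mat K := !![0, 0; 0, 1]

theorem quadMat_add_mul_cornerMat (t n a b c d : K) :
    quadMat t n a b + quadMat t n c d * cornerMat =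
      !![a + b * t, b + d; -(n * b), a + c] := by
  apply mat_ext <;> simp [quadMat, cornerMat]

theorem cornerMat_mul_quadMat (t n a b : K) : cornerMat * quadMat t n a b =
    quadMat t n (-(t * b)) b + quadMat t n (a + t * b) (-b) * cornerMat := by
  rw [quadMat_add_mul_cornerMat]
  apply mat_ext <;> simp [quadMat, cornerMat, mul_comm]

theorem exists_eq_quadMat_add {t n : K} (hn : n ≠ 0) (y : Mat K) :
    ∃ a b c d : K, y = quadMat t n a b + quadMat t n c d * cornerMat := by
  refine ⟨y 0 0 + y 1 0 / n * t, -(y 1 0 / n), y 1 1 - (y 0 0 + y 1 0 / n * t),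
    y 0 1 + y 1 0 / n, ?_⟩
  rw [quadMat_add_mul_cornerMat]
  apply mat_ext <;> (simp; try field_simp)

end Matrices

variable {K : Type u} [Field K] [ValuativeRel K]

theorem quadMat_mem {R : Subalgebra 𝒪[K] (Mat K)} {t n : K} (h : quadMat t n 0 1 ∈ R)
    (a b : 𝒪[K]) : quadMat t n a b ∈ R := by
  rw [quadMat_eq]
  exact add_mem (R.smul_mem (one_mem R) a) (R.smul_mem h b)

section Powers

variable {t n p q : 𝒪[K]}

theorem exists_quadMat_pow_mul (t n p q a b : 𝒪[K]) (k : ℕ) :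
    ∃ c d : 𝒪[K], quadMat (t : K) n p q ^ k * quadMat (t : K) n a b = quadMat (t : K) n c d := by
  induction k with
  | zero => exact ⟨a, b, by rw [pow_zero, one_mul]⟩
  | succ k ih =>
    obtain ⟨c, d, h⟩ := ih
    rw [pow_succ', mul_assoc, h, quadMat_mul]
    exact ⟨p * c - n * q * d, p * d + q * c + t * q * d, rfl⟩

/-- Elements of unit norm are units of the quadratic order. -/
theorem exists_quadMat_mul_eq_one {a b : 𝒪[K]} (h : IsUnit (normForm t n a b)) :
    ∃ c d : 𝒪[K], quadMat (t : K) n c d * quadMat (t : K) n a b = 1 := by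
  obtain ⟨w, hw⟩ := h.exists_right_inv
  have hw' : ((a : K) ^ 2 + t * a * b + n * b ^ 2) * w = 1 := congrArg Subtype.val hw
  refine ⟨(a + t * b) * w, -b * w, ?_⟩
  rw [quadMat_mul, ← quadMat_one (t : K) n]
  push_cast
  congr 1
  · linear_combination hw'
  · ring

/-- Every nonzero element of the quadratic order is a power of the uniformizer times an element of
unit norm. -/
theorem IsUniformizerPair.exists_eq_pow_mul [IsDiscreteValuationRing 𝒪[K]]
    (h : IsUniformizerPair t n p q) {a b : 𝒪[K]} (hab : normForm t n a b ≠ 0) :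
    ∃ (k : ℕ) (c d : 𝒪[K]), IsUnit (normForm t n c d) ∧
      quadMat (t : K) n a b = quadMat (t : K) n p q ^ k * quadMat (t : K) n c d := by
  generalize hx : normForm t n a b = x at hab
  induction x using IsWellFounded.induction (DvdNotUnit (α := 𝒪[K])) generalizing a b with
  | _ x ih =>
    by_cases hu : IsUnit (normForm t n a b)
    · exact ⟨0, a, b, hu, by rw [pow_zero, one_mul]⟩
    · obtain ⟨a', b', ha, hb⟩ := h.exists_eq a b hu
      have h1 : x = normForm t n a' b' * normForm t n p q := by
        rw [← hx, ha, hb]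
        simp only [normForm]
        ring
      have h2 : normForm t n a' b' ≠ 0 := left_ne_zero_of_mul (h1 ▸ hab)
      obtain ⟨k, c, d, hcd, h3⟩ := ih _ ⟨h2, _, h.norm_not_isUnit, h1⟩ rfl h2
      refine ⟨k + 1, c, d, hcd, ?_⟩
      rw [pow_succ', mul_assoc, ← h3, quadMat_mul, ha, hb]
      rfl

theorem exists_quadMat_pow_inverse [IsDiscreteValuationRing 𝒪[K]]
    (h : IsUniformizerPair t n p q) (r : ℕ) : ∃ e f : K, quadMat (t : K) n e f *
      quadMat (t : K) n p q ^ r = 1 := by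
  have hN : normForm (t : K) n p q ≠ 0 := fun h0 => h.normForm_ne_zero (Subtype.ext h0)
  induction r with
  | zero => exact ⟨1, 0, by rw [pow_zero, mul_one, quadMat_one]⟩
  | succ r ih =>
    obtain ⟨e, f, hef⟩ := ih
    have h1 : quadMat (t : K) n ((p + t * q) / normForm (t : K) n p q)
        (-q / normForm (t : K) n p q) * quadMat (t : K) n p q = 1 := by
      rw [quadMat_mul, ← quadMat_one (t : K) n]
      congr 1
      · field_simp
        rw [normForm]
        ring
      · field_simp
        ring
    refine ⟨_, _, (congrArg (· * quadMat (t : K) n p q ^ (r + 1)) (quadMat_mul (t : K) n e f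
      ((p + t * q) / normForm (t : K) n p q) (-q / normForm (t : K) n p q)).symm).trans ?_⟩
    change quadMat (t : K) n e f * _ * _ = 1
    rw [pow_succ', mul_assoc, ← mul_assoc (quadMat (t : K) n _ _) (quadMat (t : K) n p q), h1,
      one_mul, hef]

end Powers

/-- The order with rows `(𝒪, 𝒪)` and `(n𝒪, 𝒪)` is `𝒪[θ] + 𝒪[θ] e₂₂`. -/
theorem memStd_and_iff (t n : 𝒪[K]) (y : Mat K) :
    (MemStd y ∧ ∃ c : 𝒪[K], y 1 0 = n * c) ↔
      ∃ a b c d : 𝒪[K], y = quadMat (t : K) n a b + quadMat (t : K) n c d * cornerMat := by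
  constructor
  · rintro ⟨h, e, he⟩
    refine ⟨⟨y 0 0, h 0 0⟩ + e * t, -e, ⟨y 1 1, h 1 1⟩ - (⟨y 0 0, h 0 0⟩ + e * t),
      ⟨y 0 1, h 0 1⟩ + e, ?_⟩
    rw [quadMat_add_mul_cornerMat]
    apply mat_ext <;> simp [he]
  · rintro ⟨a, b, c, d, rfl⟩
    rw [quadMat_add_mul_cornerMat]
    refine ⟨memStd_iff.2 ⟨?_, ?_, ?_, ?_⟩, -b, ?_⟩
    · exact (a + b * t).2
    · exact (b + d).2
    · exact (-(n * b)).2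
    · exact (a + c).2
    · simp

/-- `R = 𝒪[θ] + ϖ^r 𝒪[θ] e₂₂`, where `ϖ = p + qθ`; equivalently `R = 𝒪[θ] + ϖ^r 𝔄`, where
`𝔄 = 𝒪[θ] + 𝒪[θ] e₂₂` has rows `(𝒪, 𝒪)` and `(n𝒪, 𝒪)`. -/
def IsBasicOrder (t n p q : 𝒪[K]) (r : ℕ) (R : Subalgebra 𝒪[K] (Mat K)) : Prop :=
  ∀ y : Mat K, y ∈ R ↔ ∃ a b c d : 𝒪[K], y = quadMat (t : K) n a b +
    quadMat (t : K) n p q ^ r * (quadMat (t : K) n c d * cornerMat)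

theorem IsBasicOrder.mem_iff {t n p q : 𝒪[K]} {r : ℕ} {R : Subalgebra 𝒪[K] (Mat K)}
    (h : IsBasicOrder t n p q r R) (x : Mat K) :
    x ∈ R ↔ ∃ (a b : 𝒪[K]) (y : Mat K), (MemStd y ∧ ∃ c : 𝒪[K], y 1 0 = n * c) ∧
      x = quadMat (t : K) n a b + quadMat (t : K) n p q ^ r * y := by
  rw [h x]
  constructor
  · rintro ⟨a, b, c, d, rfl⟩
    refine ⟨a, b, quadMat (t : K) n c d * cornerMat, (memStd_and_iff t n _).2 ⟨0, 0, c, d, ?_⟩, rfl⟩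
    have : quadMat (t : K) n (0 : 𝒪[K]) (0 : 𝒪[K]) = 0 := by
      apply mat_ext <;> simp [quadMat]
    rw [this, zero_add]
  · rintro ⟨a, b, y, hy, rfl⟩
    obtain ⟨a', b', c, d, rfl⟩ := (memStd_and_iff t n y).1 hy
    obtain ⟨a'', b'', h'⟩ := exists_quadMat_pow_mul t n p q a' b' r
    refine ⟨a + a'', b + b'', c, d, ?_⟩
    rw [mul_add, h', ← add_assoc, quadMat_add]
    push_cast
    rfl

section Basic

variable {t n p q : 𝒪[K]} [IsDiscreteValuationRing 𝒪[K]]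

/-- The orders between `𝒪[θ]` and `𝔄` correspond to the nonzero ideals of the discrete valuation
ring `𝒪[θ]`, since `𝔄 / 𝒪[θ]` is free of rank one over it. -/
theorem exists_isBasicOrder (h : IsUniformizerPair t n p q) {R : Subalgebra 𝒪[K] (Mat K)}
    (hR : IsFullOrder R) (hθ : quadMat (t : K) n 0 1 ∈ R)
    (hle : ∀ y ∈ R, MemStd y ∧ ∃ c : 𝒪[K], y 1 0 = n * c) : ∃ r, IsBasicOrder t n p q r R := by
  classical
  have hn : (n : K) ≠ 0 := fun h0 => h.ne_zero (Subtype.ext h0)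
  have hcoe : ∀ a b : 𝒪[K], quadMat (t : K) n a b ∈ R := quadMat_mem hθ
  have hϖ : ∀ k, ∃ c d : 𝒪[K], quadMat (t : K) n p q ^ k = quadMat (t : K) n c d := by
    intro k
    obtain ⟨c, d, hcd⟩ := exists_quadMat_pow_mul t n p q 1 0 k
    refine ⟨c, d, ?_⟩
    rw [← hcd]
    have : quadMat (t : K) n (1 : 𝒪[K]) (0 : 𝒪[K]) = 1 := quadMat_one _ _
    rw [this, mul_one]
  -- a nonzero element `β e₂₂ ∈ R` yields `ϖ^k e₂₂ ∈ R`, where `k` is the valuation of `β`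
  have key : ∀ c d : 𝒪[K], ¬ (c = 0 ∧ d = 0) → quadMat (t : K) n c d * cornerMat ∈ R →
      ∃ (k : ℕ) (a b : 𝒪[K]), quadMat (t : K) n p q ^ k * cornerMat ∈ R ∧
        quadMat (t : K) n c d = quadMat (t : K) n p q ^ k * quadMat (t : K) n a b := by
    intro c d hcd hmem
    obtain ⟨k, a, b, hab, he⟩ := h.exists_eq_pow_mul (fun h0 => hcd (h.eq_zero h0))
    obtain ⟨a', b', hab'⟩ := exists_quadMat_mul_eq_one hab
    refine ⟨k, a, b, ?_, he⟩
    have := mul_mem (hcoe a' b') hmem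
    obtain ⟨e, f, hef⟩ := hϖ k
    rwa [he, hef, quadMat_mul_comm _ _ (e : K), mul_assoc, ← mul_assoc, hab', one_mul,
      ← hef] at this
  have hdec : ∀ y ∈ R, ∃ a b c d : 𝒪[K], y = quadMat (t : K) n a b +
      quadMat (t : K) n c d * cornerMat ∧ quadMat (t : K) n c d * cornerMat ∈ R := by
    intro y hy
    obtain ⟨a, b, c, d, he⟩ := (memStd_and_iff t n y).1 (hle y hy)
    refine ⟨a, b, c, d, he, ?_⟩
    have := sub_mem hy (hcoe a b)
    rwa [he, add_sub_cancel_left] at this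
  have hex : ∃ k, quadMat (t : K) n p q ^ k * cornerMat ∈ R := by
    by_contra! hno
    -- otherwise `R ⊆ K[θ]`, which is a proper subspace
    let f : Mat K →ₗ[K] K :=
      (n : K) • Matrix.entryLinearMap K K 0 1 + Matrix.entryLinearMap K K 1 0
    have h1 : Submodule.span K ((Subalgebra.toSubmodule R : Submodule 𝒪[K] (Mat K)) :
        Set (Mat K)) ≤ LinearMap.ker f := by
      rw [Submodule.span_le]
      intro y hy
      obtain ⟨a, b, c, d, rfl, hcd⟩ := hdec y hy
      by_cases h0 : c = 0 ∧ d = 0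
      · change (n : K) * _ + _ = 0
        rw [quadMat_add_mul_cornerMat, h0.1, h0.2]
        simp
      · obtain ⟨k, -, -, hk, -⟩ := key c d h0 hcd
        exact absurd hk (hno k)
    rw [hR.2] at h1
    have h2 : f (Matrix.single 0 1 1) = 0 := h1 trivial
    simp [f] at h2
    exact h.ne_zero h2
  refine ⟨Nat.find hex, fun y => ⟨fun hy => ?_, ?_⟩⟩
  · obtain ⟨a, b, c, d, rfl, hcd⟩ := hdec y hy
    by_cases h0 : c = 0 ∧ d = 0
    · refine ⟨a, b, 0, 0, ?_⟩
      rw [h0.1, h0.2]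
      have : quadMat (t : K) n (0 : 𝒪[K]) (0 : 𝒪[K]) = 0 := by
        apply mat_ext <;> simp [quadMat]
      rw [this, zero_mul, mul_zero]
    · obtain ⟨k, a', b', hk, he⟩ := key c d h0 hcd
      obtain ⟨m, rfl⟩ := Nat.exists_eq_add_of_le (Nat.find_min' hex hk)
      obtain ⟨c', d', hc'⟩ := exists_quadMat_pow_mul t n p q a' b' m
      refine ⟨a, b, c', d', ?_⟩
      rw [he, pow_add, mul_assoc (_ ^ Nat.find hex), hc', mul_assoc]
  · rintro ⟨a, b, c, d, rfl⟩
    refine add_mem (hcoe a b) ?_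
    obtain ⟨e, f, hef⟩ := hϖ (Nat.find hex)
    rw [← mul_assoc, hef, quadMat_mul_comm, ← hef, mul_assoc]
    exact mul_mem (hcoe c d) (Nat.find_spec hex)

/-- Basic orders are Gorenstein: the functional `α + βϖ^r e₂₂ ↦ σ(β)`, where `σ(a + bθ) = b`, is of
the form `y ↦ tr(cy)` and makes `R` self-dual because `σ` does so for `𝒪[θ]`. -/
theorem IsBasicOrder.isGorenstein (h : IsUniformizerPair t n p q) {r : ℕ}
    {R : Subalgebra 𝒪[K] (Mat K)} (hR : IsFullOrder R) (hb : IsBasicOrder t n p q r R) :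
    IsGorenstein R := by
  have hn : (n : K) ≠ 0 := fun h0 => h.ne_zero (Subtype.ext h0)
  obtain ⟨e, f, hef⟩ := exists_quadMat_pow_inverse h r
  set P : Mat K := quadMat (t : K) n p q ^ r with hP
  have hef' : P * quadMat (t : K) n e f = 1 := mul_eq_one_comm.1 hef
  let c₀ : GL (Fin 2) K := ⟨!![0, (n : K)⁻¹; 1, 0], !![0, 1; (n : K), 0],
    by apply mat_ext <;> simp [hn], by apply mat_ext <;> simp [hn]⟩
  let c : GL (Fin 2) K := c₀ * ⟨quadMat (t : K) n e f, P, hef, hef'⟩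
  have hc : ∀ y : Mat K, (c.1 * y).trace = (c₀.1 * (quadMat (t : K) n e f * y)).trace :=
    fun y => by rw [← mul_assoc]; rfl
  have hc₀ : ∀ a b a' b' : K, (c₀.1 * (quadMat (t : K) n a b +
      quadMat (t : K) n a' b' * cornerMat)).trace = b' := by
    intro a b a' b'
    rw [quadMat_add_mul_cornerMat]
    simp [c₀, Matrix.trace_fin_two, hn]
  have hlam : ∀ a b a' b' : K, (c.1 * (quadMat (t : K) n a b +
      P * (quadMat (t : K) n a' b' * cornerMat))).trace = b' := by
    intro a b a' b'
    rw [hc, mul_add, quadMat_mul, ← mul_assoc _ P, hef, one_mul, hc₀]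
  have hcomm : ∀ a b : K, P * quadMat (t : K) n a b = quadMat (t : K) n a b * P := by
    intro a b
    have : Commute (quadMat (t : K) n p q) (quadMat (t : K) n a b) := quadMat_mul_comm _ _ _ _ _ _
    exact this.pow_left r
  have hform : ∀ a b c d : 𝒪[K], quadMat (t : K) n a b +
      P * (quadMat (t : K) n c d * cornerMat) ∈ R := fun a b c d => (hb _).2 ⟨a, b, c, d, rfl⟩
  have hz : ∀ c d : 𝒪[K], P * (quadMat (t : K) n c d * cornerMat) ∈ R := by
    intro c d
    have h1 := hform 0 0 c d
    have h2 : quadMat (t : K) n (0 : 𝒪[K]) (0 : 𝒪[K]) = 0 := by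
      apply mat_ext <;> simp [quadMat]
    rwa [h2, zero_add] at h1
  have hq : ∀ a b : 𝒪[K], quadMat (t : K) n a b ∈ R := by
    intro a b
    have h1 := hform a b 0 0
    have h2 : quadMat (t : K) n (0 : 𝒪[K]) (0 : 𝒪[K]) = 0 := by
      apply mat_ext <;> simp [quadMat]
    rwa [h2, zero_mul, mul_zero, add_zero] at h1
  have hint : ∀ y ∈ R, (c.1 * y).trace ∈ 𝒪[K] := by
    intro y hy
    obtain ⟨a, b, a', b', rfl⟩ := (hb y).1 hy
    rw [hlam]
    exact b'.2
  have hdec : ∀ y : Mat K, ∃ a b c d : K, y = quadMat (t : K) n a b +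
      P * (quadMat (t : K) n c d * cornerMat) := by
    intro y
    obtain ⟨a, b, c, d, rfl⟩ := exists_eq_quadMat_add (t := (t : K)) hn y
    refine ⟨a, b, e * c - n * f * d, e * d + f * c + t * f * d, ?_⟩
    rw [← quadMat_mul, mul_assoc, ← mul_assoc P, hef', one_mul]
  obtain ⟨e', f', hP'⟩ : ∃ e' f' : K, P = quadMat (t : K) n e' f' := by
    obtain ⟨e', f', h1⟩ := exists_quadMat_pow_mul t n p q 1 0 r
    refine ⟨e', f', ?_⟩
    rw [← h1]
    have h2 : quadMat (t : K) n (1 : 𝒪[K]) (0 : 𝒪[K]) = 1 := quadMat_one _ _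
    rw [h2, mul_one]
  have hright : ∀ a b a' b' x y : K, (c.1 * ((quadMat (t : K) n a b +
      P * (quadMat (t : K) n a' b' * cornerMat)) * quadMat (t : K) n x y)).trace =
        b' * x - a' * y := by
    intro a b a' b' x y
    have e1 : (quadMat (t : K) n a b + P * (quadMat (t : K) n a' b' * cornerMat)) *
        quadMat (t : K) n x y = (quadMat (t : K) n a b * quadMat (t : K) n x y +
          P * (quadMat (t : K) n a' b' * quadMat (t : K) n (-(t * y)) y)) +
          P * (quadMat (t : K) n a' b' * quadMat (t : K) n (x + t * y) (-y) * cornerMat) := by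
      rw [add_mul, mul_assoc, mul_assoc, cornerMat_mul_quadMat]
      noncomm_ring
    rw [e1]
    nth_rewrite 1 [hP']
    rw [quadMat_mul, quadMat_mul, quadMat_mul, quadMat_mul, quadMat_add, hlam]
    ring
  have hleft : ∀ a b a' b' x y : K, (c.1 * (quadMat (t : K) n x y * (quadMat (t : K) n a b +
      P * (quadMat (t : K) n a' b' * cornerMat)))).trace = x * b' + y * a' + t * y * b' := by
    intro a b a' b' x y
    rw [mul_add, quadMat_mul, ← mul_assoc _ P, ← hcomm, mul_assoc P, ← mul_assoc _ _ cornerMat,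
      quadMat_mul, hlam]
  have h00 : quadMat (t : K) n 0 0 = 0 := by
    apply mat_ext <;> simp [quadMat]
  refine isGorenstein_of_selfDual hR c
    (fun y => ⟨fun hy => ?_, fun hy r hr => hint _ (mul_mem hy hr)⟩)
    (fun y => ⟨fun hy => ?_, fun hy r hr => hint _ (mul_mem hr hy)⟩)
  · obtain ⟨a, b, a', b', rfl⟩ := hdec y
    have h1 := hy _ (hq 1 0)
    have h2 := hy _ (hq 0 1)
    rw [hright] at h1 h2
    have hb' : b' ∈ 𝒪[K] := by simpa using h1
    have ha' : a' ∈ 𝒪[K] := by simpa using neg_mem h2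
    have hz' : ∀ x y : 𝒪[K], a * y + b * x + t * b * y ∈ 𝒪[K] := by
      intro x y
      have h3 := sub_mem (hy _ (hz x y)) (hint _ (mul_mem (hz ⟨a', ha'⟩ ⟨b', hb'⟩) (hz x y)))
      rw [add_mul, mul_add, Matrix.trace_add, add_sub_cancel_right] at h3
      have h4 := hleft 0 0 x y a b
      rw [h00, zero_add] at h4
      rwa [h4] at h3
    have hbO : b ∈ 𝒪[K] := by simpa using hz' 1 0
    have haO : a ∈ 𝒪[K] := by
      simpa using sub_mem (hz' 0 1) (mul_mem t.2 hbO)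
    exact hform ⟨a, haO⟩ ⟨b, hbO⟩ ⟨a', ha'⟩ ⟨b', hb'⟩
  · obtain ⟨a, b, a', b', rfl⟩ := hdec y
    have h1 := hy _ (hq 1 0)
    have h2 := hy _ (hq 0 1)
    rw [hleft] at h1 h2
    have hb' : b' ∈ 𝒪[K] := by simpa using h1
    have ha' : a' ∈ 𝒪[K] := by simpa using sub_mem h2 (mul_mem t.2 hb')
    have hz' : ∀ x y : 𝒪[K], y * a - x * b ∈ 𝒪[K] := by
      intro x y
      have h3 := sub_mem (hy _ (hz x y)) (hint _ (mul_mem (hz x y) (hz ⟨a', ha'⟩ ⟨b', hb'⟩)))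
      rw [mul_add, mul_add, Matrix.trace_add, add_sub_cancel_right] at h3
      have h4 := hright 0 0 x y a b
      rw [h00, zero_add] at h4
      rwa [h4] at h3
    have hbO : b ∈ 𝒪[K] := by simpa using neg_mem (hz' 1 0)
    have haO : a ∈ 𝒪[K] := by simpa using hz' 0 1
    exact hform ⟨a, haO⟩ ⟨b, hbO⟩ ⟨a', ha'⟩ ⟨b', hb'⟩

end Basic

end

/-! ### Orders containing a maximal quadratic order -/

section

variable {K : Type u} [Field K] [ValuativeRel K]

/-- The columns `xv, v` form a basis in which `x` is a companion matrix. -/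
theorem mul_cyclicMat {K : Type*} [Field K] (x : Mat K) (v₀ v₁ : K) :
    x * !![x 0 0 * v₀ + x 0 1 * v₁, v₀; x 1 0 * v₀ + x 1 1 * v₁, v₁] =
      !![x 0 0 * v₀ + x 0 1 * v₁, v₀; x 1 0 * v₀ + x 1 1 * v₁, v₁] *
        quadMat x.trace x.det 0 1 := by
  rw [Matrix.trace_fin_two, Matrix.det_fin_two]
  apply mat_ext <;> simp [quadMat, Matrix.mul_apply, Fin.sum_univ_two] <;> ring

variable [IsDiscreteValuationRing 𝒪[K]] {t n p q : 𝒪[K]}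

/-- An element generating a maximal quadratic order is not scalar modulo `𝓂[K]`, hence has a cyclic
vector over `𝒪[K]`. -/
theorem exists_integralGL_conj_eq (h : IsUniformizerPair t n p q) {x : Mat K} (hx : MemStd x)
    (ht : x.trace = t) (hn : x.det = n) :
    ∃ k : GL (Fin 2) K, IsIntegralGL k ∧ (conj k).symm x = quadMat (t : K) n 0 1 := by
  have key : ∀ v₀ v₁ d : 𝒪[K], (x 0 0 * v₀ + x 0 1 * v₁) * v₁ - v₀ * (x 1 0 * v₀ + x 1 1 * v₁) = d →
      IsUnit d → ∃ k : GL (Fin 2) K, IsIntegralGL k ∧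
        (conj k).symm x = quadMat (t : K) n 0 1 := by
    intro v₀ v₁ d hd hdu
    set m : Mat K := !![x 0 0 * v₀ + x 0 1 * v₁, v₀; x 1 0 * v₀ + x 1 1 * v₁, v₁] with hm
    have hdet : m.det = d := by rw [hm, Matrix.det_fin_two_of, hd]
    have hd0 : m.det ≠ 0 := by
      rw [hdet]
      exact fun h0 => hdu.ne_zero (Subtype.ext h0)
    refine ⟨Matrix.GeneralLinearGroup.mkOfDetNeZero m hd0, isIntegralGL_of_det ?_ ?_, ?_⟩
    · refine memStd_iff.2 ⟨?_, v₀.2, ?_, v₁.2⟩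
      · exact add_mem (mul_mem (hx 0 0) v₀.2) (mul_mem (hx 0 1) v₁.2)
      · exact add_mem (mul_mem (hx 1 0) v₀.2) (mul_mem (hx 1 1) v₁.2)
    · change m.det⁻¹ ∈ _
      rw [hdet]
      exact inv_mem_of_isUnit hdu
    · rw [conj_symm_apply, mul_assoc, Units.inv_mul_eq_iff_eq_mul, ← ht, ← hn]
      exact mul_cyclicMat x v₀ v₁
  obtain ⟨a, ha⟩ : ∃ a : 𝒪[K], x 0 0 = a := ⟨⟨_, hx 0 0⟩, rfl⟩
  obtain ⟨b, hb⟩ : ∃ b : 𝒪[K], x 0 1 = b := ⟨⟨_, hx 0 1⟩, rfl⟩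
  obtain ⟨c, hc⟩ : ∃ c : 𝒪[K], x 1 0 = c := ⟨⟨_, hx 1 0⟩, rfl⟩
  obtain ⟨d, hd⟩ : ∃ d : 𝒪[K], x 1 1 = d := ⟨⟨_, hx 1 1⟩, rfl⟩
  rw [ha, hb, hc, hd] at key
  by_cases hbu : IsUnit b
  · exact key 0 1 b (by push_cast; ring) hbu
  by_cases hcu : IsUnit c
  · exact key 1 0 (-c) (by push_cast; ring) hcu.neg
  by_cases hsu : IsUnit (a + b - c - d)
  · exact key 1 1 _ (by push_cast; ring) hsu
  exfalso
  obtain ⟨π, hπ⟩ := IsDiscreteValuationRing.exists_irreducible 𝒪[K]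
  rw [not_isUnit_iff_dvd hπ] at hbu hcu hsu
  have had : π ∣ d - a := by
    have e : d - a = b - c - (a + b - c - d) := by ring
    rw [e]
    exact dvd_sub (dvd_sub hbu hcu) hsu
  -- `x - a` has determinant divisible by `π²`
  have ht' : t = a + d := Subtype.ext (by rw [← ht, Matrix.trace_fin_two, ha, hd]; rfl)
  have hn' : n = a * d - b * c :=
    Subtype.ext (by rw [← hn, Matrix.det_fin_two, ha, hb, hc, hd]; rfl)
  have h1 : π ^ 2 ∣ normForm t n (-a) 1 := by
    have e : normForm t n (-a) 1 = -(b * c) := by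
      rw [normForm, ht', hn']
      ring
    rw [e, sq]
    exact (mul_dvd_mul hbu hcu).neg_right
  exact hπ.not_isUnit (isUnit_of_dvd_one (h.dvd_of_sq_dvd π _ _ hπ h1).2)

/-- An order containing `θ` is conjugate to an order in `M₂(𝒪[K])` in which `θ` is a companion
matrix. -/
theorem exists_conj_eq_quadMat (h : IsUniformizerPair t n p q) {R : Subalgebra 𝒪[K] (Mat K)}
    (hR : IsFullOrder R) {x : Mat K} (hx : x ∈ R) (ht : x.trace = t) (hn : x.det = n) :
    ∃ (g : GL (Fin 2) K) (R₀ : Subalgebra 𝒪[K] (Mat K)), R = conjOrder g R₀ ∧ IsFullOrder R₀ ∧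
      quadMat (t : K) n 0 1 ∈ R₀ ∧ R₀ ≤ stdOrder := by
  obtain ⟨g, hg⟩ := exists_le_conjOrder_std hR.1
  obtain ⟨k, hk, hkx⟩ := exists_integralGL_conj_eq h (mem_conjOrder.1 (hg hx))
    (by rw [trace_conj_symm, ht]) (by rw [det_conj_symm, hn])
  refine ⟨g * k, conjOrder (g * k)⁻¹ R, (conjOrder_conjOrder_inv _ _).symm, hR.conjOrder _, ?_, ?_⟩
  · rwa [mem_conjOrder, conj_symm_eq, inv_inv, conj_mul, ← hkx, AlgEquiv.apply_symm_apply,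
      AlgEquiv.apply_symm_apply]
  · rw [← hk.conjOrder_std, ← conjOrder_mul] at hg
    have h1 := conjOrder_mono (g * k)⁻¹ hg
    rwa [conjOrder_inv_conjOrder] at h1

/-- Here `n` is a unit, so the lower left entries of `𝔄` are unrestricted and `𝔄 = M₂(𝒪[K])`. -/
theorem exists_conjOrder_isBasicOrder_of_unramified {π : 𝒪[K]} (hπ : Irreducible π)
    {R : Subalgebra 𝒪[K] (Mat K)} (hR : IsFullOrder R) {x : Mat K} (hx : x ∈ R)
    (ht : x.trace = t) (hn : x.det = n) (hu : ∀ a : 𝒪[K], IsUnit (a ^ 2 - t * a + n)) :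
    ∃ (g : GL (Fin 2) K) (R₀ : Subalgebra 𝒪[K] (Mat K)) (r : ℕ), R = conjOrder g R₀ ∧
      IsBasicOrder t n π 0 r R₀ ∧ IsFullOrder R₀ := by
  have h := isUniformizerPair_of_unramified hπ hu
  obtain ⟨g, R₀, hg, hR₀, hθ, hle⟩ := exists_conj_eq_quadMat h hR hx ht hn
  obtain ⟨w, hw⟩ := IsUnit.exists_right_inv (a := n) (by simpa using hu 0)
  have hw' : (n : K) * w = 1 := congrArg Subtype.val hw
  obtain ⟨r, hr⟩ := exists_isBasicOrder h hR₀ hθ fun y hy =>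
    ⟨hle hy, w * ⟨_, hle hy 1 0⟩, by push_cast; rw [← mul_assoc, hw', one_mul]⟩
  exact ⟨g, R₀, r, hg, hr, hR₀⟩

/-- Once `θ` is a companion matrix, the order lies in `𝔄`: if the lower left entry of some `y` were
a unit, then `θy` would be a split element. -/
theorem exists_conjOrder_isBasicOrder_of_eisenstein
    {R : Subalgebra 𝒪[K] (Mat K)} (hR : IsFullOrder R) {x : Mat K} (hx : x ∈ R)
    (ht : x.trace = t) (hn : x.det = n) (htu : ¬ IsUnit t) (hni : Irreducible n)
    (hs : ¬ HasSplitElement R) :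
    ∃ (g : GL (Fin 2) K) (R₀ : Subalgebra 𝒪[K] (Mat K)) (r : ℕ), R = conjOrder g R₀ ∧
      IsBasicOrder t n 0 1 r R₀ ∧ IsFullOrder R₀ := by
  have h := isUniformizerPair_of_eisenstein htu hni
  obtain ⟨g, R₀, hg, hR₀, hθ, hle⟩ := exists_conj_eq_quadMat h hR hx ht hn
  obtain ⟨r, hr⟩ := exists_isBasicOrder h hR₀ hθ fun y hy => by
    refine ⟨hle hy, ?_⟩
    obtain ⟨a, ha⟩ : ∃ a : 𝒪[K], y 0 0 = a := ⟨⟨_, hle hy 0 0⟩, rfl⟩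
    obtain ⟨b, hb⟩ : ∃ b : 𝒪[K], y 0 1 = b := ⟨⟨_, hle hy 0 1⟩, rfl⟩
    obtain ⟨c, hc⟩ : ∃ c : 𝒪[K], y 1 0 = c := ⟨⟨_, hle hy 1 0⟩, rfl⟩
    obtain ⟨d, hd⟩ : ∃ d : 𝒪[K], y 1 1 = d := ⟨⟨_, hle hy 1 1⟩, rfl⟩
    rw [hc]
    suffices n ∣ c by
      obtain ⟨e, rfl⟩ := this
      exact ⟨e, rfl⟩
    by_contra hcn
    have hmem := mul_mem hθ hy
    apply hs
    refine ⟨conj g (quadMat (t : K) n 0 1 * y), hg ▸ conj_mem_conjOrder.2 hmem,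
      t * a + c - n * b, n * (a * d - b * c), ?_, ?_, ?_, ?_⟩
    · rw [trace_conj, Matrix.trace_fin_two, Matrix.mul_apply, Matrix.mul_apply, Fin.sum_univ_two,
        Fin.sum_univ_two, ha, hb, hc, hd]
      simp [quadMat]
      ring
    · rw [det_conj, Matrix.det_mul, det_quadMat, Matrix.det_fin_two, ha, hb, hc, hd]
      simp [normForm]
    · by_contra hu
      rw [not_isUnit_iff_dvd hni] at hu htu
      apply hcn
      have e : c = (t * a + c - n * b) - t * a + n * b := by ring
      rw [e]
      exact dvd_add (dvd_sub hu (htu.mul_right _)) (dvd_mul_right _ _)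
    · exact (not_isUnit_iff_dvd hni).2 (dvd_mul_right _ _)
  exact ⟨g, R₀, r, hg, hr, hR₀⟩

theorem HasUnramifiedElement.isGorenstein {R : Subalgebra 𝒪[K] (Mat K)} (hR : IsFullOrder R)
    (h : HasUnramifiedElement R) : IsGorenstein R := by
  obtain ⟨x, hx, t, n, ht, hn, hu⟩ := h
  obtain ⟨π, hπ⟩ := IsDiscreteValuationRing.exists_irreducible 𝒪[K]
  obtain ⟨g, R₀, r, rfl, hb, hR₀⟩ :=
    exists_conjOrder_isBasicOrder_of_unramified hπ hR hx ht hn hu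
  exact (hb.isGorenstein (isUniformizerPair_of_unramified hπ hu) hR₀).conjOrder g

end

/-! ### Quadratic extensions embedded in `M₂(K)` -/

section

variable {K : Type u} [Field K] [ValuativeRel K]

section Embedded

variable {L : Type u} [Field L] [Algebra K L] (φ : L →ₐ[K] Mat K)

theorem map_smul_integer (c : 𝒪[K]) (y : L) : φ (c • y) = (c : K) • φ y := by
  have h : c • y = (c : K) • y := rfl
  rw [h, map_smul]

theorem det_map_smul (π : 𝒪[K]) (z : integralClosure 𝒪[K] L) :
    (φ (π • z : integralClosure 𝒪[K] L)).det = (π : K) ^ 2 * (φ z).det := by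
  have : ((π • z : integralClosure 𝒪[K] L) : L) = π • (z : L) := rfl
  rw [this, map_smul_integer, Matrix.det_smul, Fintype.card_fin]

variable [IsDiscreteValuationRing 𝒪[K]]

/-- An element of `L` is integral exactly when its trace and its norm are; both are read off from
the image in `M₂(K)`, where integral elements lie in a finitely generated order. -/
theorem mem_integralClosure_iff (y : L) : y ∈ integralClosure 𝒪[K] L ↔
    (φ y).trace ∈ 𝒪[K] ∧ (φ y).det ∈ 𝒪[K] := by
  constructor
  · intro hy
    have hfg := IsIntegral.fg_adjoin_singleton (x := y) hy
    have hfg' : (Subalgebra.toSubmodule ((Algebra.adjoin 𝒪[K] {y}).map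
        (φ.restrictScalars 𝒪[K]))).FG := hfg.map (φ.restrictScalars 𝒪[K]).toLinearMap
    have hmem : φ y ∈ (Algebra.adjoin 𝒪[K] {y}).map (φ.restrictScalars 𝒪[K]) :=
      ⟨y, Algebra.self_mem_adjoin_singleton _ _, rfl⟩
    exact ⟨trace_mem_integer hfg' hmem, det_mem_integer hfg' hmem⟩
  · rintro ⟨ht, hn⟩
    refine ⟨Polynomial.X ^ 2 - Polynomial.C ⟨_, ht⟩ * Polynomial.X + Polynomial.C ⟨_, hn⟩,
      by monicity!, ?_⟩
    rw [← Polynomial.aeval_def]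
    apply φ.toRingHom.injective
    simp only [map_add, map_sub, map_mul, map_pow, Polynomial.aeval_X, Polynomial.aeval_C]
    change φ y ^ 2 - φ (algebraMap K L (φ y).trace) * φ y + φ (algebraMap K L (φ y).det) = φ 0
    rw [AlgHom.commutes, AlgHom.commutes, sq, mul_self_eq, map_zero,
      Algebra.algebraMap_eq_smul_one, Algebra.algebraMap_eq_smul_one, smul_mul_assoc, one_mul]
    abel

theorem exists_lift_trace_det (y : integralClosure 𝒪[K] L) :
    ∃ t n : 𝒪[K], (φ y).trace = t ∧ (φ y).det = n := by
  obtain ⟨h1, h2⟩ := (mem_integralClosure_iff φ y.1).1 y.2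
  exact ⟨⟨_, h1⟩, ⟨_, h2⟩, rfl, rfl⟩

theorem isUnit_integralClosure_iff (y : integralClosure 𝒪[K] L) {n : 𝒪[K]}
    (hn : (φ y).det = n) : IsUnit y ↔ IsUnit n := by
  constructor
  · intro h
    obtain ⟨z, hz⟩ := h.exists_right_inv
    obtain ⟨-, m, -, hm⟩ := exists_lift_trace_det φ z
    refine IsUnit.of_mul_eq_one m (Subtype.ext ?_)
    change (n : K) * m = 1
    rw [← hn, ← hm, ← Matrix.det_mul, ← map_mul]
    have : (y : L) * z = 1 := congrArg Subtype.val hz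
    rw [this, map_one, Matrix.det_one]
  · intro h
    obtain ⟨w, hw⟩ := h.exists_right_inv
    obtain ⟨t, -, ht, -⟩ := exists_lift_trace_det φ y
    -- the inverse of `y` is its conjugate divided by its norm
    refine IsUnit.of_mul_eq_one (w • (algebraMap 𝒪[K] (integralClosure 𝒪[K] L) t - y))
      (Subtype.ext (φ.toRingHom.injective ?_))
    change φ (y * (w • (algebraMap K L t - (y : L)))) = φ 1
    have hw' : (n : K) * w = 1 := congrArg Subtype.val hw
    rw [map_mul, map_smul_integer, map_sub, AlgHom.commutes, map_one, mul_smul_comm, mul_sub,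
      mul_self_eq, ht, hn, Algebra.algebraMap_eq_smul_one, mul_smul_comm, mul_one,
      sub_sub_cancel, smul_smul, mul_comm, hw', one_smul]

theorem mem_map_maximalIdeal_iff {π : 𝒪[K]} (hπ : Irreducible π) (y : integralClosure 𝒪[K] L) :
    y ∈ Ideal.map (algebraMap 𝒪[K] (integralClosure 𝒪[K] L)) 𝓂[K] ↔
      ∃ z : integralClosure 𝒪[K] L, y = π • z := by
  rw [(IsDiscreteValuationRing.irreducible_iff_uniformizer π).1 hπ, Ideal.map_span,
    Set.image_singleton, Ideal.mem_span_singleton]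
  simp only [Algebra.smul_def]
  rfl

/-- `𝓂[K]` generates a maximal ideal of `𝒪_L` exactly when it generates the set of all nonunits. The
embedding is needed to recognise units by their norms. -/
theorem isMaximal_map_iff (φ : L →ₐ[K] Mat K) :
    (Ideal.map (algebraMap 𝒪[K] (integralClosure 𝒪[K] L)) 𝓂[K]).IsMaximal ↔
    ∀ y : integralClosure 𝒪[K] L, ¬ IsUnit y →
      y ∈ Ideal.map (algebraMap 𝒪[K] (integralClosure 𝒪[K] L)) 𝓂[K] := by
  obtain ⟨π, hπ⟩ := IsDiscreteValuationRing.exists_irreducible 𝒪[K]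
  constructor
  · intro hmax y hy
    by_contra hyI
    obtain ⟨z, i, hi, hzi⟩ := hmax.exists_inv hyI
    obtain ⟨w, rfl⟩ := (mem_map_maximalIdeal_iff hπ i).1 hi
    apply hy
    obtain ⟨s, m, hs, hm⟩ := exists_lift_trace_det φ w
    have h1 : IsUnit (1 + π * (π * m - s)) := by
      by_contra h
      refine (not_isUnit_iff_dvd hπ).2 ?_ (isUnit_one (M := 𝒪[K]))
      exact (dvd_add_left (dvd_mul_right π _)).1 ((not_isUnit_iff_dvd hπ).1 h)
    -- `zy = 1 - πw` has unit norm
    have h2 : z * y = 1 - π • w := eq_sub_of_add_eq hzi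
    have h3 : IsUnit (z * y) := by
      rw [isUnit_integralClosure_iff φ (z * y) (n := 1 + π * (π * m - s))]
      · exact h1
      · rw [h2]
        change (φ (1 - π • (w : L))).det = _
        rw [map_sub, map_one, map_smul_integer]
        rw [Matrix.trace_fin_two] at hs
        rw [Matrix.det_fin_two] at hm ⊢
        push_cast
        simp
        linear_combination (π : K) ^ 2 * hm - π * hs
    exact isUnit_of_mul_isUnit_right h3
  · intro h
    refine Ideal.isMaximal_iff.2 ⟨fun h1 => ?_, fun J x _ hx hxJ => ?_⟩
    · obtain ⟨z, hz⟩ := (mem_map_maximalIdeal_iff hπ 1).1 h1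
      obtain ⟨-, m, -, hm⟩ := exists_lift_trace_det φ z
      have h2 := det_map_smul φ π z
      rw [← hz, hm] at h2
      have h3 : (1 : 𝒪[K]) = π * (π * m) := by
        refine Subtype.ext ?_
        have h4 : (φ ((1 : integralClosure 𝒪[K] L) : L)).det = 1 := by
          change (φ 1).det = 1
          rw [map_one, Matrix.det_one]
        rw [h4] at h2
        push_cast
        rw [h2]
        ring
      exact hπ.not_isUnit (IsUnit.of_mul_eq_one _ h3.symm)
    · have hu : IsUnit x := by
        by_contra hu
        exact hx (h x hu)
      rw [Ideal.eq_top_of_isUnit_mem J hxJ hu]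
      trivial

end Embedded

section Generator

variable {t n p q : 𝒪[K]} {L : Type u} [Field L] [Algebra K L] {φ : L →ₐ[K] Mat K} {θ : L}

theorem map_add_smul_eq (hθ : φ θ = quadMat (t : K) n 0 1) (a b : K) :
    φ (algebraMap K L a + b • θ) = quadMat (t : K) n a b := by
  rw [map_add, AlgHom.commutes, map_smul, hθ, quadMat_eq _ _ a b, Algebra.algebraMap_eq_smul_one]

theorem exists_eq_add_smul (hL : Module.finrank K L = 2) (hθ : φ θ = quadMat (t : K) n 0 1)
    (y : L) : ∃ a b : K, y = algebraMap K L a + b • θ := by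
  have : FiniteDimensional K L := Module.finite_of_finrank_pos (by rw [hL]; norm_num)
  have hli : LinearIndependent K ![1, θ] := by
    rw [LinearIndependent.pair_iff]
    intro a b hab
    have h1 := congrArg φ hab
    rw [← Algebra.algebraMap_eq_smul_one, map_add_smul_eq hθ, map_zero] at h1
    have h2 := congrFun (congrFun h1 1) 1
    have h3 := congrFun (congrFun h1 0) 1
    exact ⟨by simpa [quadMat] using h2, by simpa [quadMat] using h3⟩
  have hspan := hli.span_eq_top_of_card_eq_finrank' (by rw [hL, Fintype.card_fin])
  have hy : y ∈ Submodule.span K (Set.range ![1, θ]) := hspan ▸ trivial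
  rw [Matrix.range_cons, Matrix.range_cons, Matrix.range_empty, Set.union_empty,
    Set.singleton_union, Submodule.mem_span_pair] at hy
  obtain ⟨a, b, rfl⟩ := hy
  exact ⟨a, b, by rw [Algebra.algebraMap_eq_smul_one]⟩

variable [IsDiscreteValuationRing 𝒪[K]]

/-- The ring of integers is `𝒪[K][θ]`. -/
theorem mem_integralClosure_iff_quadMat (h : IsUniformizerPair t n p q)
    (hL : Module.finrank K L = 2) (hθ : φ θ = quadMat (t : K) n 0 1) (y : L) :
    y ∈ integralClosure 𝒪[K] L ↔ ∃ a b : 𝒪[K], φ y = quadMat (t : K) n a b := by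
  rw [mem_integralClosure_iff φ]
  constructor
  · rintro ⟨-, hn⟩
    obtain ⟨a, b, rfl⟩ := exists_eq_add_smul hL hθ y
    rw [map_add_smul_eq hθ] at hn ⊢
    rw [det_quadMat] at hn
    obtain ⟨a₁, s₁, hs₁, rfl⟩ := IsFractionRing.div_surjective (A := 𝒪[K]) a
    obtain ⟨a₂, s₂, hs₂, rfl⟩ := IsFractionRing.div_surjective (A := 𝒪[K]) b
    have hs₁' := nonZeroDivisors.ne_zero hs₁
    have hs₂' := nonZeroDivisors.ne_zero hs₂
    have h1 : (s₁ : K) ≠ 0 := fun h => hs₁' (Subtype.ext h)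
    have h2 : (s₂ : K) ≠ 0 := fun h => hs₂' (Subtype.ext h)
    change normForm (t : K) n (a₁ / s₁ : K) (a₂ / s₂ : K) ∈ 𝒪[K] at hn
    obtain ⟨⟨c, hc⟩, ⟨d, hd⟩⟩ := h.dvd_of_normForm_eq (mul_ne_zero hs₁' hs₂') (a := a₁ * s₂)
      (b := a₂ * s₁) (m := ⟨_, hn⟩) (Subtype.ext (by
        push_cast [normForm]
        field_simp))
    refine ⟨c, d, ?_⟩
    have hc' : (a₁ : K) * s₂ = s₁ * s₂ * c := congrArg Subtype.val hc
    have hd' : (a₂ : K) * s₁ = s₁ * s₂ * d := congrArg Subtype.val hd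
    change quadMat (t : K) n (a₁ / s₁ : K) (a₂ / s₂ : K) = _
    have e1 : (a₁ : K) / s₁ = c := by
      field_simp
      exact mul_right_cancel₀ h2 (by linear_combination hc')
    have e2 : (a₂ : K) / s₂ = d := by
      field_simp
      exact mul_right_cancel₀ h1 (by linear_combination hd')
    rw [e1, e2]
  · rintro ⟨a, b, hab⟩
    rw [hab, trace_quadMat, det_quadMat]
    exact ⟨(2 * a + t * b : 𝒪[K]).2, (normForm t n a b).2⟩

theorem isUnramifiedQuadratic_of_pair {π : 𝒪[K]} (hπ : Irreducible π)
    (hu : ∀ a : 𝒪[K], IsUnit (a ^ 2 - t * a + n))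
    (hL : Module.finrank K L = 2) (hθ : φ θ = quadMat (t : K) n 0 1) :
    IsUnramifiedQuadratic K L := by
  have h := isUniformizerPair_of_unramified hπ hu
  refine ⟨hL, (isMaximal_map_iff φ).2 fun y hy => ?_⟩
  obtain ⟨a, b, hab⟩ := (mem_integralClosure_iff_quadMat h hL hθ y).1 y.2
  have hn : (φ y).det = (normForm t n a b : 𝒪[K]) := by
    rw [hab, det_quadMat]
    rfl
  rw [isUnit_integralClosure_iff φ y hn, not_isUnit_iff_dvd hπ] at hy
  obtain ⟨⟨a', rfl⟩, ⟨b', rfl⟩⟩ := dvd_of_dvd_normForm hπ hu hy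
  have hz := (mem_integralClosure_iff_quadMat h hL hθ
    (algebraMap K L a' + (b' : K) • θ)).2 ⟨a', b', map_add_smul_eq hθ _ _⟩
  refine (mem_map_maximalIdeal_iff hπ y).2 ⟨⟨_, hz⟩, Subtype.ext (φ.toRingHom.injective ?_)⟩
  change φ y = φ (π • (algebraMap K L a' + (b' : K) • θ))
  rw [map_smul_integer, map_add_smul_eq hθ, hab]
  apply mat_ext <;> simp [quadMat] <;> ring

theorem isRamifiedQuadratic_of_pair (ht : ¬ IsUnit t) (hni : Irreducible n)
    (hL : Module.finrank K L = 2) (hθ : φ θ = quadMat (t : K) n 0 1) :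
    IsRamifiedQuadratic K L ∧ ∃ hmem : θ ∈ integralClosure 𝒪[K] L,
      Irreducible (⟨θ, hmem⟩ : integralClosure 𝒪[K] L) := by
  have h := isUniformizerPair_of_eisenstein ht hni
  have hmem : θ ∈ integralClosure 𝒪[K] L :=
    (mem_integralClosure_iff_quadMat h hL hθ θ).2 ⟨0, 1, by rw [hθ]; rfl⟩
  have hdet : (φ ((⟨θ, hmem⟩ : integralClosure 𝒪[K] L) : L)).det = n := by
    rw [hθ, det_quadMat, normForm]
    ring
  have hnu : ¬ IsUnit (⟨θ, hmem⟩ : integralClosure 𝒪[K] L) := by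
    rw [isUnit_integralClosure_iff φ _ hdet]
    exact hni.not_isUnit
  refine ⟨⟨hL, fun hmax => ?_⟩, hmem, hnu, fun a b hab => ?_⟩
  · obtain ⟨z, hz⟩ := (mem_map_maximalIdeal_iff hni _).1 ((isMaximal_map_iff φ).1 hmax _ hnu)
    obtain ⟨-, m, -, hm⟩ := exists_lift_trace_det φ z
    have h1 := det_map_smul φ n z
    rw [← hz, hdet, hm] at h1
    have h2 : n * 1 = n * (n * m) := Subtype.ext (by
      push_cast
      linear_combination h1)
    exact hni.not_isUnit (IsUnit.of_mul_eq_one _ (mul_left_cancel₀ hni.ne_zero h2).symm)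
  · obtain ⟨-, α, -, hα⟩ := exists_lift_trace_det φ a
    obtain ⟨-, β, -, hβ⟩ := exists_lift_trace_det φ b
    have h1 : n = α * β := by
      refine Subtype.ext ?_
      push_cast
      rw [← hdet, hab, ← hα, ← hβ, ← Matrix.det_mul, ← map_mul]
      rfl
    rw [isUnit_integralClosure_iff φ a hα, isUnit_integralClosure_iff φ b hβ]
    exact hni.isUnit_or_isUnit h1

/-- The field `K[θ]`, realised by the matrices `quadMat t n a b`. -/
theorem exists_quadratic_embedding (h : IsUniformizerPair t n p q) :
    ∃ (L : Type u) (_ : Field L) (_ : Algebra K L) (φ : L →ₐ[K] Mat K) (θ : L),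
      Module.finrank K L = 2 ∧ φ θ = quadMat (t : K) n 0 1 := by
  let f : Polynomial K := Polynomial.X ^ 2 - Polynomial.C (t : K) * Polynomial.X +
    Polynomial.C (n : K)
  have hdeg : f.natDegree = 2 := by
    simp only [f]
    compute_degree!
  have hirr : Irreducible f := by
    refine Polynomial.irreducible_of_degree_le_three_of_not_isRoot (by rw [hdeg]; decide) ?_
    intro s hs
    obtain ⟨a, b, hb, rfl⟩ := IsFractionRing.div_surjective (A := 𝒪[K]) s
    have hb0 := nonZeroDivisors.ne_zero hb
    have hb' : (b : K) ≠ 0 := fun h => hb0 (Subtype.ext h)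
    change f.IsRoot ((a : K) / b) at hs
    have h1 : ((a : K) / b) ^ 2 - t * (a / b) + n = 0 := by simpa [f] using hs
    refine hb0 (h.eq_zero (a := -a) (b := b) (Subtype.ext ?_)).2
    field_simp at h1
    push_cast [normForm]
    linear_combination h1
  have : Fact (Irreducible f) := ⟨hirr⟩
  let ψ : Polynomial K →ₐ[K] Mat K := Polynomial.aeval (quadMat (t : K) n 0 1)
  have hψ : ∀ a ∈ Ideal.span {f}, ψ a = 0 := by
    intro a ha
    obtain ⟨b, rfl⟩ := Ideal.mem_span_singleton.1 ha
    have hf : ψ f = 0 := by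
      simp only [ψ, f, map_add, map_sub, map_mul, map_pow, Polynomial.aeval_X, Polynomial.aeval_C]
      apply mat_ext <;>
        simp [quadMat, sq, Matrix.mul_apply, Matrix.algebraMap_matrix_apply, mul_comm]
    rw [map_mul, hf, zero_mul]
  refine ⟨AdjoinRoot f, inferInstance, inferInstance, Ideal.Quotient.liftₐ (Ideal.span {f}) ψ hψ,
    AdjoinRoot.root f, ?_, ?_⟩
  · rw [(AdjoinRoot.powerBasis hirr.ne_zero).finrank, AdjoinRoot.powerBasis_dim, hdeg]
  · change ψ Polynomial.X = _
    exact Polynomial.aeval_X _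

end Generator

end

/-! ### Unramified and Eisenstein elements in rings of integers -/

section

variable {K : Type u} [Field K] [ValuativeRel K] [IsDiscreteValuationRing 𝒪[K]]

section Elements

variable {L : Type u} [Field L] [Algebra K L] (φ : L →ₐ[K] Mat K)

theorem exists_smul_mem_integralClosure (φ : L →ₐ[K] Mat K) (y : L) :
    ∃ s : 𝒪[K], s ≠ 0 ∧ s • y ∈ integralClosure 𝒪[K] L := by
  obtain ⟨a, s, hs, ha⟩ := IsFractionRing.div_surjective (A := 𝒪[K]) (φ y).trace
  obtain ⟨b, s', hs', hb⟩ := IsFractionRing.div_surjective (A := 𝒪[K]) (φ y).det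
  have h1 := nonZeroDivisors.ne_zero hs
  have h1' := nonZeroDivisors.ne_zero hs'
  have h2 : (s : K) ≠ 0 := fun h => h1 (Subtype.ext h)
  have h2' : (s' : K) ≠ 0 := fun h => h1' (Subtype.ext h)
  change (a : K) / s = _ at ha
  change (b : K) / s' = _ at hb
  refine ⟨s * s', mul_ne_zero h1 h1', (mem_integralClosure_iff φ _).2 ?_⟩
  rw [map_smul_integer, Matrix.trace_smul, Matrix.det_smul, Fintype.card_fin, ← ha, ← hb]
  have e1 : ((s * s' : 𝒪[K]) : K) • ((a : K) / s) = (s' * a : 𝒪[K]) := by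
    push_cast
    rw [smul_eq_mul]
    field_simp
  have e2 : ((s * s' : 𝒪[K]) : K) ^ 2 * ((b : K) / s') = (s ^ 2 * s' * b : 𝒪[K]) := by
    push_cast
    field_simp
  rw [e1, e2]
  exact ⟨SetLike.coe_mem _, SetLike.coe_mem _⟩

/-- If no integer of `L` generated the residue extension, then `𝒪_L = 𝒪[K] + 𝓂[K] 𝒪_L`, whence
`𝒪_L = 𝒪[K]` by Nakayama's lemma. -/
theorem IsUnramifiedQuadratic.hasUnramifiedElement {φ : L →ₐ[K] Mat K}
    (hL : IsUnramifiedQuadratic K L) {D : Subalgebra 𝒪[K] (Mat K)}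
    (hD : (Subalgebra.toSubmodule D).FG) (hφ : ∀ a ∈ integralClosure 𝒪[K] L, φ a ∈ D) :
    ∃ y ∈ integralClosure 𝒪[K] L, ∃ t n : 𝒪[K], (φ y).trace = t ∧ (φ y).det = n ∧
      ∀ a : 𝒪[K], IsUnit (a ^ 2 - t * a + n) := by
  by_contra! hno
  obtain ⟨π, hπ⟩ := IsDiscreteValuationRing.exists_irreducible 𝒪[K]
  let N : Submodule 𝒪[K] (Mat K) := Subalgebra.toSubmodule
    ((integralClosure 𝒪[K] L).map (φ.restrictScalars 𝒪[K]))
  have hN : ∀ x, x ∈ N ↔ ∃ y ∈ integralClosure 𝒪[K] L, φ y = x := fun x => Iff.rfl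
  have hfg : N.FG := by
    refine Submodule.FG.of_le hD fun x hx => ?_
    obtain ⟨y, hy, rfl⟩ := (hN x).1 hx
    exact hφ y hy
  have hle : N ≤ Submodule.span 𝒪[K] {1} ⊔ 𝓂[K] • N := by
    intro x hx
    obtain ⟨y, hy, rfl⟩ := (hN x).1 hx
    obtain ⟨t, n, ht, hn⟩ := exists_lift_trace_det φ ⟨y, hy⟩
    obtain ⟨a, ha⟩ := hno y hy t n ht hn
    set z : integralClosure 𝒪[K] L := ⟨y, hy⟩ - algebraMap 𝒪[K] _ a with hz
    have hφz : φ z = φ y - (a : K) • 1 := by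
      change φ (y - algebraMap K L a) = _
      rw [map_sub, AlgHom.commutes, Algebra.algebraMap_eq_smul_one]
    have hdet : (φ z).det = (a ^ 2 - t * a + n : 𝒪[K]) := by
      rw [Matrix.trace_fin_two] at ht
      rw [Matrix.det_fin_two] at hn
      rw [hφz, Matrix.det_fin_two]
      push_cast
      simp
      linear_combination hn - a * ht
    rw [← isUnit_integralClosure_iff φ z hdet] at ha
    obtain ⟨w, hw⟩ := (mem_map_maximalIdeal_iff hπ z).1 ((isMaximal_map_iff φ).1 hL.2 z ha)
    refine Submodule.mem_sup.2 ⟨a • 1, Submodule.smul_mem _ _ (Submodule.mem_span_singleton_self 1),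
      π • φ w, Submodule.smul_mem_smul ?_ ((hN _).2 ⟨w, w.2, rfl⟩), ?_⟩
    · exact (IsLocalRing.mem_maximalIdeal _).2 hπ.not_isUnit
    · have h1 : φ z = (π : K) • φ w := by
        rw [hw]
        exact map_smul_integer φ π w
      rw [coe_smul_eq, coe_smul_eq, ← h1, hφz, add_sub_cancel]
  have hN1 : N ≤ Submodule.span 𝒪[K] {1} :=
    Submodule.le_of_le_smul_of_le_jacobson_bot hfg (IsLocalRing.maximalIdeal_le_jacobson _) hle
  have hfin : Module.finrank K L ≤ 1 := by
    refine finrank_le_one 1 fun y => ?_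
    obtain ⟨s, hs, hy⟩ := exists_smul_mem_integralClosure φ y
    have hs' : (s : K) ≠ 0 := fun h => hs (Subtype.ext h)
    obtain ⟨c, hc⟩ := Submodule.mem_span_singleton.1 (hN1 ((hN _).2 ⟨_, hy, rfl⟩))
    refine ⟨(s : K)⁻¹ * c, φ.toRingHom.injective ?_⟩
    change φ (((s : K)⁻¹ * c) • 1) = φ y
    rw [map_smul_integer] at hc
    rw [map_smul, map_one, mul_smul, ← coe_smul_eq, hc, inv_smul_smul₀ hs']
  rw [hL.1] at hfin
  omega

/-- A nonunit of `𝒪_L` outside `𝓂[K] 𝒪_L` has an Eisenstein characteristic polynomial; its trace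
is a nonunit since Hensel's lemma would otherwise split the polynomial. -/
theorem IsRamifiedQuadratic.exists_eisenstein [TopologicalSpace K] [IsNonarchimedeanLocalField K]
    (hL : IsRamifiedQuadratic K L) :
    ∃ y ∈ integralClosure 𝒪[K] L, ∃ t n : 𝒪[K], (φ y).trace = t ∧ (φ y).det = n ∧
      ¬ IsUnit t ∧ Irreducible n := by
  obtain ⟨π, hπ⟩ := IsDiscreteValuationRing.exists_irreducible 𝒪[K]
  have h0 := coe_ne_zero_of_irreducible hπ
  have hmax := hL.2
  rw [isMaximal_map_iff φ] at hmax
  push Not at hmax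
  obtain ⟨y, hyu, hyI⟩ := hmax
  rw [mem_map_maximalIdeal_iff hπ] at hyI
  push Not at hyI
  obtain ⟨t, n, ht, hn⟩ := exists_lift_trace_det φ y
  have hnu : ¬ IsUnit n := by rwa [← isUnit_integralClosure_iff φ y hn]
  have htu : ¬ IsUnit t := by
    intro htu
    obtain ⟨a, ha, hau⟩ := exists_root_of_isUnit htu hnu
    have hroot : (y - algebraMap 𝒪[K] _ a) * (y - algebraMap 𝒪[K] _ (t - a)) = 0 := by
      refine Subtype.ext (φ.toRingHom.injective ?_)
      change φ ((y - algebraMap K L a) * (y - algebraMap K L (t - a : 𝒪[K]))) = φ 0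
      have ha' : (a : K) ^ 2 - t * a + n = 0 := by exact_mod_cast congrArg Subtype.val ha
      have hsq := mul_self_eq (φ y)
      rw [ht, hn] at hsq
      rw [map_mul, map_sub, map_sub, AlgHom.commutes, AlgHom.commutes, map_zero,
        Algebra.algebraMap_eq_smul_one, Algebra.algebraMap_eq_smul_one, sub_mul, mul_sub, mul_sub,
        hsq, smul_mul_assoc, smul_mul_assoc, mul_smul_comm, one_mul, mul_one, one_mul]
      push_cast
      have hn' : (n : K) = (t - a) * a := by linear_combination ha'
      rw [hn']
      module
    rcases mul_eq_zero.1 hroot with h | h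
    · obtain ⟨b, rfl⟩ := (not_isUnit_iff_dvd hπ).1 hau
      refine hyI (algebraMap 𝒪[K] _ b) ?_
      rw [sub_eq_zero.1 h, map_mul, Algebra.smul_def]
    · apply hyu
      rw [sub_eq_zero.1 h]
      refine IsUnit.map _ ?_
      by_contra hu
      rw [not_isUnit_iff_dvd hπ] at hu hau
      have := dvd_add hu hau
      rw [sub_add_cancel] at this
      exact (not_isUnit_iff_dvd hπ).2 this htu
  refine ⟨y, y.2, t, n, ht, hn, htu, ?_⟩
  obtain ⟨m, rfl⟩ := (not_isUnit_iff_dvd hπ).1 hnu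
  obtain ⟨s, rfl⟩ := (not_isUnit_iff_dvd hπ).1 htu
  refine (irreducible_mul_isUnit ?_).2 hπ
  by_contra hm
  obtain ⟨k, rfl⟩ := (not_isUnit_iff_dvd hπ).1 hm
  -- otherwise `π⁻¹ y` is integral
  have hz : (π : K)⁻¹ • (y : L) ∈ integralClosure 𝒪[K] L := by
    rw [mem_integralClosure_iff φ, map_smul, Matrix.trace_smul, Matrix.det_smul, Fintype.card_fin,
      ht, hn]
    push_cast
    rw [smul_eq_mul, inv_mul_cancel_left₀ h0]
    refine ⟨s.2, ?_⟩
    have e : (π : K)⁻¹ ^ 2 * (π * (π * k)) = k := by field_simp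
    rw [e]
    exact k.2
  refine hyI ⟨_, hz⟩ (Subtype.ext ?_)
  change (y : L) = (π : K) • ((π : K)⁻¹ • (y : L))
  rw [smul_inv_smul₀ h0]

end Elements

end

/-! ### Unramified and Eisenstein elements in Eichler orders -/

section

variable {K : Type u} [Field K] [ValuativeRel K]

theorem HasUnramifiedElement.conjOrder {R : Subalgebra 𝒪[K] (Mat K)} (h : HasUnramifiedElement R)
    (g : GL (Fin 2) K) : HasUnramifiedElement (conjOrder g R) := by
  obtain ⟨x, hx, t, n, ht, hn, hu⟩ := h
  exact ⟨conj g x, conj_mem_conjOrder.2 hx, t, n, by rwa [trace_conj], by rwa [det_conj], hu⟩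

section Existence

variable [TopologicalSpace K] [IsNonarchimedeanLocalField K]

/-- The map `x ↦ x² - x` is not injective on the finite residue field, hence not surjective. -/
theorem exists_unramified_pair : ∃ t n : 𝒪[K], ∀ a : 𝒪[K], IsUnit (a ^ 2 - t * a + n) := by
  obtain ⟨m, hm⟩ : ∃ m : 𝓀[K], ∀ x : 𝓀[K], x ^ 2 - x ≠ m := by
    by_contra! h
    have hinj : Function.Injective fun x : 𝓀[K] => x ^ 2 - x := Finite.injective_iff_surjective.2 h
    exact zero_ne_one (hinj (by simp : (0 : 𝓀[K]) ^ 2 - 0 = 1 ^ 2 - 1))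
  obtain ⟨n, rfl⟩ := IsLocalRing.residue_surjective m
  refine ⟨1, -n, fun a => ?_⟩
  by_contra ha
  have h0 := (IsLocalRing.residue_eq_zero_iff _).2 ((IsLocalRing.mem_maximalIdeal _).2 ha)
  refine hm (IsLocalRing.residue _ a) ?_
  rw [← sub_eq_zero, ← h0]
  simp [sub_eq_add_neg]

theorem hasUnramifiedElement_stdOrder :
    HasUnramifiedElement (stdOrder : Subalgebra 𝒪[K] (Mat K)) := by
  obtain ⟨t, n, h⟩ := exists_unramified_pair (K := K)
  refine ⟨quadMat (t : K) n 0 1, ?_, t, n, ?_, ?_, h⟩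
  · refine mem_stdOrder.2 (memStd_iff.2 ?_)
    simp [quadMat, one_mem, zero_mem]
  · rw [trace_quadMat]
    ring
  · rw [det_quadMat, normForm]
    ring

end Existence

/-- The Eichler order of level one contains the ring of integers of `K(√-π)`. -/
theorem isBasicOrder_eichler_one {π : 𝒪[K]} (hπ : Irreducible π) :
    IsBasicOrder 0 π 0 1 0 (eichler hπ 1) := by
  intro y
  simp only [pow_zero, one_mul]
  rw [← memStd_and_iff, mem_eichler_one]

section Discrete

variable [IsDiscreteValuationRing 𝒪[K]] {π : 𝒪[K]}

/-- An unramified element fixes only one vertex of the tree. -/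
theorem HasUnramifiedElement.eq_of_le {B D D' : Subalgebra 𝒪[K] (Mat K)}
    (h : HasUnramifiedElement B) (hD : IsMaximalOrder D) (hD' : IsMaximalOrder D') (hBD : B ≤ D)
    (hBD' : B ≤ D') : D = D' := by
  obtain ⟨x, hx, t, n, ht, hn, hu⟩ := h
  obtain ⟨π, hπ⟩ := IsDiscreteValuationRing.exists_irreducible 𝒪[K]
  obtain ⟨g, d, h1, h2⟩ := exists_eq_vertex hπ ⟨D, hD⟩ ⟨D', hD'⟩
  have h1' : D = BassOrders.conjOrder g stdOrder := congrArg Subtype.val h1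
  have h2' : D' = BassOrders.conjOrder (g * shift hπ ^ d) stdOrder := congrArg Subtype.val h2
  rcases d with _ | d
  · rw [h1', h2', pow_zero, mul_one]
  exfalso
  have hE : (conj g).symm x ∈ eichler hπ (d + 1) := by
    have hx1 := hBD hx
    have hx2 := hBD' hx
    rw [h1'] at hx1
    rw [h2', conjOrder_mul] at hx2
    exact ⟨mem_conjOrder.1 hx1, mem_conjOrder.1 hx2⟩
  rw [← trace_conj_symm g, Matrix.trace_fin_two] at ht
  rw [← det_conj_symm g, Matrix.det_fin_two] at hn
  obtain ⟨ha, hb, ⟨c, hc, hc'⟩, he⟩ := (mem_eichler hπ).1 hE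
  have hu' := hu ⟨_, ha⟩
  have e : (⟨_, ha⟩ : 𝒪[K]) ^ 2 - t * ⟨_, ha⟩ + n = π * (-(π ^ d * ⟨_, hb⟩ * ⟨_, hc⟩)) := by
    refine Subtype.ext ?_
    push_cast
    rw [← ht, ← hn, hc']
    ring
  rw [e] at hu'
  exact hπ.not_isUnit (isUnit_of_mul_isUnit_left hu')

/-- Up to conjugation, the elements of such an order are upper triangular modulo `π²`; if trace and
determinant are nonunits, then `π` divides both diagonal entries, so `π²` divides the
determinant. -/
theorem not_hasEisensteinElement_conjOrder_eichler (hπ : Irreducible π) (g : GL (Fin 2) K) {d : ℕ}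
    (hd : 2 ≤ d) : ¬ HasEisensteinElement (conjOrder g (eichler hπ d)) := by
  rintro ⟨x, hx, t, n, ht, hn, htu, hni⟩
  rw [← trace_conj_symm g, Matrix.trace_fin_two] at ht
  rw [← det_conj_symm g, Matrix.det_fin_two] at hn
  obtain ⟨ha, hb, ⟨c, hc, hc'⟩, he⟩ := (mem_eichler hπ).1 (mem_conjOrder.1 hx)
  obtain ⟨a, ha'⟩ : ∃ a : 𝒪[K], (conj g).symm x 0 0 = a := ⟨⟨_, ha⟩, rfl⟩
  obtain ⟨e, he'⟩ : ∃ e : 𝒪[K], (conj g).symm x 1 1 = e := ⟨⟨_, he⟩, rfl⟩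
  obtain ⟨k, rfl⟩ := Nat.exists_eq_add_of_le hd
  have ht' : a + e = t := Subtype.ext (by
    push_cast
    rw [← ht, ha', he'])
  have hn' : n = a * e - π ^ 2 * (π ^ k * ⟨_, hb⟩ * ⟨c, hc⟩) := Subtype.ext (by
    push_cast
    rw [← hn, ha', he', hc', pow_add]
    ring)
  have hπt := (not_isUnit_iff_dvd hπ).1 htu
  have hπn := (not_isUnit_iff_dvd hπ).1 hni.not_isUnit
  have hπae : π ∣ a * e := by
    have : a * e = n + π ^ 2 * (π ^ k * ⟨_, hb⟩ * ⟨c, hc⟩) := by rw [hn']; ring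
    rw [this]
    exact dvd_add hπn ((dvd_pow_self π two_ne_zero).mul_right _)
  have hboth : π ∣ a ∧ π ∣ e := by
    rw [← ht'] at hπt
    rcases hπ.prime.dvd_or_dvd hπae with h | h
    · exact ⟨h, (dvd_add_right h).1 hπt⟩
    · exact ⟨(dvd_add_left h).1 hπt, h⟩
  have hsq : π * π ∣ n := by
    rw [hn']
    refine dvd_sub (mul_dvd_mul hboth.1 hboth.2) ?_
    rw [sq]
    exact dvd_mul_right _ _
  obtain ⟨m, hm⟩ := hsq
  rcases hni.isUnit_or_isUnit (hm.trans (mul_assoc _ _ _)) with h | h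
  · exact hπ.not_isUnit h
  · exact hπ.not_isUnit (isUnit_of_mul_isUnit_left h)

/-! ### Basic orders in terms of quadratic extensions -/

section Basic

variable {t n p q : 𝒪[K]} {r : ℕ}

theorem condE1_of_isBasicOrder (hπ : Irreducible π) (hu : ∀ a : 𝒪[K], IsUnit (a ^ 2 - t * a + n))
    {g : GL (Fin 2) K} {R : Subalgebra 𝒪[K] (Mat K)} (hR : IsBasicOrder t n π 0 r R) :
    CondE1 (conjOrder g R) := by
  have h := isUniformizerPair_of_unramified hπ hu
  obtain ⟨w, hw⟩ := IsUnit.exists_right_inv (a := n) (by simpa using hu 0)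
  have hw' : (n : K) * w = 1 := congrArg Subtype.val hw
  obtain ⟨L, _, _, φ, θ, hL, hθ⟩ := exists_quadratic_embedding h
  have hOL := mem_integralClosure_iff_quadMat h hL hθ
  have hstd : ∀ y : Mat K, (MemStd y ∧ ∃ c : 𝒪[K], y 1 0 = n * c) ↔ y ∈ stdOrder := by
    intro y
    refine ⟨fun hy => hy.1, fun hy => ⟨hy, w * ⟨y 1 0, hy 1 0⟩, ?_⟩⟩
    push_cast
    rw [← mul_assoc, hw', one_mul]
  have hpow : ∀ y : Mat K, quadMat (t : K) n (π : K) (0 : 𝒪[K]) ^ r * y = π ^ r • y := by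
    intro y
    have e : quadMat (t : K) n (π : K) (0 : 𝒪[K]) = algebraMap 𝒪[K] (Mat K) π := by
      rw [Algebra.algebraMap_eq_smul_one, coe_smul_eq]
      apply mat_ext <;> simp [quadMat]
    rw [e, ← map_pow, ← Algebra.smul_def]
  have hquad : ∀ a b : 𝒪[K], quadMat (t : K) n a b ∈ stdOrder := fun a b => by
    refine mem_stdOrder.2 (memStd_iff.2 ⟨(a + b * t : 𝒪[K]).2, b.2, (-(n * b) : 𝒪[K]).2, a.2⟩)
  have hmem : ∀ x : Mat K, x ∈ conjOrder g R ↔ ∃ a ∈ integralClosure 𝒪[K] L,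
      ∃ y ∈ conjOrder g stdOrder, x = (conjHom g).comp φ a + π ^ r • y := by
    intro x
    rw [mem_conjOrder, hR.mem_iff]
    constructor
    · rintro ⟨a, b, y, hy, hx⟩
      refine ⟨algebraMap K L a + (b : K) • θ, (hOL _).2 ⟨a, b, map_add_smul_eq hθ _ _⟩, conj g y,
        conj_mem_conjOrder.2 ((hstd y).1 hy), ?_⟩
      rw [hpow] at hx
      rw [AlgHom.comp_apply, map_add_smul_eq hθ, conjHom_apply, ← map_smul, ← map_add, ← hx,
        AlgEquiv.apply_symm_apply]
    · rintro ⟨a, ha, y, hy, rfl⟩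
      obtain ⟨a₁, a₂, ha'⟩ := (hOL a).1 ha
      refine ⟨a₁, a₂, (conj g).symm y, (hstd _).2 (mem_conjOrder.1 hy), ?_⟩
      rw [AlgHom.comp_apply, conjHom_apply, map_add, AlgEquiv.symm_apply_apply, ha', map_smul, hpow]
  have hφ : ∀ a ∈ integralClosure 𝒪[K] L, (conjHom g).comp φ a ∈ conjOrder g stdOrder := by
    intro a ha
    obtain ⟨a₁, a₂, ha'⟩ := (hOL a).1 ha
    rw [AlgHom.comp_apply, conjHom_apply, ha', conj_mem_conjOrder]
    exact hquad a₁ a₂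
  have hle : conjOrder g R ≤ conjOrder g stdOrder := by
    intro x hx
    obtain ⟨a, ha, y, hy, rfl⟩ := (hmem x).1 hx
    exact add_mem (hφ a ha) (Subalgebra.smul_mem _ hy _)
  have hun : HasUnramifiedElement (conjOrder g R) := by
    refine HasUnramifiedElement.conjOrder ⟨quadMat (t : K) n (0 : 𝒪[K]) (1 : 𝒪[K]),
      (hR.mem_iff _).2 ⟨0, 1, 0, (hstd 0).2 (zero_mem _), by rw [mul_zero, add_zero]⟩,
      t, n, ?_, ?_, hu⟩ g
    · rw [trace_quadMat]
      simp
    · rw [det_quadMat]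
      simp [normForm]
  exact ⟨_, isMaximalOrder_conjOrder_std g, hle,
    fun D' hD' hBD' => hun.eq_of_le hD' (isMaximalOrder_conjOrder_std g) hBD' hle,
    L, _, _, (conjHom g).comp φ, isUnramifiedQuadratic_of_pair hπ hu hL hθ, hφ, π, r, hπ, hmem⟩

theorem condE2_of_isBasicOrder (ht : ¬ IsUnit t) (hn : Irreducible n)
    {g : GL (Fin 2) K} {R : Subalgebra 𝒪[K] (Mat K)} (hR : IsBasicOrder t n 0 1 r R) :
    CondE2 (conjOrder g R) := by
  have h := isUniformizerPair_of_eisenstein ht hn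
  obtain ⟨L, _, _, φ, θ, hL, hθ⟩ := exists_quadratic_embedding h
  have hOL := mem_integralClosure_iff_quadMat h hL hθ
  have hinf : conjOrder g stdOrder ⊓ conjOrder (g * shift hn) stdOrder =
      conjOrder g (eichler hn 1) := by
    rw [eichler, conjOrder_inf, ← conjOrder_mul, pow_one]
  have hquad : ∀ a b : 𝒪[K], quadMat (t : K) n a b ∈ eichler hn 1 := fun a b =>
    (mem_eichler_one hn).2 ⟨memStd_iff.2 ⟨(a + b * t : 𝒪[K]).2, b.2, (-(n * b) : 𝒪[K]).2, a.2⟩,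
      -b, by simp [quadMat]⟩
  have hmem : ∀ x : Mat K, x ∈ conjOrder g R ↔ ∃ a ∈ integralClosure 𝒪[K] L,
      ∃ y ∈ conjOrder g (eichler hn 1),
        x = (conjHom g).comp φ a + (conjHom g).comp φ θ ^ r * y := by
    intro x
    rw [mem_conjOrder, hR.mem_iff]
    constructor
    · rintro ⟨a, b, y, hy, hx⟩
      refine ⟨algebraMap K L a + (b : K) • θ, (hOL _).2 ⟨a, b, map_add_smul_eq hθ _ _⟩, conj g y,
        conj_mem_conjOrder.2 ((mem_eichler_one hn).2 hy), ?_⟩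
      rw [AlgHom.comp_apply, AlgHom.comp_apply, map_add_smul_eq hθ, hθ, conjHom_apply,
        conjHom_apply, ← map_pow, ← map_mul, ← map_add]
      exact (AlgEquiv.symm_apply_eq _).1 hx
    · rintro ⟨a, ha, y, hy, rfl⟩
      obtain ⟨a₁, a₂, ha'⟩ := (hOL a).1 ha
      refine ⟨a₁, a₂, (conj g).symm y, (mem_eichler_one hn).1 (mem_conjOrder.1 hy), ?_⟩
      rw [AlgHom.comp_apply, AlgHom.comp_apply, conjHom_apply, conjHom_apply, map_add, map_mul,
        map_pow, AlgEquiv.symm_apply_apply, AlgEquiv.symm_apply_apply, ha', hθ]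
      rfl
  have hφ : ∀ a ∈ integralClosure 𝒪[K] L, (conjHom g).comp φ a ∈ conjOrder g (eichler hn 1) := by
    intro a ha
    obtain ⟨a₁, a₂, ha'⟩ := (hOL a).1 ha
    rw [AlgHom.comp_apply, conjHom_apply, ha', conj_mem_conjOrder]
    exact hquad a₁ a₂
  obtain ⟨hram, hθL, hϖ⟩ := isRamifiedQuadratic_of_pair ht hn hL hθ
  have hle : conjOrder g R ≤ conjOrder g (eichler hn 1) := by
    intro x hx
    obtain ⟨a, ha, y, hy, rfl⟩ := (hmem x).1 hx
    exact add_mem (hφ a ha) (mul_mem (pow_mem (hφ θ hθL) r) hy)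
  rw [← hinf] at hle hφ
  simp only [← hinf] at hmem
  exact ⟨_, _, isMaximalOrder_conjOrder_std g, isMaximalOrder_conjOrder_std _,
    areNeighbors_shift hn g, hle.trans inf_le_left, hle.trans inf_le_right,
    L, _, _, (conjHom g).comp φ, hram, hφ, ⟨θ, hθL⟩, r, hϖ, hmem⟩

end Basic

end Discrete

/-! ### The classification -/

variable {B : Subalgebra 𝒪[K] (Mat K)}

theorem not_condE1_and_condE2 : ¬ (CondE1 B ∧ CondE2 B) := by
  rintro ⟨⟨D, -, -, huniq, -⟩, D₁, D₂, hD₁, hD₂, hadj, h1, h2, -⟩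
  exact hadj.ne ((huniq D₁ hD₁ h1).trans (huniq D₂ hD₂ h2).symm)

theorem not_condE1_and_condE3 : ¬ (CondE1 B ∧ CondE3 B) := by
  rintro ⟨⟨D, -, -, huniq, -⟩, d, hd, D₁, D₂, -, hdist, rfl⟩
  have h : D₁ = D₂ := Subtype.ext
    ((huniq D₁ D₁.2 inf_le_left).trans (huniq D₂ D₂.2 inf_le_right).symm)
  rw [h, SimpleGraph.dist_self] at hdist
  omega

section Discrete

variable [IsDiscreteValuationRing 𝒪[K]]

theorem CondE1.hasUnramifiedElement (h : CondE1 B) : HasUnramifiedElement B := by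
  obtain ⟨D, hD, -, -, L, _, _, φ, hL, hφ, π, r, -, hmem⟩ := h
  obtain ⟨y, hy, t, n, ht, hn, hu⟩ := hL.hasUnramifiedElement hD.1.1 hφ
  exact ⟨φ y, (hmem _).2 ⟨y, hy, 0, zero_mem _, by rw [smul_zero, add_zero]⟩, t, n, ht, hn, hu⟩

theorem CondE3.hasSplitElement (h : CondE3 B) : HasSplitElement B := by
  obtain ⟨d, -, hE⟩ := h
  obtain ⟨π, hπ⟩ := IsDiscreteValuationRing.exists_irreducible 𝒪[K]
  obtain ⟨g, rfl⟩ := hE.exists_eq_conjOrder hπ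
  exact hasSplitElement_conjOrder_eichler hπ g d

theorem HasUnramifiedElement.condE1 (hB : IsFullOrder B) (h : HasUnramifiedElement B) :
    CondE1 B := by
  obtain ⟨x, hx, t, n, ht, hn, hu⟩ := h
  obtain ⟨π, hπ⟩ := IsDiscreteValuationRing.exists_irreducible 𝒪[K]
  obtain ⟨g, R, r, rfl, hR, -⟩ := exists_conjOrder_isBasicOrder_of_unramified hπ hB hx ht hn hu
  exact condE1_of_isBasicOrder hπ hu hR

end Discrete

section LocalField

variable [TopologicalSpace K] [IsNonarchimedeanLocalField K]

theorem CondE2.hasEisensteinElement (h : CondE2 B) : HasEisensteinElement B := by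
  obtain ⟨D₁, D₂, -, -, -, -, -, L, _, _, φ, hL, -, ϖ, r, -, hmem⟩ := h
  obtain ⟨y, hy, t, n, ht, hn, htu, hni⟩ := hL.exists_eisenstein φ
  exact ⟨φ y, (hmem _).2 ⟨y, hy, 0, zero_mem _, by rw [mul_zero, add_zero]⟩, t, n, ht, hn, htu,
    hni⟩

/-- Eichler orders of level zero and one fall under (E1) and (E2). -/
theorem HasSplitElement.condE (hB : IsFullOrder B) (h : HasSplitElement B) :
    CondE1 B ∨ CondE2 B ∨ CondE3 B := by
  obtain ⟨π, hπ⟩ := IsDiscreteValuationRing.exists_irreducible 𝒪[K]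
  obtain ⟨g, d, rfl⟩ := h.exists_eq_conjOrder_eichler hπ hB
  rcases d with _ | _ | d
  · left
    refine HasUnramifiedElement.condE1 hB (HasUnramifiedElement.conjOrder ?_ g)
    have : eichler hπ 0 = stdOrder := by
      rw [eichler, pow_zero, conjOrder_one, inf_idem]
    rw [this]
    exact hasUnramifiedElement_stdOrder
  · right
    left
    exact condE2_of_isBasicOrder not_isUnit_zero hπ (isBasicOrder_eichler_one hπ)
  · exact .inr (.inr ⟨d + 2, by omega, isEichlerOfLevel_conjOrder hπ g _⟩)

theorem HasEisensteinElement.isGorenstein (hB : IsFullOrder B) (h : HasEisensteinElement B) :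
    IsGorenstein B := by
  by_cases hs : HasSplitElement B
  · exact hs.isGorenstein hB
  obtain ⟨x, hx, t, n, ht, hn, htu, hni⟩ := h
  obtain ⟨g, R, r, rfl, hb, hR⟩ :=
    exists_conjOrder_isBasicOrder_of_eisenstein hB hx ht hn htu hni hs
  exact (hb.isGorenstein (isUniformizerPair_of_eisenstein htu hni) hR).conjOrder g

theorem IsBass.condE (hB : IsBass B) : CondE1 B ∨ CondE2 B ∨ CondE3 B := by
  by_cases hs : HasSplitElement B
  · exact hs.condE hB.1
  rcases hB.exists_element with h | h | ⟨x, hx, t, n, ht, hn, htu, hni⟩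
  · exact absurd h hs
  · exact .inl (h.condE1 hB.1)
  · obtain ⟨g, R, r, rfl, hb, -⟩ :=
      exists_conjOrder_isBasicOrder_of_eisenstein hB.1 hx ht hn htu hni hs
    exact .inr (.inl (condE2_of_isBasicOrder htu hni hb))

/-- The three kinds of elements pass to overorders, and each of them makes an order Gorenstein. -/
theorem isBass_of_condE (hB : IsFullOrder B) (h : CondE1 B ∨ CondE2 B ∨ CondE3 B) : IsBass B := by
  refine ⟨hB, fun R hR hBR => ?_⟩
  rcases h with h | h | h
  · obtain ⟨x, hx, h'⟩ := h.hasUnramifiedElement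
    exact HasUnramifiedElement.isGorenstein hR ⟨x, hBR hx, h'⟩
  · obtain ⟨x, hx, h'⟩ := h.hasEisensteinElement
    exact HasEisensteinElement.isGorenstein hR ⟨x, hBR hx, h'⟩
  · exact (h.hasSplitElement.mono hBR).isGorenstein hR

theorem not_condE2_and_condE3 : ¬ (CondE2 B ∧ CondE3 B) := by
  rintro ⟨h2, d, hd, hE⟩
  obtain ⟨π, hπ⟩ := IsDiscreteValuationRing.exists_irreducible 𝒪[K]
  obtain ⟨g, rfl⟩ := hE.exists_eq_conjOrder hπ
  exact not_hasEisensteinElement_conjOrder_eichler hπ g hd h2.hasEisensteinElement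

end LocalField

end

end BassOrders

theorem proposition4p1 {K : Type*} [Field K] [ValuativeRel K] [TopologicalSpace K]
    [IsNonarchimedeanLocalField K] (B : Subalgebra 𝒪[K] (Matrix (Fin 2) (Fin 2) K)) :
    (BassOrders.IsBass B →
      (BassOrders.CondE1 B ∨ BassOrders.CondE2 B ∨ BassOrders.CondE3 B) ∧
      ¬ (BassOrders.CondE1 B ∧ BassOrders.CondE2 B) ∧
      ¬ (BassOrders.CondE1 B ∧ BassOrders.CondE3 B) ∧
      ¬ (BassOrders.CondE2 B ∧ BassOrders.CondE3 B)) ∧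
    (BassOrders.IsFullOrder B →
      (BassOrders.CondE1 B ∨ BassOrders.CondE2 B ∨ BassOrders.CondE3 B) →
      BassOrders.IsBass B) := by
  exact ⟨fun hB => ⟨hB.condE, BassOrders.not_condE1_and_condE2, BassOrders.not_condE1_and_condE3,
    BassOrders.not_condE2_and_condE3⟩, BassOrders.isBass_of_condE⟩
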